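/- **Setting.** Let $L>0$, $L_0\in\mathbb N$, $L_0\ge 1$, $L_N=2^NL_0$, $\varepsilon_N=L/L_N$. Fix a boundary condition: periodic (Ramond, $+$) or anti-periodic (Neveu–Schwarz, $-$), with shift $\delta=0$ or $\delta=\tfrac12$, and a chirality $\chi\in\{1,-1\}$. Put $\Gamma_\infty=\tfrac{\pi}{L}(\mathbb Z+\delta)$ and $\Gamma_N=\tfrac{\pi}{L}(\{-L_N,\dots,L_N-1\}+\delta)$; $\Gamma_{\infty,+}$, $\Gamma_{N,+}$ are the sets with $\delta=0$. Let $\mathfrak h=L^2(\mathbb R/2L\mathbb Z)$ (with the given boundary condition), with plane waves $e_l$, $l\in\Gamma_\infty$, $\|e_l\|^2=2L$, whose span is $\mathcal D_{\rm std}$; let $\mathfrak h_N$ be the $2L_N$-dimensional space with orthogonal basis $e_l$, $l\in\Gamma_N$, $\|e_l\|^2=2L_N$. Momenta of $\mathfrak h_N$ are understood modulo $2\pi/\varepsilon_N$. For $k\in\tfrac{\pi}{L}\mathbb Z$ let $$\ell_{\chi,k}=\tfrac{\chi}{2\pi}\sum_{l\in\Gamma_\infty}(l-\tfrac{\chi k}{2})\,e_{l-\chi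 k}\otimes\bar e_l\ \text{ on }\mathcal D_{\rm std},\qquad \ell^{(N)}_{\chi,k}=\tfrac{\chi}{2\pi}\sum_{l\in\Gamma_N}\cos(\tfrac{\varepsilon_Nk}{4})^2\sin\!\big(\varepsilon_N(l-\tfrac{\chi k}{2})\big)\,e_{l-\chi k}\otimes\bar e_l\ \text{ on }\mathfrak h_N$$ (the one-particle Virasoro generators and Koo–Saleur approximants), $r_{\chi,k}=\tfrac12(\ell_{\chi,k}+\ell_{\chi,-k})$, $\iota_{\chi,k}=\tfrac1{2i}(\ell_{\chi,k}-\ell_{\chi,-k})$, and likewise $r^{(N)}_{\chi,k},\iota^{(N)}_{\chi,k}$. For a map $R^N_\infty:\mathfrak h_N\to\mathfrak h$ and $o^{(N)}$ on $\mathfrak h_N$ let $\tilde o^{(N)}=R^N_\infty\,o^{(N)}\,(R^N_\infty)^*$. Let $\mathfrak A=\mathfrak A_{\rm CAR}(\mathfrak h)$ be the CAR algebra, generated by $a(\xi)$, $\xi\in\mathfrak h$. A quasi-free representation is $\pi(a(\xi))=a((1-P)V\xi)+a^\dagger(JPV\xi)$ on the anti-symmetric Fock space over a Hilbert space $\mathfrak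 k$, where $V:\mathfrak h\to\mathfrak k$ is an isometry, $P$ an orthogonal projection and $J$ a conjugation on $\mathfrak k$ commuting with $P$ (this comprises pure gauge-invariant quasi-free states, $V=1$, and doubled purifications of mixed ones). With $J$ the complex conjugation of momentum coefficients, $\pi_-$ (anti-periodic case) is given by $V=1$ and $P$ the projection onto momenta $p$ with $\chi p<0$; $\pi_+$ (periodic case) is given by $\mathfrak k=\mathfrak h\oplus\mathfrak h$, $V\xi=\xi\oplus0$, conjugation $J\oplus J$, and $P$ acting on $\{e_p\oplus0,0\oplus e_p\}$ as $\mathrm{diag}(\theta(-\chi p),\theta(\chi p))$ for $p\neq0$ and as $\tfrac12\begin{pmatrix}1&-\chi\\-\chi&1\end{pmatrix}$ for $p=0$. For a representation $\pi$ and an essentially self-adjoint $o$ on $\mathfrak h$ put $\sigma_t(\pi(A))=\pi(\alpha_{e^{ito}}(A))$ with the Bogoliubov automorphism $\alpha_U(a^\dagger(\xi))=a^\dagger(U\xi)$; if $e^{ito}$ is implemented in $\pi$ by unitaries $W_t$ (such as $e^{it\,dF_S(o)}$ in admissible representations) then $\sigma_t=\mathrm{Ad}_{W_t}$ on $\pi(\mathfrak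 A)$. A compactly supported orthonormal Daubechies scaling function of order $K\ge2$ with real finite filter $h$ is a compactly supported $s\in L^2(\mathbb R)$ with $\int s=1$, orthonormal integer translates, $s(x)=\sum_nh_n2^{1/2}s(2x-n)$, and $m_0(p)=2^{-1/2}\sum_nh_ne^{-ipn}=\big(\tfrac{1+e^{-ip}}2\big)^K\mathcal L(p)$ with a real-coefficient trigonometric polynomial $\mathcal L$, $|\mathcal L(p)|^2=\sum_{j<K}\binom{K-1+j}{j}\sin^{2j}(p/2)$. Put $\hat s(p)=\int e^{-ipx}s(x)\,dx$. "Convergence of $\tilde\sigma^{(N)}_t$ to $\sigma_t$ in $\pi$" means $$\lim_{N\to\infty}\|\tilde\sigma^{(N)}_t(\pi(A))-\sigma_t(\pi(A))\|=0\quad\text{for all }A\in\mathfrak A,\text{ uniformly for }t\text{ in compact intervals.}$$ **Theorem.** There is a universal $\alpha_0\in\mathbb N$ such that the following holds for all $L$, $L_0$, both boundary conditions and both chiralities. Let $s\in C^{\alpha_0}(\mathbb R)$ be a compactly supported orthonormal Daubechies scaling function. (A) Let $R^N_\infty$ be the wavelet renormalization map $(R^N_\infty\hat\xi)_k=\varepsilon_N^{1/2}\hat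 s(\varepsilon_Nk)\hat\xi_k$, $k\in\Gamma_\infty$ ($\hat\xi$ extended periodically). Then for every $k\in\tfrac{\pi}{L}\mathbb Z$ and every quasi-free representation (in particular in every admissible one, including $\pi_\pm$), the Bogoliubov automorphisms generated by $\tilde r^{(N)}_{\chi,k}$ and $\tilde\iota^{(N)}_{\chi,k}$ converge to those generated by $r_{\chi,k}$ and $\iota_{\chi,k}$. (B) The same holds in $\pi_\pm$ for the momentum-cutoff map $(R^N_\infty\hat\xi)_k=\varepsilon_N^{1/2}\mathbf 1_{\Gamma_N}(k)\hat\xi_k$ (without any scaling function). (C) Let $M\in\mathbb N_0$, let $X$ be a real function on the lattice $\varepsilon_M\{-L_M,\dots,L_M-1\}$, $\hat X_k=\sum_xe^{-ikx}X_x$, $S^M_N(\hat X)_k=\prod_{j=M+1}^{N}2m_0(\varepsilon_jk)\,\hat X_k$, $S^M_\infty(\hat X)_k=\varepsilon_M\hat s(\varepsilon_Mk)\hat X_k$, and $$\tilde\ell^{(N)}_\chi(S^M_NX)=\tfrac1{2L_N}\sum_{k\in\Gamma_{N,+}}S^M_N(\hat X)_k\,\tilde\ell^{(N)}_{\chi,k}\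 (N>M),\qquad \ell_\chi(S^M_\infty X)=\tfrac1{2L}\sum_{k\in\Gamma_{\infty,+}}S^M_\infty(\hat X)_k\,\ell_{\chi,k}\ \text{ on }\mathcal D_{\rm std},$$ with $\tilde\ell^{(N)}_{\chi,k}$ formed by the momentum-cutoff map. Then the last series converges on $\mathcal D_{\rm std}$ and, in $\pi_\pm$, the Bogoliubov automorphisms generated by $\tilde\ell^{(N)}_\chi(S^M_NX)$ converge to those generated by $\ell_\chi(S^M_\infty X)$. In all cases the approximating one-particle exponentials $e^{it\tilde o^{(N)}}$ are unitary, and exactly one strongly continuous one-parameter unitary group has a generator extending the limiting operator on $\mathcal D_{\rm std}$. The convergence also holds for $\mathrm{Ad}_{W^{(N)}_t}\to\mathrm{Ad}_{W_t}$ on $\pi(\mathfrak A)$, for any unitaries $W^{(N)}_t$, $W_t$ on the representation space that implement these automorphisms. -/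

import Mathlib

open scoped ENNReal InnerProductSpace
open Complex Filter Topology

noncomputable section

/-- The Hilbert space `ℓ²(ι)`. -/
abbrev EllTwo (ι : Type) : Type := lp (fun _ : ι => ℂ) 2

/-- The standard basis vector of `ℓ²(ι)` at `i`. -/
def stdVec {ι : Type} (i : ι) : EllTwo ι :=
  letI := Classical.decEq ι
  lp.single 2 i 1

theorem stdVec_apply {ι : Type} [DecidableEq ι] (i j : ι) :
    (stdVec i : EllTwo ι) j = if j = i then 1 else 0 := by
  classical
  by_cases h : j = i
  · subst h; simp [stdVec]
  · simp [stdVec, h]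

theorem inner_stdVec {ι : Type} (i : ι) (ξ : EllTwo ι) : ⟪stdVec i, ξ⟫_ℂ = ξ i := by
  let := Classical.decEq ι
  have : stdVec i = lp.single 2 i (1 : ℂ) := by
    ext j; rw [stdVec_apply]; by_cases h : j = i
    · subst h; simp
    · simp [h]
  rw [this, lp.inner_single_left]; simp

theorem orthonormal_stdVec {ι : Type} : Orthonormal ℂ (stdVec : ι → EllTwo ι) := by
  classical
  rw [orthonormal_iff_ite]
  intro i j
  rw [inner_stdVec, stdVec_apply]

/-! ### The CAR algebra -/

/-- A representation of the canonical anti-commutation relations over `𝔥` on a Hilbert space. -/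
structure CARRep (𝔥 : Type) [NormedAddCommGroup 𝔥] [InnerProductSpace ℂ 𝔥] where
  H : Type
  [normedAddCommGroup : NormedAddCommGroup H]
  [innerProductSpace : InnerProductSpace ℂ H]
  [completeSpace : CompleteSpace H]
  [nontrivial : Nontrivial H]
  /-- the annihilation operators -/
  a : 𝔥 →ₗ⋆[ℂ] (H →L[ℂ] H)
  anticomm_star : ∀ ξ η : 𝔥, a ξ * star (a η) + star (a η) * a ξ = ⟪ξ, η⟫_ℂ • 1
  anticomm : ∀ ξ η : 𝔥, a ξ * a η + a η * a ξ = 0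

attribute [instance] CARRep.normedAddCommGroup CARRep.innerProductSpace CARRep.completeSpace
  CARRep.nontrivial

section CAR

variable {𝔥 : Type} [NormedAddCommGroup 𝔥] [InnerProductSpace ℂ 𝔥]

theorem CARRep.norm_a_le (ρ : CARRep 𝔥) (ξ : 𝔥) : ‖ρ.a ξ‖ ≤ ‖ξ‖ := by
  refine ContinuousLinearMap.opNorm_le_bound _ (norm_nonneg _) fun v => ?_
  have h := congrArg (fun T : ρ.H →L[ℂ] ρ.H => RCLike.re ⟪v, T v⟫_ℂ) (ρ.anticomm_star ξ ξ)
  simp only [add_apply, mul_apply_eq_comp, inner_add_right,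
    smul_apply, one_apply_eq_self, inner_smul_right,
    ContinuousLinearMap.star_eq_adjoint, ContinuousLinearMap.adjoint_inner_right, map_add] at h
  rw [← ContinuousLinearMap.adjoint_inner_left, inner_self_eq_norm_sq_to_K,
    inner_self_eq_norm_sq_to_K, inner_self_eq_norm_sq_to_K, inner_self_eq_norm_sq_to_K] at h
  have h' : ‖ContinuousLinearMap.adjoint (ρ.a ξ) v‖ ^ 2 + ‖ρ.a ξ v‖ ^ 2 = ‖ξ‖ ^ 2 * ‖v‖ ^ 2 := by
    simpa [← Complex.ofReal_pow] using h
  have h2 : ‖ρ.a ξ v‖ ^ 2 ≤ (‖ξ‖ * ‖v‖) ^ 2 := by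
    rw [mul_pow]; nlinarith [sq_nonneg ‖ContinuousLinearMap.adjoint (ρ.a ξ) v‖]
  exact le_of_sq_le_sq h2 (by positivity)

/-- The restriction of a CAR representation along an isometry `T`, `ξ ↦ a (T ξ)`. -/
def CARRep.comp (ρ : CARRep 𝔥) (T : 𝔥 →ₗᵢ[ℂ] 𝔥) : CARRep 𝔥 where
  H := ρ.H
  a := ρ.a.comp T.toLinearMap
  anticomm_star ξ η := by simpa using ρ.anticomm_star (T ξ) (T η)
  anticomm ξ η := ρ.anticomm (T ξ) (T η)

variable (𝔥) in
/-- The C⋆-algebra of bounded families of operators indexed by all CAR representations. -/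
abbrev CARProduct : Type 1 := lp (fun ρ : CARRep 𝔥 => ρ.H →L[ℂ] ρ.H) ∞

/-- The universal annihilation operators. -/
def carAnnihilation (ξ : 𝔥) : CARProduct 𝔥 :=
  ⟨fun ρ => ρ.a ξ, memℓp_infty ⟨‖ξ‖, by rintro _ ⟨ρ, rfl⟩; exact ρ.norm_a_le ξ⟩⟩

variable (𝔥) in
/-- The CAR algebra of `𝔥`: the universal unital C⋆-algebra generated by annihilation operators
subject to the CAR, i.e. the C⋆-algebra generated inside the product of all representations. -/
def CARAlgebra : StarSubalgebra ℂ (CARProduct 𝔥) :=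
  (StarAlgebra.adjoin ℂ (Set.range (carAnnihilation (𝔥 := 𝔥)))).topologicalClosure

/-- The annihilation operator `a(ξ)` as an element of the CAR algebra. -/
def CARAlgebra.a (ξ : 𝔥) : CARAlgebra 𝔥 :=
  ⟨carAnnihilation ξ, StarSubalgebra.le_topologicalClosure _
    (StarAlgebra.subset_adjoin ℂ _ ⟨ξ, rfl⟩)⟩

/-- The `⋆`-representation of the CAR algebra determined by a CAR representation. -/
def CARRep.π (ρ : CARRep 𝔥) : CARAlgebra 𝔥 →⋆ₐ[ℂ] (ρ.H →L[ℂ] ρ.H) where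
  toFun A := A.1 ρ
  map_one' := rfl
  map_mul' _ _ := rfl
  map_zero' := rfl
  map_add' _ _ := rfl
  commutes' _ := rfl
  map_star' _ := rfl

theorem CARRep.π_a (ρ : CARRep 𝔥) (ξ : 𝔥) : ρ.π (CARAlgebra.a ξ) = ρ.a ξ := rfl

/-- Pull-back of families of operators along `ρ ↦ ρ.comp T`. -/
def carPullback (T : 𝔥 →ₗᵢ[ℂ] 𝔥) : CARProduct 𝔥 →⋆ₐ[ℂ] CARProduct 𝔥 where
  toFun A := ⟨fun ρ => A (ρ.comp T), memℓp_infty ⟨‖A‖, by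
    rintro _ ⟨ρ, rfl⟩; exact lp.norm_apply_le_norm ENNReal.top_ne_zero A (ρ.comp T)⟩⟩
  map_one' := rfl
  map_mul' _ _ := rfl
  map_zero' := rfl
  map_add' _ _ := rfl
  commutes' _ := rfl
  map_star' _ := rfl

theorem carPullback_continuous (T : 𝔥 →ₗᵢ[ℂ] 𝔥) : Continuous (carPullback T) := by
  refine AddMonoidHomClass.continuous_of_bound (carPullback T) 1 fun A => ?_
  rw [one_mul]
  exact lp.norm_le_of_forall_le (norm_nonneg _) fun ρ =>
    lp.norm_apply_le_norm ENNReal.top_ne_zero A (ρ.comp T)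

theorem carPullback_mem (T : 𝔥 →ₗᵢ[ℂ] 𝔥) (A : CARAlgebra 𝔥) :
    carPullback T A.1 ∈ CARAlgebra 𝔥 := by
  have h1 : (StarAlgebra.adjoin ℂ (Set.range (carAnnihilation (𝔥 := 𝔥)))).map (carPullback T) ≤
      StarAlgebra.adjoin ℂ (Set.range (carAnnihilation (𝔥 := 𝔥))) := by
    rw [StarAlgHom.map_adjoin]
    refine StarAlgebra.adjoin_le ?_
    rintro _ ⟨_, ⟨ξ, rfl⟩, rfl⟩
    exact StarAlgebra.subset_adjoin ℂ _ ⟨T ξ, rfl⟩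
  have h2 := StarSubalgebra.map_topologicalClosure_le
    (StarAlgebra.adjoin ℂ (Set.range (carAnnihilation (𝔥 := 𝔥)))) (carPullback T)
    (carPullback_continuous T)
  exact StarSubalgebra.topologicalClosure_mono h1 (h2 ⟨A.1, A.2, rfl⟩)

/-- The Bogoliubov morphism `α_T` of the CAR algebra, `α_T (a(ξ)) = a(T ξ)`. -/
def bogoliubov (T : 𝔥 →ₗᵢ[ℂ] 𝔥) : CARAlgebra 𝔥 →⋆ₐ[ℂ] CARAlgebra 𝔥 where
  toFun A := ⟨carPullback T A.1, carPullback_mem T A⟩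
  map_one' := rfl
  map_mul' _ _ := rfl
  map_zero' := rfl
  map_add' _ _ := rfl
  commutes' _ := rfl
  map_star' _ := rfl

theorem bogoliubov_a (T : 𝔥 →ₗᵢ[ℂ] 𝔥) (ξ : 𝔥) :
    bogoliubov T (CARAlgebra.a ξ) = CARAlgebra.a (T ξ) := rfl

end CAR

/-! ### Anti-symmetric Fock space in the occupation-number picture -/

/-- The anti-symmetric Fock space over `ℓ²(ι)`: the basis vector of `F = {k₁ < ⋯ < kₙ}` stands for
`e_{k₁} ∧ ⋯ ∧ e_{kₙ}`. -/
abbrev FockSpace (ι : Type) : Type := EllTwo (Finset ι)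

section Fock

variable {ι : Type} [LinearOrder ι]

/-- The sign of moving mode `k` into its place in the ordered product over `F`. -/
def fockSign (k : ι) (F : Finset ι) : ℂ := (-1) ^ (F.filter (· < k)).card

theorem norm_fockSign (k : ι) (F : Finset ι) : ‖fockSign k F‖ = 1 := by
  simp [fockSign]

theorem fockSign_mul_self (k : ι) (F : Finset ι) : fockSign k F * fockSign k F = 1 := by
  rw [fockSign, ← mul_pow]; simp

theorem conj_fockSign (k : ι) (F : Finset ι) : starRingEnd ℂ (fockSign k F) = fockSign k F := by
  simp [fockSign]

/-- Coordinates of `a†(e_k) Ψ`, i.e. `e_k ∧ Ψ`. -/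
def modeCreateFun (k : ι) (Ψ : Finset ι → ℂ) (F : Finset ι) : ℂ :=
  if k ∈ F then fockSign k F * Ψ (F.erase k) else 0

theorem modeCreateFun_sum_le (k : ι) (Ψ : FockSpace ι) (s : Finset (Finset ι)) :
    ∑ F ∈ s, ‖modeCreateFun k Ψ F‖ ^ (2 : ℝ≥0∞).toReal ≤ ‖Ψ‖ ^ (2 : ℝ≥0∞).toReal := by
  have h1 : ∑ F ∈ s, ‖modeCreateFun k Ψ F‖ ^ (2 : ℝ≥0∞).toReal =
      ∑ F ∈ s.filter (k ∈ ·), ‖Ψ (F.erase k)‖ ^ (2 : ℝ≥0∞).toReal := by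
    rw [Finset.sum_filter]
    refine Finset.sum_congr rfl fun F _ => ?_
    by_cases h : k ∈ F <;> simp [modeCreateFun, h, norm_fockSign]
  have h2 : Set.InjOn (fun F : Finset ι => F.erase k) (s.filter (k ∈ ·)) := by
    intro F hF G hG h
    have hF' : k ∈ F := (Finset.mem_filter.mp hF).2
    have hG' : k ∈ G := (Finset.mem_filter.mp hG).2
    rw [← Finset.insert_erase hF', ← Finset.insert_erase hG']
    exact congrArg (insert k) h
  rw [h1, ← Finset.sum_image (f := fun G => ‖Ψ G‖ ^ (2 : ℝ≥0∞).toReal) h2]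
  exact lp.sum_rpow_le_norm_rpow (by norm_num) Ψ _

/-- The creation operator `a†(e_k)` of a single mode on Fock space. -/
def modeCreate (k : ι) : FockSpace ι →L[ℂ] FockSpace ι :=
  LinearMap.mkContinuous
    { toFun := fun Ψ => ⟨modeCreateFun k Ψ, memℓp_gen' (modeCreateFun_sum_le k Ψ)⟩
      map_add' := fun Ψ Φ => by
        ext F
        change modeCreateFun k (Ψ + Φ : FockSpace ι) F = modeCreateFun k Ψ F + modeCreateFun k Φ F
        by_cases h : k ∈ F <;> simp [modeCreateFun, h, mul_add]
      map_smul' := fun c Ψ => by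
        ext F; by_cases h : k ∈ F <;> simp [modeCreateFun, h, mul_left_comm] }
    1 fun Ψ => by
      rw [one_mul]
      exact lp.norm_le_of_forall_sum_le (by norm_num) (norm_nonneg _) (modeCreateFun_sum_le k Ψ)

theorem modeCreate_apply (k : ι) (Ψ : FockSpace ι) (F : Finset ι) :
    modeCreate k Ψ F = if k ∈ F then fockSign k F * Ψ (F.erase k) else 0 := rfl

theorem star_modeCreate_apply (k : ι) (Ψ : FockSpace ι) (F : Finset ι) :
    (star (modeCreate k) : FockSpace ι →L[ℂ] FockSpace ι) Ψ F =
      if k ∈ F then 0 else fockSign k (insert k F) * Ψ (insert k F) := by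
  have h := ContinuousLinearMap.adjoint_inner_right (modeCreate k) (stdVec F) Ψ
  have h0 : modeCreate k (stdVec F) =
      if k ∈ F then 0 else fockSign k (insert k F) • stdVec (insert k F) := by
    ext G
    rw [modeCreate_apply, stdVec_apply]
    by_cases hF : k ∈ F
    · rw [if_pos hF]
      by_cases hG : k ∈ G
      · have : G.erase k ≠ F := fun h => by rw [← h] at hF; simp at hF
        simp [this]
      · simp [hG]
    · rw [if_neg hF, lp.coeFn_smul, Pi.smul_apply, stdVec_apply]
      by_cases hG : k ∈ G
      · rw [if_pos hG]
        by_cases hGF : G = insert k F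
        · subst hGF; simp [Finset.erase_insert hF]
        · have : G.erase k ≠ F := fun h => hGF (by rw [← h, Finset.insert_erase hG])
          simp [this, hGF]
      · have : G ≠ insert k F := fun h => hG (by simp [h])
        simp [hG, this]
  rw [h0, ← ContinuousLinearMap.star_eq_adjoint, inner_stdVec] at h
  rw [h]
  by_cases hF : k ∈ F
  · simp [hF]
  · rw [if_neg hF, if_neg hF, inner_smul_left, conj_fockSign, inner_stdVec]

theorem fockSign_insert_of_lt {k l : ι} {F : Finset ι} (h : k < l) (hk : k ∉ F) :
    fockSign l (insert k F) = - fockSign l F := by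
  rw [fockSign, fockSign, Finset.filter_insert, if_pos h, Finset.card_insert_of_notMem (by simp [hk]),
    pow_succ]; ring

theorem fockSign_insert_of_le {k l : ι} {F : Finset ι} (h : l ≤ k) :
    fockSign l (insert k F) = fockSign l F := by
  rw [fockSign, fockSign, Finset.filter_insert, if_neg (not_lt.mpr h)]

theorem fockSign_erase_of_lt {k l : ι} {F : Finset ι} (h : k < l) (hk : k ∈ F) :
    fockSign l (F.erase k) = - fockSign l F := by
  have := fockSign_insert_of_lt h (Finset.notMem_erase k F)
  rw [Finset.insert_erase hk] at this
  rw [this, neg_neg]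

theorem fockSign_erase_of_le {k l : ι} {F : Finset ι} (h : l ≤ k) :
    fockSign l (F.erase k) = fockSign l F := by
  by_cases hk : k ∈ F
  · have := fockSign_insert_of_le (F := F.erase k) h
    rwa [Finset.insert_erase hk, eq_comm] at this
  · rw [Finset.erase_eq_of_notMem hk]

theorem modeCreate_anticomm (k l : ι) :
    modeCreate k * modeCreate l + modeCreate l * modeCreate k = 0 := by
  ext Ψ F
  change modeCreate k (modeCreate l Ψ) F + modeCreate l (modeCreate k Ψ) F = 0
  simp only [modeCreate_apply]
  by_cases hk : k ∈ F <;> by_cases hl : l ∈ F <;> simp only [hk, hl, if_true, if_false,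
    Finset.mem_erase, and_false, and_true, mul_zero, add_zero]
  rcases lt_trichotomy k l with h | h | h
  · rw [if_pos h.ne', if_pos h.ne, fockSign_erase_of_lt h hk, fockSign_erase_of_le h.le,
      Finset.erase_right_comm]; ring
  · subst h; simp
  · rw [if_pos h.ne, if_pos h.ne', fockSign_erase_of_lt h hl, fockSign_erase_of_le h.le,
      Finset.erase_right_comm]; ring

theorem modeCreate_anticomm_star (k l : ι) :
    star (modeCreate k) * modeCreate l + modeCreate l * star (modeCreate k) =
      if k = l then (1 : FockSpace ι →L[ℂ] FockSpace ι) else 0 := by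
  ext Ψ F
  change (star (modeCreate k) : FockSpace ι →L[ℂ] FockSpace ι) (modeCreate l Ψ) F +
    modeCreate l ((star (modeCreate k) : FockSpace ι →L[ℂ] FockSpace ι) Ψ) F = _
  simp only [modeCreate_apply, star_modeCreate_apply]
  by_cases hkl : k = l
  · subst hkl
    by_cases hk : k ∈ F
    · simp [hk, Finset.insert_erase hk, ← mul_assoc, fockSign_mul_self]
    · simp [hk, ← mul_assoc, fockSign_mul_self]
  · rw [if_neg hkl]
    have hlk : ¬ l = k := fun h => hkl h.symm
    by_cases hk : k ∈ F <;> by_cases hl : l ∈ F <;>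
      simp [hk, hl, hkl, hlk]
    rw [Finset.erase_insert_of_ne hkl]
    rcases lt_or_gt_of_ne hkl with h | h
    · rw [fockSign_insert_of_lt h hk, fockSign_insert_of_le (F := F.erase l) le_rfl,
        fockSign_insert_of_le (F := F) le_rfl, fockSign_erase_of_le h.le]; ring
    · rw [fockSign_insert_of_le (F := F) (k := k) h.le,
        fockSign_insert_of_le (F := F.erase l) le_rfl,
        fockSign_insert_of_le (F := F) le_rfl, fockSign_erase_of_lt h hl]; ring

theorem sum_modeCreate_anticomm_star (f g : ι → ℂ) (s : Finset ι) :
    star (∑ k ∈ s, f k • modeCreate k) * (∑ l ∈ s, g l • modeCreate l) +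
      (∑ l ∈ s, g l • modeCreate l) * star (∑ k ∈ s, f k • modeCreate k) =
    (∑ k ∈ s, starRingEnd ℂ (f k) * g k) • (1 : FockSpace ι →L[ℂ] FockSpace ι) := by
  rw [star_sum, Finset.sum_mul_sum, Finset.sum_mul_sum, Finset.sum_comm (s := s) (t := s)
    (f := fun l k => g l • modeCreate l * star (f k • modeCreate k)), ← Finset.sum_add_distrib,
    Finset.sum_smul]
  refine Finset.sum_congr rfl fun k hk => ?_
  rw [← Finset.sum_add_distrib, Finset.sum_eq_single_of_mem k hk]
  · have := modeCreate_anticomm_star k k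
    rw [if_pos rfl] at this
    rw [star_smul, smul_mul_smul_comm, smul_mul_smul_comm, mul_comm (g k), ← smul_add, this]
    rfl
  · intro l _ hlk
    have := modeCreate_anticomm_star k l
    rw [if_neg hlk.symm] at this
    rw [star_smul, smul_mul_smul_comm, smul_mul_smul_comm, mul_comm (g l), ← smul_add, this,
      smul_zero]

theorem norm_sum_modeCreate_sq_le (f : ι → ℂ) (s : Finset ι) :
    ‖∑ k ∈ s, f k • modeCreate k‖ ^ 2 ≤ ∑ k ∈ s, ‖f k‖ ^ 2 := by
  set x := ∑ k ∈ s, f k • modeCreate k with hx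
  have h0 : star x * x + x * star x = ((∑ k ∈ s, ‖f k‖ ^ 2 : ℝ) : ℂ) •
      (1 : FockSpace ι →L[ℂ] FockSpace ι) := by
    rw [hx, sum_modeCreate_anticomm_star]
    congr 1
    push_cast
    exact Finset.sum_congr rfl fun k _ => Complex.conj_mul' (f k)
  have hC : 0 ≤ ∑ k ∈ s, ‖f k‖ ^ 2 := Finset.sum_nonneg fun _ _ => by positivity
  have h1 : ‖x‖ ≤ Real.sqrt (∑ k ∈ s, ‖f k‖ ^ 2) := by
    refine ContinuousLinearMap.opNorm_le_bound _ (Real.sqrt_nonneg _) fun v => ?_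
    have h := congrArg (fun T : FockSpace ι →L[ℂ] FockSpace ι => RCLike.re ⟪v, T v⟫_ℂ) h0
    simp only [add_apply, mul_apply_eq_comp, inner_add_right, smul_apply, one_apply_eq_self,
      inner_smul_right, ContinuousLinearMap.star_eq_adjoint,
      ContinuousLinearMap.adjoint_inner_right, map_add] at h
    rw [← ContinuousLinearMap.adjoint_inner_left x (ContinuousLinearMap.adjoint x v) v,
      inner_self_eq_norm_sq_to_K, inner_self_eq_norm_sq_to_K, inner_self_eq_norm_sq_to_K] at h
    have h' : ‖x v‖ ^ 2 + ‖ContinuousLinearMap.adjoint x v‖ ^ 2 =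
        (∑ k ∈ s, ‖f k‖ ^ 2) * ‖v‖ ^ 2 := by
      simpa only [← Complex.ofReal_pow, ← Complex.ofReal_mul, RCLike.re_to_complex,
        Complex.ofReal_re, Complex.coe_algebraMap] using h
    refine le_of_sq_le_sq ?_ (by positivity)
    rw [mul_pow, Real.sq_sqrt hC]
    nlinarith [sq_nonneg ‖ContinuousLinearMap.adjoint x v‖]
  calc ‖x‖ ^ 2 ≤ Real.sqrt (∑ k ∈ s, ‖f k‖ ^ 2) ^ 2 := by gcongr
    _ = _ := Real.sq_sqrt hC

theorem summable_modeCreate (ξ : EllTwo ι) : Summable fun k => ξ k • modeCreate k := by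
  have h : Summable fun k => ‖ξ k‖ ^ 2 := by
    have := (lp.memℓp ξ).summable (by norm_num)
    simpa using this
  rw [summable_iff_vanishing_norm] at h ⊢
  intro ε hε
  obtain ⟨s, hs⟩ := h (ε ^ 2) (by positivity)
  refine ⟨s, fun t ht => ?_⟩
  have h1 := hs t ht
  rw [Real.norm_of_nonneg (Finset.sum_nonneg fun _ _ => by positivity)] at h1
  exact lt_of_pow_lt_pow_left₀ 2 hε.le ((norm_sum_modeCreate_sq_le _ _).trans_lt h1)

/-- The creation operator `a†(ξ) = ∑ₖ ξₖ a†(e_k)` on Fock space. -/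
def fockCreate : EllTwo ι →ₗ[ℂ] (FockSpace ι →L[ℂ] FockSpace ι) where
  toFun ξ := ∑' k, ξ k • modeCreate k
  map_add' ξ η := by
    rw [← (summable_modeCreate ξ).tsum_add (summable_modeCreate η)]
    simp [add_smul]
  map_smul' c ξ := by
    rw [RingHom.id_apply, ← (summable_modeCreate ξ).tsum_const_smul]
    simp [mul_smul]

theorem hasSum_fockCreate (ξ : EllTwo ι) :
    HasSum (fun k => ξ k • modeCreate k) (fockCreate ξ) := (summable_modeCreate ξ).hasSum

theorem fockCreate_anticomm (ξ η : EllTwo ι) :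
    fockCreate ξ * fockCreate η + fockCreate η * fockCreate ξ = 0 := by
  have h1 : ∀ l, fockCreate ξ * modeCreate l + modeCreate l * fockCreate ξ = 0 := by
    intro l
    refine (((hasSum_fockCreate ξ).mul_right (modeCreate l)).add
      ((hasSum_fockCreate ξ).mul_left (modeCreate l))).unique ?_
    convert hasSum_zero using 2 with k
    rw [smul_mul_assoc, mul_smul_comm, ← smul_add, modeCreate_anticomm, smul_zero]
  refine (((hasSum_fockCreate η).mul_left (fockCreate ξ)).add
    ((hasSum_fockCreate η).mul_right (fockCreate ξ))).unique ?_
  convert hasSum_zero using 2 with l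
  rw [smul_mul_assoc, mul_smul_comm, ← smul_add, h1, smul_zero]

theorem fockCreate_anticomm_star (ξ η : EllTwo ι) :
    star (fockCreate ξ) * fockCreate η + fockCreate η * star (fockCreate ξ) =
      ⟪ξ, η⟫_ℂ • (1 : FockSpace ι →L[ℂ] FockSpace ι) := by
  have h1 : ∀ l, star (fockCreate ξ) * modeCreate l + modeCreate l * star (fockCreate ξ) =
      starRingEnd ℂ (ξ l) • (1 : FockSpace ι →L[ℂ] FockSpace ι) := by
    intro l
    refine (((hasSum_fockCreate ξ).star.mul_right (modeCreate l)).add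
      ((hasSum_fockCreate ξ).star.mul_left (modeCreate l))).unique ?_
    have h2 : ∀ k, star (ξ k • modeCreate k) * modeCreate l +
        modeCreate l * star (ξ k • modeCreate k) =
        if k = l then starRingEnd ℂ (ξ l) • (1 : FockSpace ι →L[ℂ] FockSpace ι) else 0 := by
      intro k
      rw [star_smul, smul_mul_assoc, mul_smul_comm, ← smul_add, modeCreate_anticomm_star]
      by_cases h : k = l
      · subst h; rw [if_pos rfl, if_pos rfl]; rfl
      · rw [if_neg h, if_neg h, smul_zero]
    simp only [h2]
    exact hasSum_ite_eq l _
  refine (((hasSum_fockCreate η).mul_left (star (fockCreate ξ))).add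
    ((hasSum_fockCreate η).mul_right (star (fockCreate ξ)))).unique ?_
  have h3 : ∀ l, star (fockCreate ξ) * (η l • modeCreate l) +
      (η l • modeCreate l) * star (fockCreate ξ) =
      ⟪ξ l, η l⟫_ℂ • (1 : FockSpace ι →L[ℂ] FockSpace ι) := by
    intro l
    rw [smul_mul_assoc, mul_smul_comm, ← smul_add, h1, smul_smul]
    rfl
  simp only [h3]
  exact (lp.hasSum_inner ξ η).smul_const (1 : FockSpace ι →L[ℂ] FockSpace ι)

end Fock

/-! ### Quasi-free representations -/

instance (ι : Type) : Nontrivial (EllTwo (Finset ι)) :=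
  ⟨stdVec ∅, 0, fun h => by
    classical
    have := congrArg (fun Ψ : FockSpace ι => Ψ ∅) h
    simp [stdVec_apply] at this⟩

/-- The data of a gauge-invariant quasi-free representation over `𝔥` on the anti-symmetric Fock
space of `ℓ²(ι)`: an isometry `V`, an orthogonal projection `P` and a conjugation `J` commuting
with `P`. The corresponding state has the two-point operator `S = V⋆ P V`,
`ω(a(ξ) a†(η)) = ⟪ξ, (1 - S) η⟫`. For `V = 1` this is the representation of a pure state
(`P = S`); for `V ξ = ξ ⊕ 0` and `P = P_S` on `𝔥 ⊕ 𝔥` it is the purification by doubling. -/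
structure QuasiFree (𝔥 : Type) [NormedAddCommGroup 𝔥] [InnerProductSpace ℂ 𝔥] (ι : Type) where
  V : 𝔥 →ₗᵢ[ℂ] EllTwo ι
  P : EllTwo ι →L[ℂ] EllTwo ι
  isStarProjection : IsStarProjection P
  J : EllTwo ι →ₗᵢ⋆[ℂ] EllTwo ι
  J_J : ∀ ζ, J (J ζ) = ζ
  J_P : ∀ ζ, J (P ζ) = P (J ζ)

section QuasiFree

variable {𝔥 : Type} [NormedAddCommGroup 𝔥] [InnerProductSpace ℂ 𝔥] {ι : Type}

theorem QuasiFree.inner_P (Q : QuasiFree 𝔥 ι) (ξ η : EllTwo ι) : ⟪Q.P ξ, Q.P η⟫_ℂ = ⟪ξ, Q.P η⟫_ℂ := by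
  have h : Q.P * Q.P = Q.P := Q.isStarProjection.isIdempotentElem
  rw [← ContinuousLinearMap.adjoint_inner_right, ← ContinuousLinearMap.star_eq_adjoint,
    Q.isStarProjection.isSelfAdjoint.star_eq]
  exact congrArg (fun T : EllTwo ι →L[ℂ] EllTwo ι => ⟪ξ, T η⟫_ℂ) h

theorem QuasiFree.inner_P_left (Q : QuasiFree 𝔥 ι) (ξ η : EllTwo ι) : ⟪Q.P ξ, η⟫_ℂ = ⟪ξ, Q.P η⟫_ℂ := by
  rw [← ContinuousLinearMap.adjoint_inner_right, ← ContinuousLinearMap.star_eq_adjoint,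
    Q.isStarProjection.isSelfAdjoint.star_eq]

theorem QuasiFree.inner_J (Q : QuasiFree 𝔥 ι) (ξ η : EllTwo ι) : ⟪Q.J ξ, Q.J η⟫_ℂ = ⟪η, ξ⟫_ℂ := by
  have key : ∀ x y : EllTwo ι, RCLike.re ⟪Q.J x, Q.J y⟫_ℂ = RCLike.re ⟪y, x⟫_ℂ := by
    intro x y
    rw [re_inner_eq_norm_add_mul_self_sub_norm_sub_mul_self_div_four,
      re_inner_eq_norm_add_mul_self_sub_norm_sub_mul_self_div_four, ← map_add, ← map_sub,
      Q.J.norm_map, Q.J.norm_map, add_comm y x, norm_sub_rev y x]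
  apply Complex.ext
  · exact key ξ η
  · have h2 := key (Complex.I • ξ) η
    rw [map_smulₛₗ, inner_smul_left, inner_smul_right] at h2
    simpa using h2

variable [LinearOrder ι]

/-- The quasi-free representation `π_S(a(ξ)) = a((1 - P) V ξ) + a†(J P V ξ)` on Fock space. -/
def QuasiFree.rep (Q : QuasiFree 𝔥 ι) : CARRep 𝔥 where
  H := FockSpace ι
  a :=
    { toFun := fun ξ => star (fockCreate (Q.V ξ - Q.P (Q.V ξ))) + fockCreate (Q.J (Q.P (Q.V ξ)))
      map_add' := fun ξ η => by
        simp only [map_add, map_sub, star_add, star_sub]; abel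
      map_smul' := fun c ξ => by
        simp only [map_smul, map_smulₛₗ, ← smul_sub, star_smul, smul_add]; rfl }
  anticomm_star ξ η := by
    have e1 := fockCreate_anticomm_star (Q.V ξ - Q.P (Q.V ξ)) (Q.V η - Q.P (Q.V η))
    have e2 := fockCreate_anticomm_star (Q.J (Q.P (Q.V η))) (Q.J (Q.P (Q.V ξ)))
    have e3 := fockCreate_anticomm (Q.J (Q.P (Q.V ξ))) (Q.V η - Q.P (Q.V η))
    have e4 := congrArg star
      (fockCreate_anticomm (Q.V ξ - Q.P (Q.V ξ)) (Q.J (Q.P (Q.V η))))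
    simp only [star_add, star_mul, star_zero] at e4
    have e5 : ⟪Q.V ξ - Q.P (Q.V ξ), Q.V η - Q.P (Q.V η)⟫_ℂ +
        ⟪Q.J (Q.P (Q.V η)), Q.J (Q.P (Q.V ξ))⟫_ℂ = ⟪ξ, η⟫_ℂ := by
      simp only [Q.inner_J, inner_sub_left, inner_sub_right, Q.inner_P, Q.inner_P_left,
        LinearIsometry.inner_map_map]
      ring
    simp only [LinearMap.coe_mk, AddHom.coe_mk, star_add, star_star]
    rw [← e5, add_smul, ← e1, ← e2]
    have e6 : ∀ A B C D : FockSpace ι →L[ℂ] FockSpace ι, (A + B) * (C + D) + (C + D) * (A + B) =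
        A * C + C * A + (D * B + B * D) + (B * C + C * B) + (D * A + A * D) := by
      intro A B C D; simp only [add_mul, mul_add]; abel
    rw [e6, e3, e4, add_zero, add_zero]
  anticomm ξ η := by
    have e1 := congrArg star
      (fockCreate_anticomm (Q.V ξ - Q.P (Q.V ξ)) (Q.V η - Q.P (Q.V η)))
    simp only [star_add, star_mul, star_zero] at e1
    have e2 := fockCreate_anticomm (Q.J (Q.P (Q.V ξ))) (Q.J (Q.P (Q.V η)))
    have e0 : ∀ x y : 𝔥, ⟪Q.V x - Q.P (Q.V x), Q.J (Q.P (Q.V y))⟫_ℂ = 0 := by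
      intro x y
      rw [Q.J_P, inner_sub_left, Q.inner_P, sub_self]
    have e3 := fockCreate_anticomm_star (Q.V ξ - Q.P (Q.V ξ)) (Q.J (Q.P (Q.V η)))
    have e4 := fockCreate_anticomm_star (Q.V η - Q.P (Q.V η)) (Q.J (Q.P (Q.V ξ)))
    rw [e0, zero_smul] at e3 e4
    simp only [LinearMap.coe_mk, AddHom.coe_mk]
    have e6 : ∀ A B C D : FockSpace ι →L[ℂ] FockSpace ι, (A + B) * (C + D) + (C + D) * (A + B) =
        C * A + A * C + (B * D + D * B) + (A * D + D * A) + (C * B + B * C) := by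
      intro A B C D; simp only [add_mul, mul_add]; abel
    rw [e6, e1, e2, e3, e4]
    simp

end QuasiFree

/-! ### Momentum lattices and the representations of the scaling limit of the lattice vacua -/

/-- The boundary conditions: Ramond (periodic) and Neveu–Schwarz (anti-periodic). -/
inductive Sector where
  | ramond
  | neveuSchwarz

/-- The shift of the integers in the momentum lattice. -/
def Sector.shift : Sector → ℝ
  | .ramond => 0
  | .neveuSchwarz => 1 / 2

/-- The momentum `(π / L) (j + shift)` in the momentum lattice of the circle `ℝ / 2Lℤ`. -/
def mom (L : ℝ) (b : Sector) (j : ℤ) : ℝ := Real.pi / L * (j + b.shift)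

/-- The chiral one-particle space `L²(S¹_L)` with periodic or anti-periodic boundary conditions, in
the momentum representation: the basis vector `stdVec j` is the normalised plane wave
`(2L)^{-1/2} e_p`, `p = mom L b j`. -/
abbrev OneParticle : Type := EllTwo ℤ

section Projections

variable {ι : Type}

theorem weightedComp_sum_le (f : ι → ℝ) (hf : ∀ i, |f i| ≤ 1) (τ : ι ≃ ι) (ζ : EllTwo ι)
    (s : Finset ι) :
    ∑ i ∈ s, ‖(f i : ℂ) * ζ (τ i)‖ ^ (2 : ℝ≥0∞).toReal ≤ ‖ζ‖ ^ (2 : ℝ≥0∞).toReal := by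
  classical
  calc ∑ i ∈ s, ‖(f i : ℂ) * ζ (τ i)‖ ^ (2 : ℝ≥0∞).toReal
      ≤ ∑ i ∈ s, ‖ζ (τ i)‖ ^ (2 : ℝ≥0∞).toReal := by
        refine Finset.sum_le_sum fun i _ => Real.rpow_le_rpow (norm_nonneg _) ?_ (by norm_num)
        rw [norm_mul, Complex.norm_real]
        exact mul_le_of_le_one_left (norm_nonneg _) (hf i)
    _ = ∑ i ∈ s.image τ, ‖ζ i‖ ^ (2 : ℝ≥0∞).toReal :=
        (Finset.sum_image (f := fun i => ‖ζ i‖ ^ (2 : ℝ≥0∞).toReal) τ.injective.injOn).symm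
    _ ≤ _ := lp.sum_rpow_le_norm_rpow (by norm_num) ζ _

/-- The operator `(W ζ)_i = f_i ζ_{τ i}` on `ℓ²(ι)`. -/
def weightedComp (f : ι → ℝ) (hf : ∀ i, |f i| ≤ 1) (τ : ι ≃ ι) : EllTwo ι →L[ℂ] EllTwo ι :=
  LinearMap.mkContinuous
    { toFun := fun ζ => ⟨fun i => (f i : ℂ) * ζ (τ i), memℓp_gen' (weightedComp_sum_le f hf τ ζ)⟩
      map_add' := fun ζ η => by
        ext i
        change (f i : ℂ) * (ζ + η : EllTwo ι) (τ i) = (f i : ℂ) * ζ (τ i) + (f i : ℂ) * η (τ i)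
        simp [mul_add]
      map_smul' := fun c ζ => by
        ext i
        change (f i : ℂ) * (c • ζ : EllTwo ι) (τ i) = c * ((f i : ℂ) * ζ (τ i))
        simp [mul_left_comm] }
    1 fun ζ => by
      rw [one_mul]
      exact lp.norm_le_of_forall_sum_le (by norm_num) (norm_nonneg _) (weightedComp_sum_le f hf τ ζ)

/-- The operator `(P ζ)_i = f_i ζ_i + g_i ζ_{τ i}` on `ℓ²(ι)`. -/
def blockOp (f g : ι → ℝ) (hf : ∀ i, |f i| ≤ 1) (hg : ∀ i, |g i| ≤ 1) (τ : ι ≃ ι) :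
    EllTwo ι →L[ℂ] EllTwo ι :=
  weightedComp f hf (Equiv.refl ι) + weightedComp g hg τ

theorem blockOp_apply (f g : ι → ℝ) (hf : ∀ i, |f i| ≤ 1) (hg : ∀ i, |g i| ≤ 1) (τ : ι ≃ ι)
    (ζ : EllTwo ι) (i : ι) : blockOp f g hf hg τ ζ i = f i * ζ i + g i * ζ (τ i) := rfl

theorem blockOp_isStarProjection (f g : ι → ℝ) (hf : ∀ i, |f i| ≤ 1) (hg : ∀ i, |g i| ≤ 1)
    (τ : ι ≃ ι) (hτ : ∀ i, τ (τ i) = i) (hgτ : ∀ i, g (τ i) = g i)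
    (h1 : ∀ i, f i * f i + g i * g i = f i) (h2 : ∀ i, g i * (f i + f (τ i)) = g i) :
    IsStarProjection (blockOp f g hf hg τ) := by
  classical
  refine ⟨?_, ?_⟩
  · ext ζ i
    change blockOp f g hf hg τ (blockOp f g hf hg τ ζ) i = _
    simp only [blockOp_apply, hτ, hgτ]
    have e1 : (f i : ℂ) * f i + g i * g i = f i := by exact_mod_cast h1 i
    have e2 : (g i : ℂ) * (f i + f (τ i)) = g i := by exact_mod_cast h2 i
    linear_combination ζ i * e1 + ζ (τ i) * e2
  · ext ζ i
    have h := ContinuousLinearMap.adjoint_inner_right (blockOp f g hf hg τ) (stdVec i) ζ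
    rw [inner_stdVec, ← ContinuousLinearMap.star_eq_adjoint] at h
    rw [h]
    have h0 : blockOp f g hf hg τ (stdVec i) = (f i : ℂ) • stdVec i + (g i : ℂ) • stdVec (τ i) := by
      ext j
      rw [blockOp_apply, lp.coeFn_add, Pi.add_apply, lp.coeFn_smul, lp.coeFn_smul, Pi.smul_apply,
        Pi.smul_apply, stdVec_apply, stdVec_apply, stdVec_apply]
      congr 1
      · by_cases hj : j = i
        · subst hj; simp
        · simp [hj]
      · by_cases hj : j = τ i
        · subst hj; simp [hτ, hgτ]
        · have : τ j ≠ i := fun h => hj (by rw [← h, hτ])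
          simp [hj, this]
    rw [h0, inner_add_left, inner_smul_left, inner_smul_left, inner_stdVec, inner_stdVec,
      blockOp_apply, Complex.conj_ofReal, Complex.conj_ofReal]

/-- Complex conjugation of the momentum-space coefficients. -/
def coordConj : EllTwo ι →ₗᵢ⋆[ℂ] EllTwo ι := (starₗᵢ ℂ : EllTwo ι ≃ₗᵢ⋆[ℂ] EllTwo ι).toLinearIsometry

theorem coordConj_apply (ζ : EllTwo ι) (i : ι) : coordConj ζ i = starRingEnd ℂ (ζ i) := rfl

theorem coordConj_blockOp (f g : ι → ℝ) (hf : ∀ i, |f i| ≤ 1) (hg : ∀ i, |g i| ≤ 1) (τ : ι ≃ ι)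
    (ζ : EllTwo ι) :
    coordConj (blockOp f g hf hg τ ζ) = blockOp f g hf hg τ (coordConj ζ) := by
  ext i
  simp [coordConj_apply, blockOp_apply]

theorem coordConj_coordConj (ζ : EllTwo ι) : coordConj (coordConj ζ) = ζ := by
  ext i
  simp [coordConj_apply]

end Projections

/-- The Neveu–Schwarz representation `π_-(a(ξ)) = a(P^{χ} ξ) + a†(J P^{-χ} ξ)` of the chirality
`χ = ±1`, with `P^±` the projection onto positive, negative momenta. -/
def neveuSchwarzData (L : ℝ) (χ : ℤˣ) : QuasiFree OneParticle ℤ where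
  V := LinearIsometry.id
  P := blockOp (fun j => if ((χ : ℤ) : ℝ) * mom L .neveuSchwarz j < 0 then 1 else 0) (fun _ => 0)
    (fun j => by split_ifs <;> simp) (fun _ => by simp) (Equiv.refl ℤ)
  isStarProjection := blockOp_isStarProjection _ _ _ _ _ (fun _ => rfl) (fun _ => rfl)
    (fun j => by split_ifs <;> simp) (fun j => by simp)
  J := coordConj
  J_J := coordConj_coordConj
  J_P := coordConj_blockOp _ _ _ _ _

/-- Diagonal entries of the doubled projection `P_{S_{-χ}}` of the Ramond sector on
`OneParticle ⊕ OneParticle`: `θ(-χ p)` and `θ(χ p)`, with `1/2` at zero momentum. -/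
def ramondDiag (L : ℝ) (χ : ℤˣ) : ℤ ⊕ₗ ℤ → ℝ := fun i =>
  Sum.elim
    (fun j => if mom L .ramond j = 0 then 1 / 2 else
      if ((χ : ℤ) : ℝ) * mom L .ramond j < 0 then 1 else 0)
    (fun j => if mom L .ramond j = 0 then 1 / 2 else
      if 0 < ((χ : ℤ) : ℝ) * mom L .ramond j then 1 else 0) (ofLex i)

/-- Off-diagonal entries of the doubled projection `P_{S_{-χ}}` of the Ramond sector. -/
def ramondOffDiag (L : ℝ) (χ : ℤˣ) : ℤ ⊕ₗ ℤ → ℝ := fun i =>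
  if mom L .ramond (Sum.elim id id (ofLex i)) = 0 then -((χ : ℤ) : ℝ) / 2 else 0

/-- Exchange of the two copies of the one-particle space. -/
def sumLexSwap : ℤ ⊕ₗ ℤ ≃ ℤ ⊕ₗ ℤ := (ofLex.trans (Equiv.sumComm ℤ ℤ)).trans toLex

theorem orthonormal_inl : Orthonormal ℂ fun j : ℤ => (stdVec (toLex (Sum.inl j)) : EllTwo (ℤ ⊕ₗ ℤ)) :=
  orthonormal_stdVec.comp _ (toLex.injective.comp Sum.inl_injective)

theorem units_int_cast_cases (χ : ℤˣ) : ((χ : ℤ) : ℝ) = 1 ∨ ((χ : ℤ) : ℝ) = -1 := by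
  rcases Int.units_eq_one_or χ with h | h <;> simp [h]

/-- The Ramond representation
`π_+(a(ξ)) = a(P_{S_χ} (ξ ⊕ 0)) + a†((J ⊕ J) P_{S_{-χ}} (ξ ⊕ 0))` of the chirality `χ = ±1`. -/
def ramondData (L : ℝ) (χ : ℤˣ) : QuasiFree OneParticle (ℤ ⊕ₗ ℤ) where
  V := orthonormal_inl.orthogonalFamily.linearIsometry
  P := blockOp (ramondDiag L χ) (ramondOffDiag L χ)
    (fun i => by
      unfold ramondDiag
      rcases ofLex i with j | j <;> simp only [Sum.elim_inl, Sum.elim_inr] <;> split_ifs <;>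
        norm_num [abs_le])
    (fun i => by
      unfold ramondOffDiag
      rcases units_int_cast_cases χ with h | h <;> split_ifs <;> norm_num [h, abs_le])
    sumLexSwap
  isStarProjection := blockOp_isStarProjection _ _ _ _ _
    (fun i => by simp [sumLexSwap])
    (fun i => by
      obtain ⟨i, rfl⟩ := toLex.surjective i
      rcases i with j | j <;> rfl)
    (fun i => by
      obtain ⟨i, rfl⟩ := toLex.surjective i
      rcases units_int_cast_cases χ with h | h <;> rcases i with j | j <;>
        by_cases hj : mom L .ramond j = 0 <;> simp [ramondDiag, ramondOffDiag, hj, h] <;> norm_num)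
    (fun i => by
      obtain ⟨i, rfl⟩ := toLex.surjective i
      rcases i with j | j <;>
        by_cases hj : mom L .ramond j = 0 <;>
          simp [ramondDiag, ramondOffDiag, sumLexSwap, hj] <;> norm_num)
  J := coordConj
  J_J := coordConj_coordConj
  J_P := coordConj_blockOp _ _ _ _ _

/-- The quasi-free representation `π_±` of the chiral CAR algebra of chirality `χ` given by the
scaling limit of the massless lattice vacua. -/
def scalingLimitRep (L : ℝ) (χ : ℤˣ) : Sector → CARRep OneParticle
  | .ramond => (ramondData L χ).rep
  | .neveuSchwarz => (neveuSchwarzData L χ).rep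

/-! ### One-particle Virasoro generators -/

/-- The plane waves are linearly independent. -/
theorem linearIndependent_stdVec : LinearIndependent ℂ (stdVec : ℤ → OneParticle) :=
  orthonormal_stdVec.linearIndependent

/-- The operator on the span `𝒟_std` of the plane waves with prescribed values on the normalised
plane waves. -/
def stdOperator (f : ℤ → OneParticle) : OneParticle →ₗ.[ℂ] OneParticle where
  domain := Submodule.span ℂ (Set.range stdVec)
  toFun := (Module.Basis.span linearIndependent_stdVec).constr ℂ f

theorem stdOperator_apply (f : ℤ → OneParticle) (n : ℤ)
    (hn : stdVec n ∈ (stdOperator f).domain) : stdOperator f ⟨stdVec n, hn⟩ = f n := by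
  have h := (Module.Basis.span linearIndependent_stdVec).constr_basis ℂ f n
  rw [Module.Basis.span_apply] at h
  exact h

/-- The value at the normalised plane wave of momentum `p = mom L b n` of the one-particle Virasoro
generator `ℓ_{χ,k} = (χ/2π) ∑_l (l - χ k/2) e_{l - χ k} ⊗ ē_l`, where `k = (π/L) κ` and
`‖e_l‖² = 2L`. -/
def virasoroVec (L : ℝ) (b : Sector) (χ : ℤˣ) (κ n : ℤ) : OneParticle :=
  ((((χ : ℤ) : ℝ) / (2 * Real.pi) * (mom L b n - ((χ : ℤ) : ℝ) * (Real.pi / L * κ) / 2) * (2 * L) :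
    ℝ) : ℂ) • stdVec (n - (χ : ℤ) * κ)

/-- The one-particle Virasoro generator `ℓ_{χ,k}`, `k = (π/L) κ`, on `𝒟_std`. -/
def virasoro (L : ℝ) (b : Sector) (χ : ℤˣ) (κ : ℤ) : OneParticle →ₗ.[ℂ] OneParticle :=
  stdOperator (virasoroVec L b χ κ)

/-- The real part `r_{χ,k} = (ℓ_{χ,k} + ℓ_{χ,-k}) / 2` on `𝒟_std`. -/
def virasoroRe (L : ℝ) (b : Sector) (χ : ℤˣ) (κ : ℤ) : OneParticle →ₗ.[ℂ] OneParticle :=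
  (1 / 2 : ℂ) • (virasoro L b χ κ + virasoro L b χ (-κ))

/-- The imaginary part `ι_{χ,k} = (ℓ_{χ,k} - ℓ_{χ,-k}) / 2i` on `𝒟_std`. -/
def virasoroIm (L : ℝ) (b : Sector) (χ : ℤˣ) (κ : ℤ) : OneParticle →ₗ.[ℂ] OneParticle :=
  (1 / (2 * I) : ℂ) • (virasoro L b χ κ - virasoro L b χ (-κ))

/-! ### One-particle Koo–Saleur approximants -/

/-- The number `L_N = 2^N L₀`; the lattice at scale `N` has `2 L_N` sites. -/
def latSize (L₀ N : ℕ) : ℕ := 2 ^ N * L₀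

/-- The lattice spacing `ε_N = L / L_N = 2^{-N} ε₀`. -/
def latSpacing (L : ℝ) (L₀ N : ℕ) : ℝ := L / latSize L₀ N

/-- Indices of the lattice sites `ε_N {-L_N, …, L_N - 1}` and of the lattice momenta
`(π/L) {-L_N + shift, …, L_N - 1 + shift}`. -/
abbrev LatIndex (L₀ N : ℕ) : Type := Finset.Ico (-(latSize L₀ N : ℤ)) (latSize L₀ N)

/-- The chiral one-particle space at scale `N` in the momentum representation; the standard basis
consists of the normalised plane waves `(2 L_N)^{-1/2} e_l`. -/
abbrev LatOneParticle (L₀ N : ℕ) : Type := EuclideanSpace ℂ (LatIndex L₀ N)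

/-- The matrix, in the basis of normalised plane waves, of the one-particle Koo–Saleur approximant
`ℓ^{(N)}_{χ,k} = (χ/2π) ∑_l cos(ε_N k/4)² sin(ε_N (l - χ k/2)) e_{l - χ k} ⊗ ē_l`, where
`k = (π/L) κ`, `‖e_l‖² = 2 L_N`, and lattice momenta are understood modulo `2π / ε_N`. -/
def ksMatrix (L : ℝ) (L₀ : ℕ) (b : Sector) (χ : ℤˣ) (N : ℕ) (κ : ℤ) :
    Matrix (LatIndex L₀ N) (LatIndex L₀ N) ℂ :=
  Matrix.of fun m l =>
    if (m : ℤ) ≡ l - (χ : ℤ) * κ [ZMOD 2 * latSize L₀ N] then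
      ((((χ : ℤ) : ℝ) / (2 * Real.pi) * Real.cos (latSpacing L L₀ N * (Real.pi / L * κ) / 4) ^ 2 *
        Real.sin (latSpacing L L₀ N * (mom L b l - ((χ : ℤ) : ℝ) * (Real.pi / L * κ) / 2)) *
        (2 * latSize L₀ N) : ℝ) : ℂ)
    else 0

/-- The one-particle Koo–Saleur approximant `ℓ^{(N)}_{χ,k}` at scale `N`. -/
def ksOperator (L : ℝ) (L₀ : ℕ) (b : Sector) (χ : ℤˣ) (N : ℕ) (κ : ℤ) :
    LatOneParticle L₀ N →L[ℂ] LatOneParticle L₀ N :=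
  Matrix.toEuclideanCLM (𝕜 := ℂ) (ksMatrix L L₀ b χ N κ)

/-- The linear map from the lattice one-particle space with prescribed values on the normalised
plane waves. -/
def latMap {L₀ N : ℕ} (f : LatIndex L₀ N → OneParticle) : LatOneParticle L₀ N →L[ℂ] OneParticle :=
  LinearMap.toContinuousLinearMap
    ((EuclideanSpace.basisFun (LatIndex L₀ N) ℂ).toBasis.constr ℂ f)

/-- The asymptotic one-particle map `R^N_∞` of the momentum-cutoff renormalization group:
`R^N_∞(ξ̂)_k = ε_N^{1/2} χ_{Γ_N}(k) ξ̂_k`, which maps normalised plane waves to normalised plane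
waves. -/
def momentumMap (L₀ N : ℕ) : LatOneParticle L₀ N →L[ℂ] OneParticle :=
  latMap fun l => stdVec (l : ℤ)

/-- The Fourier transform `ŝ(p) = ∫ e^{-ipx} s(x) dx`. -/
def fourierHat (s : ℝ → ℝ) (p : ℝ) : ℂ := ∫ x : ℝ, Complex.exp (-(I * (p * x))) * (s x : ℂ)

/-- Coordinates, in the normalised plane waves, of the image under the wavelet map `R^N_∞` of the
normalised lattice plane wave of index `l`. -/
def waveletCoord (s : ℝ → ℝ) (L : ℝ) (L₀ : ℕ) (b : Sector) (N : ℕ) (l : LatIndex L₀ N) (j : ℤ) : ℂ :=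
  if j ≡ l [ZMOD 2 * latSize L₀ N] then fourierHat s (latSpacing L L₀ N * mom L b j) else 0

open Classical in
/-- The asymptotic one-particle map `R^N_∞` of the wavelet renormalization group:
`R^N_∞(ξ̂)_k = ε_N^{1/2} ŝ(ε_N k) (ξ̂_per)_k` with `ξ̂_per` the periodic extension of `ξ̂`. (The
coordinates are square-summable for a compactly supported `s ∈ L²`.) -/
def waveletMap (s : ℝ → ℝ) (L : ℝ) (L₀ : ℕ) (b : Sector) (N : ℕ) :
    LatOneParticle L₀ N →L[ℂ] OneParticle :=
  latMap fun l =>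
    if h : Memℓp (waveletCoord s L L₀ b N l) 2 then ⟨waveletCoord s L L₀ b N l, h⟩ else 0

/-- The approximant `õ = R o R⋆` on the continuum one-particle space. -/
def transport {L₀ N : ℕ} (R : LatOneParticle L₀ N →L[ℂ] OneParticle)
    (o : LatOneParticle L₀ N →L[ℂ] LatOneParticle L₀ N) : OneParticle →L[ℂ] OneParticle :=
  R ∘L o ∘L ContinuousLinearMap.adjoint R

/-- The real part `r^{(N)}_{χ,k} = (ℓ^{(N)}_{χ,k} + ℓ^{(N)}_{χ,-k}) / 2`. -/
def ksRe (L : ℝ) (L₀ : ℕ) (b : Sector) (χ : ℤˣ) (N : ℕ) (κ : ℤ) :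
    LatOneParticle L₀ N →L[ℂ] LatOneParticle L₀ N :=
  (1 / 2 : ℂ) • (ksOperator L L₀ b χ N κ + ksOperator L L₀ b χ N (-κ))

/-- The imaginary part `ι^{(N)}_{χ,k} = (ℓ^{(N)}_{χ,k} - ℓ^{(N)}_{χ,-k}) / 2i`. -/
def ksIm (L : ℝ) (L₀ : ℕ) (b : Sector) (χ : ℤˣ) (N : ℕ) (κ : ℤ) :
    LatOneParticle L₀ N →L[ℂ] LatOneParticle L₀ N :=
  (1 / (2 * I) : ℂ) • (ksOperator L L₀ b χ N κ - ksOperator L L₀ b χ N (-κ))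

/-! ### Daubechies scaling functions and smearing -/

/-- The trigonometric polynomial `∑ₙ qₙ e^{-ipn}`. -/
def trigPoly (q : ℤ →₀ ℝ) (p : ℝ) : ℂ := q.sum fun n c => (c : ℂ) * Complex.exp (-(I * (p * n)))

/-- The symbol `m₀(p) = 2^{-1/2} ∑ₙ hₙ e^{-ipn}` of a low-pass filter. -/
def filterSymbol (h : ℤ →₀ ℝ) (p : ℝ) : ℂ := ((Real.sqrt 2 : ℝ) : ℂ)⁻¹ * trigPoly h p

/-- `s` is a compactly supported orthonormal Daubechies scaling function of order `K` with low-pass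
filter `h`: `m₀(p) = ((1 + e^{-ip})/2)^K 𝓛(p)` with a real trigonometric polynomial `𝓛` such that
`|𝓛(p)|² = ∑_{j<K} (K-1+j choose j) sin(p/2)^{2j}`. -/
structure IsDaubechies (K : ℕ) (h : ℤ →₀ ℝ) (s : ℝ → ℝ) : Prop where
  two_le : 2 ≤ K
  factor : ∃ q : ℤ →₀ ℝ,
    (∀ p : ℝ, filterSymbol h p = ((1 + Complex.exp (-(I * p))) / 2) ^ K * trigPoly q p) ∧
    ∀ p : ℝ, ‖trigPoly q p‖ ^ 2 =
      ∑ j ∈ Finset.range K, ((K - 1 + j).choose j : ℝ) * Real.sin (p / 2) ^ (2 * j)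
  memLp : MeasureTheory.MemLp s 2
  hasCompactSupport : HasCompactSupport s
  integral_eq_one : ∫ x, s x = 1
  orthonormal : ∀ n : ℤ, ∫ x, s x * s (x - n) = if n = 0 then 1 else 0
  scaling : ∀ᵐ x : ℝ, s x = h.sum fun n c => c * (Real.sqrt 2 * s (2 * x - n))

/-- The (periodically extended) lattice Fourier transform `X̂_k = ∑_x e^{-ikx} X_x`, `k = (π/L) κ`,
of a real loop `X` on the lattice of scale `M`, with sites `x = ε_M j`. -/
def loopHat (L : ℝ) {L₀ M : ℕ} (X : LatIndex L₀ M → ℝ) (κ : ℤ) : ℂ :=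
  ∑ j : LatIndex L₀ M,
    Complex.exp (-(I * ((Real.pi / L * κ : ℝ) * (latSpacing L L₀ M * (j : ℤ) : ℝ)))) * (X j : ℂ)

/-- The wavelet renormalization of loops between finite scales,
`S^M_N(X̂)_k = (∏_{j=1}^{N-M} 2 m₀(ε_{M+j} k)) (X̂_per)_k`, `k = (π/L) κ`, the composition of the
one-step maps `S^N_{N+1}(X̂)_k = 2 m₀(ε_{N+1} k) (X̂_per)_k`. -/
def loopToScale (h : ℤ →₀ ℝ) (L : ℝ) {L₀ M : ℕ} (X : LatIndex L₀ M → ℝ) (N : ℕ) (κ : ℤ) : ℂ :=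
  (∏ j ∈ Finset.Ioc M N, 2 * filterSymbol h (latSpacing L L₀ j * (Real.pi / L * κ))) * loopHat L X κ

/-- The asymptotic wavelet renormalization of loops, `S^M_∞(X̂)_k = ε_M ŝ(ε_M k) (X̂_per)_k`,
`k = (π/L) κ`. -/
def loopToLimit (s : ℝ → ℝ) (L : ℝ) {L₀ M : ℕ} (X : LatIndex L₀ M → ℝ) (κ : ℤ) : ℂ :=
  latSpacing L L₀ M * fourierHat s (latSpacing L L₀ M * (Real.pi / L * κ)) * loopHat L X κ

/-- The smeared one-particle Koo–Saleur approximant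
`ℓ̃^{(N)}_χ(S^M_N X) = (2 L_N)⁻¹ ∑_{k ∈ Γ_{N,+}} S^M_N(X̂)_k ℓ̃^{(N)}_{χ,k}`, with `ℓ̃^{(N)}_{χ,k}`
formed by the momentum-cutoff renormalization group. -/
def smearedKS (h : ℤ →₀ ℝ) (L : ℝ) (L₀ : ℕ) (b : Sector) (χ : ℤˣ) {M : ℕ} (X : LatIndex L₀ M → ℝ)
    (N : ℕ) : OneParticle →L[ℂ] OneParticle :=
  (2 * (latSize L₀ N : ℂ))⁻¹ • ∑ κ : LatIndex L₀ N,
    loopToScale h L X N κ • transport (momentumMap L₀ N) (ksOperator L L₀ b χ N κ)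

/-- The terms of the series `ℓ_χ(S^M_∞ X) e = (2L)⁻¹ ∑_{k ∈ Γ_{∞,+}} S^M_∞(X̂)_k ℓ_{χ,k} e` at the
normalised plane wave of index `n`. -/
def smearedTerm (s : ℝ → ℝ) (L : ℝ) (L₀ : ℕ) (b : Sector) (χ : ℤˣ) {M : ℕ} (X : LatIndex L₀ M → ℝ)
    (n κ : ℤ) : OneParticle :=
  (2 * (L : ℂ))⁻¹ • loopToLimit s L X κ • virasoroVec L b χ κ n

/-- The smeared one-particle Virasoro generator `ℓ_χ(S^M_∞ X)` on `𝒟_std`. -/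
def smearedVirasoro (s : ℝ → ℝ) (L : ℝ) (L₀ : ℕ) (b : Sector) (χ : ℤˣ) {M : ℕ}
    (X : LatIndex L₀ M → ℝ) : OneParticle →ₗ.[ℂ] OneParticle :=
  stdOperator fun n => ∑' κ : ℤ, smearedTerm s L L₀ b χ X n κ

/-! ### Unitary groups and convergence of Bogoliubov transformations -/

section Convergence

variable {𝔥 : Type} [NormedAddCommGroup 𝔥] [InnerProductSpace ℂ 𝔥]

/-- `U` is a strongly continuous one-parameter unitary group whose generator extends `o`, that is,
`d/dt U_t ξ |_{t=0} = i o ξ` on the domain of `o`. For essentially self-adjoint `o` there is exactly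
one such group, `U_t = e^{i t o}`. -/
structure IsUnitaryGroupOf (o : 𝔥 →ₗ.[ℂ] 𝔥) (U : ℝ → 𝔥 ≃ₗᵢ[ℂ] 𝔥) : Prop where
  add : ∀ t u ξ, U (t + u) ξ = U t (U u ξ)
  continuous : ∀ ξ, Continuous fun t => U t ξ
  hasDerivAt : ∀ ξ : o.domain, HasDerivAt (fun t => U t (ξ : 𝔥)) (I • o ξ) 0

/-- The action on `ρ(𝔄)` of the Bogoliubov transformation `α_T` in the representation `ρ`,
`σ(ρ(A)) = ρ(α_T(A))`. -/
def CARRep.sigma (ρ : CARRep 𝔥) (T : 𝔥 ≃ₗᵢ[ℂ] 𝔥) (A : CARAlgebra 𝔥) : ρ.H →L[ℂ] ρ.H :=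
  ρ.π (bogoliubov T.toLinearIsometry A)

/-- `Ad_W (B) = W B W⋆` for a unitary `W`. -/
def adUnitary {H : Type} [NormedAddCommGroup H] [InnerProductSpace ℂ H] (W : H ≃ₗᵢ[ℂ] H)
    (B : H →L[ℂ] H) : H →L[ℂ] H :=
  (W : H →L[ℂ] H) ∘L B ∘L (W.symm : H →L[ℂ] H)

/-- The unitary `W` implements the Bogoliubov transformation `α_T` in `ρ`:
`Ad_W(ρ(a†(ξ))) = ρ(a†(T ξ))`. -/
def CARRep.Implements (ρ : CARRep 𝔥) (W : ρ.H ≃ₗᵢ[ℂ] ρ.H) (T : 𝔥 ≃ₗᵢ[ℂ] 𝔥) : Prop :=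
  ∀ ξ, adUnitary W (star (ρ.a ξ)) = star (ρ.a (T ξ))

/-- Convergence, in the representation `ρ`, of the Bogoliubov transformations generated by bounded
one-particle operators `oN 0, oN 1, …` to those generated by the symmetric operator `o`:
* `e^{i t oN}` is unitary for all `N` and `t`, and there is exactly one strongly continuous unitary
  group whose generator extends `o`;
* for every `A` in the CAR algebra, `σ_t^{(N)}(ρ(A)) → σ_t(ρ(A))` in norm, uniformly for `t` in
  compact intervals;
* this holds for `Ad_{W N t}(ρ(A)) → Ad_{W' t}(ρ(A))` if `W N t`, `W' t` are any unitaries that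
  implement the transformations in `ρ` (such as the exponentials of the second quantised
  generators). -/
def BogoliubovConvergence [CompleteSpace 𝔥] (ρ : CARRep 𝔥) (oN : ℕ → 𝔥 →L[ℂ] 𝔥)
    (o : 𝔥 →ₗ.[ℂ] 𝔥) : Prop :=
  ∃ (UN : ℕ → ℝ → 𝔥 ≃ₗᵢ[ℂ] 𝔥) (U : ℝ → 𝔥 ≃ₗᵢ[ℂ] 𝔥),
    (∀ N t, (UN N t : 𝔥 →L[ℂ] 𝔥) = NormedSpace.exp (((t : ℂ) * I) • oN N)) ∧
    IsUnitaryGroupOf o U ∧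
    (∀ U', IsUnitaryGroupOf o U' → U' = U) ∧
    (∀ (A : CARAlgebra 𝔥) (t₀ t₁ : ℝ),
      TendstoUniformlyOn (fun N t => ρ.sigma (UN N t) A) (fun t => ρ.sigma (U t) A)
        atTop (Set.Icc t₀ t₁)) ∧
    ∀ (W : ℕ → ℝ → ρ.H ≃ₗᵢ[ℂ] ρ.H) (W' : ℝ → ρ.H ≃ₗᵢ[ℂ] ρ.H),
      (∀ N t, ρ.Implements (W N t) (UN N t)) → (∀ t, ρ.Implements (W' t) (U t)) →
        ∀ (A : CARAlgebra 𝔥) (t₀ t₁ : ℝ),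
          TendstoUniformlyOn (fun N t => adUnitary (W N t) (ρ.π A))
            (fun t => adUnitary (W' t) (ρ.π A)) atTop (Set.Icc t₀ t₁)

end Convergence

end

/-! Everything reduces to strong convergence of one-particle unitaries. Since `‖a(ξ)‖ ≤ ‖ξ‖`,
convergence `U_N(t) ξ → U(t) ξ`, uniform for `t` in compact intervals, gives norm convergence on the
generators of the CAR algebra, then on the ⋆-algebra they generate, and by density everywhere. The
representation plays no role, and an implementing unitary acts on the represented algebra exactly as
the Bogoliubov automorphism does.

Strong convergence is obtained from explicit approximate solutions. Let `f n` be the columns, in the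
plane-wave basis, of a symmetric operator of first-order type (`IsFirstOrder`), and compress it to
the modes `|n| ≤ m`. Along the compressed evolution `ψ m` of a basis vector, the energy `∑ w(n)²
|c_n|²` with `w(n) = (1 + n²)²` has as derivative the expectation of a commutator. A Schur test
bounds it by the energy (`abs_commutator_sum_le`), and Grönwall gives `|c_n| ≤ D / w(n)` uniformly
in `m`. If `V` is any unitary group whose generator has columns `g n`, Duhamel's formula bounds the
distance from `V` to `ψ m` by `D (δ m + ∑_{|n| ≤ m} ‖g n - f n‖) T` with `δ m → 0`
(`IsFirstOrder.exists_approx`). Fixing `m` first leaves only finitely many columns to control. This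
single estimate yields existence of the limiting group, its uniqueness, and convergence for all
bounded self-adjoint approximants that converge on each basis vector. The approximants need no
energy estimate uniform in `N`.

What remains is concrete. A combination `∑ s_κ ℓ_κ` has matrix elements `s(χ(n - a)) χ((n + a)/2 +
shift)`, which is of first-order type once `∑ |s_κ| (1 + κ²)³` converges (`isFirstOrder_virasoro`).
The lattice coefficients converge because `sin(ε x)/ε → x`. The wavelet map is harmless in the limit
because `ŝ(0) = 1` and `ŝ(2πq) = 0` for `q ≠ 0`. For smeared generators the product of filter
symbols equals `ŝ(ε_M k) / ŝ(ε_N k)`; as `ŝ` has no zero on `[-π, π]`, it is dominated by a multiple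
of `|ŝ(ε_M k)|`, and dominated convergence applies (`tendsto_smearedKS`). -/

/-! ### From one-particle unitaries to Bogoliubov automorphisms. -/

section CARConvergence

variable {𝔥 : Type} [NormedAddCommGroup 𝔥] [InnerProductSpace ℂ 𝔥]

/-- The component of a family of operators at the representation `ρ` composed with `T`, as an
operator on `ρ.H`. -/
noncomputable def CARRep.evalComp (ρ : CARRep 𝔥) (T : 𝔥 ≃ₗᵢ[ℂ] 𝔥) :
    CARProduct 𝔥 →⋆ₐ[ℂ] (ρ.H →L[ℂ] ρ.H) where
  toFun B := B (ρ.comp T.toLinearIsometry)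
  map_one' := rfl
  map_mul' _ _ := rfl
  map_zero' := rfl
  map_add' _ _ := rfl
  commutes' _ := rfl
  map_star' _ := rfl

theorem CARRep.norm_evalComp_le (ρ : CARRep 𝔥) (T : 𝔥 ≃ₗᵢ[ℂ] 𝔥) (B : CARProduct 𝔥) :
    ‖ρ.evalComp T B‖ ≤ ‖B‖ :=
  lp.norm_apply_le_norm ENNReal.top_ne_zero B (ρ.comp T.toLinearIsometry)

theorem CARRep.sigma_eq_evalComp (ρ : CARRep 𝔥) (T : 𝔥 ≃ₗᵢ[ℂ] 𝔥) (A : CARAlgebra 𝔥) :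
    ρ.sigma T A = ρ.evalComp T A.1 := rfl

theorem CARRep.evalComp_carAnnihilation (ρ : CARRep 𝔥) (T : 𝔥 ≃ₗᵢ[ℂ] 𝔥) (ξ : 𝔥) :
    ρ.evalComp T (carAnnihilation ξ) = ρ.a (T ξ) := rfl

/-- Strong convergence of one-particle unitaries, uniform on `s`, implies norm convergence of the
Bogoliubov transforms of every element of the CAR algebra, uniform on `s`. -/
theorem CARRep.tendstoUniformlyOn_sigma (ρ : CARRep 𝔥) {UN : ℕ → ℝ → 𝔥 ≃ₗᵢ[ℂ] 𝔥}
    {U : ℝ → 𝔥 ≃ₗᵢ[ℂ] 𝔥} {s : Set ℝ}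
    (h : ∀ ξ, TendstoUniformlyOn (fun N t => UN N t ξ) (fun t => U t ξ) atTop s)
    (A : CARAlgebra 𝔥) :
    TendstoUniformlyOn (fun N t => ρ.sigma (UN N t) A) (fun t => ρ.sigma (U t) A) atTop s := by
  have key : ∀ B ∈ StarAlgebra.adjoin ℂ (Set.range (carAnnihilation (𝔥 := 𝔥))), ∀ ε > 0,
      ∀ᶠ N in atTop, ∀ t ∈ s, ‖ρ.evalComp (U t) B - ρ.evalComp (UN N t) B‖ < ε := by
    intro B hB
    induction hB using StarAlgebra.adjoin_induction with
    | mem x hx =>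
      obtain ⟨ξ, rfl⟩ := hx
      intro ε hε
      filter_upwards [Metric.tendstoUniformlyOn_iff.mp (h ξ) ε hε] with N hN t ht
      rw [ρ.evalComp_carAnnihilation, ρ.evalComp_carAnnihilation, ← map_sub]
      refine (ρ.norm_a_le _).trans_lt ?_
      rw [← dist_eq_norm]
      exact hN t ht
    | algebraMap r =>
      intro ε hε
      refine Eventually.of_forall fun N t _ => ?_
      rw [AlgHomClass.commutes, AlgHomClass.commutes, sub_self, norm_zero]
      exact hε
    | add x y _ _ hx hy =>
      intro ε hε
      filter_upwards [hx (ε / 2) (by positivity), hy (ε / 2) (by positivity)] with N h1 h2 t ht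
      rw [map_add, map_add, add_sub_add_comm]
      exact (norm_add_le _ _).trans_lt (by linarith [h1 t ht, h2 t ht])
    | mul x y _ _ hx hy =>
      intro ε hε
      have hx0 := norm_nonneg x
      have hy0 := norm_nonneg y
      -- The product is telescoped, and each factor stays bounded by `‖x‖` or `‖y‖` whatever the
      -- unitary; the `+ 1` keeps the denominator positive.
      filter_upwards [hx (ε / (‖x‖ + ‖y‖ + 1)) (by positivity),
        hy (ε / (‖x‖ + ‖y‖ + 1)) (by positivity)] with N h1 h2 t ht
      have e : ρ.evalComp (U t) (x * y) - ρ.evalComp (UN N t) (x * y) =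
          ρ.evalComp (U t) x * (ρ.evalComp (U t) y - ρ.evalComp (UN N t) y) +
          (ρ.evalComp (U t) x - ρ.evalComp (UN N t) x) * ρ.evalComp (UN N t) y := by
        rw [map_mul, map_mul, mul_sub, sub_mul]; abel
      rw [e]
      calc _ ≤ ‖x‖ * (ε / (‖x‖ + ‖y‖ + 1)) + ε / (‖x‖ + ‖y‖ + 1) * ‖y‖ := by
            refine (norm_add_le _ _).trans (add_le_add ?_ ?_)
            · exact (norm_mul_le _ _).trans (mul_le_mul (ρ.norm_evalComp_le _ _) (h2 t ht).le
                (norm_nonneg _) (norm_nonneg _))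
            · exact (norm_mul_le _ _).trans (mul_le_mul (h1 t ht).le (ρ.norm_evalComp_le _ _)
                (norm_nonneg _) (by positivity))
        _ = ε * ((‖x‖ + ‖y‖) / (‖x‖ + ‖y‖ + 1)) := by ring
        _ < ε * 1 := by
            gcongr
            rw [div_lt_one (by positivity)]; linarith
        _ = ε := mul_one _
    | star x _ hx =>
      intro ε hε
      filter_upwards [hx ε hε] with N h1 t ht
      rw [map_star, map_star, ← star_sub, norm_star]
      exact h1 t ht
  rw [Metric.tendstoUniformlyOn_iff]
  intro ε hε
  have hA : A.1 ∈ closure (StarAlgebra.adjoin ℂ (Set.range (carAnnihilation (𝔥 := 𝔥))) :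
      Set (CARProduct 𝔥)) := A.2
  obtain ⟨B, hB, hAB⟩ := Metric.mem_closure_iff.mp hA (ε / 3) (by positivity)
  rw [dist_eq_norm] at hAB
  filter_upwards [key B hB (ε / 3) (by positivity)] with N hN t ht
  rw [ρ.sigma_eq_evalComp, ρ.sigma_eq_evalComp, dist_eq_norm]
  have e : ρ.evalComp (U t) A.1 - ρ.evalComp (UN N t) A.1 =
      ρ.evalComp (U t) (A.1 - B) + (ρ.evalComp (U t) B - ρ.evalComp (UN N t) B) -
        ρ.evalComp (UN N t) (A.1 - B) := by
    rw [map_sub, map_sub]; abel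
  rw [e]
  have h1 := (ρ.norm_evalComp_le (U t) (A.1 - B)).trans_lt hAB
  have h2 := (ρ.norm_evalComp_le (UN N t) (A.1 - B)).trans_lt hAB
  have h3 := norm_sub_le (ρ.evalComp (U t) (A.1 - B) +
    (ρ.evalComp (U t) B - ρ.evalComp (UN N t) B)) (ρ.evalComp (UN N t) (A.1 - B))
  have h4 := norm_add_le (ρ.evalComp (U t) (A.1 - B))
    (ρ.evalComp (U t) B - ρ.evalComp (UN N t) B)
  linarith [hN t ht]

/-- Exhibits conjugation by a unitary as a ⋆-homomorphism, so that it is determined by its values on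
generators. -/
theorem adUnitary_eq_conjStarAlgEquiv {H : Type} [NormedAddCommGroup H] [InnerProductSpace ℂ H]
    [CompleteSpace H] (W : H ≃ₗᵢ[ℂ] H) (B : H →L[ℂ] H) :
    adUnitary W B = W.conjStarAlgEquiv B := by
  ext x
  simp [adUnitary]

/-- The adjoint action of an implementing unitary agrees with the Bogoliubov transformation. -/
theorem CARRep.Implements.adUnitary_eq {ρ : CARRep 𝔥} {W : ρ.H ≃ₗᵢ[ℂ] ρ.H} {T : 𝔥 ≃ₗᵢ[ℂ] 𝔥}
    (h : ρ.Implements W T) (A : CARAlgebra 𝔥) : adUnitary W (ρ.π A) = ρ.sigma T A := by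
  have key : ∀ B ∈ StarAlgebra.adjoin ℂ (Set.range (carAnnihilation (𝔥 := 𝔥))),
      W.conjStarAlgEquiv (B ρ) = ρ.evalComp T B := by
    intro B hB
    induction hB using StarAlgebra.adjoin_induction with
    | mem x hx =>
      obtain ⟨ξ, rfl⟩ := hx
      rw [ρ.evalComp_carAnnihilation]
      have h1 := h ξ
      rw [adUnitary_eq_conjStarAlgEquiv, map_star] at h1
      -- Implementation is formulated for creation operators; taking adjoints gives it for the
      -- generators `a(ξ)`.
      exact star_injective h1
    | algebraMap r =>
      rw [AlgHomClass.commutes]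
      exact AlgHomClass.commutes W.conjStarAlgEquiv r
    | add x y _ _ hx hy => rw [map_add, ← hx, ← hy]; exact map_add W.conjStarAlgEquiv (x ρ) (y ρ)
    | mul x y _ _ hx hy => rw [map_mul, ← hx, ← hy]; exact map_mul W.conjStarAlgEquiv (x ρ) (y ρ)
    | star x _ hx => rw [map_star, ← hx]; exact map_star W.conjStarAlgEquiv (x ρ)
  have hA : A.1 ∈ closure (StarAlgebra.adjoin ℂ (Set.range (carAnnihilation (𝔥 := 𝔥))) :
      Set (CARProduct 𝔥)) := A.2
  rw [adUnitary_eq_conjStarAlgEquiv, ρ.sigma_eq_evalComp]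
  -- Both sides are contractions, so agreement on the dense ⋆-subalgebra passes to its closure.
  have hW : ∀ B : ρ.H →L[ℂ] ρ.H, ‖W.conjStarAlgEquiv B‖ ≤ ‖B‖ := by
    intro B
    refine ContinuousLinearMap.opNorm_le_bound _ (norm_nonneg _) fun x => ?_
    have := B.le_opNorm (W.symm x)
    simpa using this
  rw [← sub_eq_zero, ← norm_le_zero_iff]
  refine le_of_forall_pos_le_add fun ε hε => ?_
  obtain ⟨B, hB, hAB⟩ := Metric.mem_closure_iff.mp hA (ε / 2) (by positivity)
  rw [dist_eq_norm] at hAB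
  have h1 := (ρ.norm_evalComp_le T (A.1 - B)).trans hAB.le
  have h2 : ‖W.conjStarAlgEquiv ((A.1 - B) ρ)‖ ≤ ε / 2 :=
    (hW _).trans ((lp.norm_apply_le_norm ENNReal.top_ne_zero (A.1 - B) ρ).trans hAB.le)
  have e : W.conjStarAlgEquiv (ρ.π A) - ρ.evalComp T A.1 =
      W.conjStarAlgEquiv ((A.1 - B) ρ) - ρ.evalComp T (A.1 - B) := by
    have e1 : W.conjStarAlgEquiv ((A.1 - B) ρ) =
        W.conjStarAlgEquiv (ρ.π A) - W.conjStarAlgEquiv (B ρ) :=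
      map_sub W.conjStarAlgEquiv (ρ.π A) (B ρ)
    rw [map_sub, e1, key B hB]; abel
  rw [e]
  have := norm_sub_le (W.conjStarAlgEquiv ((A.1 - B) ρ)) (ρ.evalComp T (A.1 - B))
  linarith

/-- Convergence of Bogoliubov transformations follows from strong convergence of the one-particle
unitary groups, uniform on compact intervals. -/
theorem bogoliubovConvergence_of_strong [CompleteSpace 𝔥] (ρ : CARRep 𝔥)
    {oN : ℕ → 𝔥 →L[ℂ] 𝔥} {o : 𝔥 →ₗ.[ℂ] 𝔥} (UN : ℕ → ℝ → 𝔥 ≃ₗᵢ[ℂ] 𝔥) (U : ℝ → 𝔥 ≃ₗᵢ[ℂ] 𝔥)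
    (hUN : ∀ N t, (UN N t : 𝔥 →L[ℂ] 𝔥) = NormedSpace.exp (((t : ℂ) * I) • oN N))
    (hU : IsUnitaryGroupOf o U) (huniq : ∀ U', IsUnitaryGroupOf o U' → U' = U)
    (hconv : ∀ ξ t₀ t₁, TendstoUniformlyOn (fun N t => UN N t ξ) (fun t => U t ξ) atTop
      (Set.Icc t₀ t₁)) :
    BogoliubovConvergence ρ oN o := by
  refine ⟨UN, U, hUN, hU, huniq, fun A t₀ t₁ => ρ.tendstoUniformlyOn_sigma
    (fun ξ => hconv ξ t₀ t₁) A, fun W W' hW hW' A t₀ t₁ => ?_⟩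
  have e1 : (fun N t => adUnitary (W N t) (ρ.π A)) = fun N t => ρ.sigma (UN N t) A := by
    funext N t; exact (hW N t).adUnitary_eq A
  have e2 : (fun t => adUnitary (W' t) (ρ.π A)) = fun t => ρ.sigma (U t) A := by
    funext t; exact (hW' t).adUnitary_eq A
  rw [e1, e2]
  exact ρ.tendstoUniformlyOn_sigma (fun ξ => hconv ξ t₀ t₁) A

end CARConvergence

/-! ### Strongly continuous unitary groups and their limits. -/

section UnitaryGroups

variable {H : Type} [NormedAddCommGroup H] [InnerProductSpace ℂ H]

/-- The unitary group generated by a bounded self-adjoint operator. -/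
theorem exists_unitary_exp [CompleteSpace H] {O : H →L[ℂ] H} (hO : IsSelfAdjoint O) :
    ∃ V : ℝ → H ≃ₗᵢ[ℂ] H,
      (∀ t, (V t : H →L[ℂ] H) = NormedSpace.exp (((t : ℂ) * I) • O)) ∧
      (∀ t u ξ, V (t + u) ξ = V t (V u ξ)) ∧
      ∀ ξ t, HasDerivAt (fun t => V t ξ) (I • O (V t ξ)) t := by
  have hsa : ∀ t : ℝ, IsSelfAdjoint ((t : ℂ) • O) := fun t =>
    IsSelfAdjoint.smul (Complex.conj_ofReal t) hO
  let V : ℝ → H ≃ₗᵢ[ℂ] H := fun t =>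
    Unitary.linearIsometryEquiv (selfAdjoint.expUnitary ⟨(t : ℂ) • O, hsa t⟩)
  have hV : ∀ t, (V t : H →L[ℂ] H) = NormedSpace.exp (((t : ℂ) * I) • O) := by
    intro t
    change ((Unitary.linearIsometryEquiv _ : H ≃ₗᵢ[ℂ] H) : H →L[ℂ] H) = _
    rw [Unitary.coe_linearIsometryEquiv_apply, selfAdjoint.expUnitary_coe, smul_smul, mul_comm]
  have hV' : ∀ t ξ, V t ξ = NormedSpace.exp ((t : ℂ) • (I • O)) ξ := by
    intro t ξ
    rw [smul_smul, ← hV]; rfl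
  refine ⟨V, hV, fun t u ξ => ?_, fun ξ t => ?_⟩
  · let +nondep : NormedAlgebra ℚ (H →L[ℂ] H) := .restrictScalars ℚ ℂ (H →L[ℂ] H)
    rw [hV', hV', hV', Complex.ofReal_add, add_smul, NormedSpace.exp_add_of_commute]
    · rfl
    · exact ((Commute.refl (I • O)).smul_left _).smul_right _
  -- The exponential is differentiated in a complex parameter and then restricted to the real line.
  · have h1 : HasDerivAt (fun u : ℂ => NormedSpace.exp (u • (I • O)))
        ((I • O) * NormedSpace.exp ((t : ℂ) • (I • O))) (t : ℂ) :=
      hasDerivAt_exp_smul_const' (I • O) (t : ℂ)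
    have h2 := h1.clm_apply (hasDerivAt_const (t : ℂ) ξ)
    rw [map_zero, add_zero] at h2
    have h3 := h2.scomp t Complex.ofRealCLM.hasDerivAt
    simp only [hV']
    simpa using! h3

theorem unitaryGroup_zero {U : ℝ → H ≃ₗᵢ[ℂ] H} (hadd : ∀ t u ξ, U (t + u) ξ = U t (U u ξ)) (ξ : H) :
    U 0 ξ = ξ := by
  have := hadd 0 0 ξ
  rw [add_zero] at this
  exact ((U 0).injective this).symm

theorem unitaryGroup_neg {U : ℝ → H ≃ₗᵢ[ℂ] H} (hadd : ∀ t u ξ, U (t + u) ξ = U t (U u ξ)) (t : ℝ)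
    (ξ : H) : U t (U (-t) ξ) = ξ := by
  rw [← hadd, add_neg_cancel, unitaryGroup_zero hadd]

/-- Since `U_s = U_t U_{s-t}`, the derivative at `0` is carried to time `t` by the fixed bounded
operator `U_t`. -/
theorem unitaryGroup_hasDerivAt {U : ℝ → H ≃ₗᵢ[ℂ] H} (hadd : ∀ t u ξ, U (t + u) ξ = U t (U u ξ))
    {ξ η : H} (h : HasDerivAt (fun t => U t ξ) η 0) (t : ℝ) :
    HasDerivAt (fun t => U t ξ) (U t η) t := by
  have h1 : HasDerivAt (fun s => U (s - t) ξ) η t := by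
    have := HasDerivAt.comp_sub_const (f := fun t => U t ξ) t t (by rwa [sub_self])
    exact this
  have h2 := (((U t).toContinuousLinearEquiv.toContinuousLinearMap.restrictScalars
    ℝ).hasFDerivAt).comp_hasDerivAt t h1
  refine (h2.congr_of_eventuallyEq ?_)
  refine Eventually.of_forall fun s => ?_
  change U s ξ = U t (U (s - t) ξ)
  rw [← hadd, add_sub_cancel]

/-- A sequence of strongly continuous unitary groups that is strongly Cauchy, uniformly on compact
intervals, converges to a strongly continuous unitary group. -/
theorem exists_limit_unitaryGroup [CompleteSpace H] {V : ℕ → ℝ → H ≃ₗᵢ[ℂ] H}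
    (hadd : ∀ N t u ξ, V N (t + u) ξ = V N t (V N u ξ))
    (hcont : ∀ N ξ, Continuous fun t => V N t ξ)
    (hC : ∀ ξ T, UniformCauchySeqOn (fun N t => V N t ξ) atTop (Set.Icc (-T) T)) :
    ∃ U : ℝ → H ≃ₗᵢ[ℂ] H, (∀ t u ξ, U (t + u) ξ = U t (U u ξ)) ∧
      (∀ ξ, Continuous fun t => U t ξ) ∧
      ∀ ξ T, TendstoUniformlyOn (fun N t => V N t ξ) (fun t => U t ξ) atTop (Set.Icc (-T) T) := by
  have hlim : ∀ t ξ, ∃ y, Tendsto (fun N => V N t ξ) atTop (𝓝 y) := fun t ξ =>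
    cauchySeq_tendsto_of_complete
      ((hC ξ |t|).cauchySeq (x := t) ⟨neg_abs_le t, le_abs_self t⟩)
  choose g hg using hlim
  have hnorm : ∀ t ξ, ‖g t ξ‖ = ‖ξ‖ := fun t ξ =>
    tendsto_nhds_unique (hg t ξ).norm (by simp)
  have hsub : ∀ t ξ η, g t (ξ - η) = g t ξ - g t η := fun t ξ η =>
    tendsto_nhds_unique (hg t (ξ - η)) (by simpa using (hg t ξ).sub (hg t η))
  -- Isometries allow the vector to vary with `N`; this is what passes the group law to the limit.
  have happ : ∀ t (x : ℕ → H) y, Tendsto x atTop (𝓝 y) →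
      Tendsto (fun N => V N t (x N)) atTop (𝓝 (g t y)) := by
    intro t x y hx
    have h1 : Tendsto (fun N => V N t (x N - y)) atTop (𝓝 0) := by
      rw [tendsto_zero_iff_norm_tendsto_zero]
      simp only [LinearIsometryEquiv.norm_map]
      rw [← tendsto_zero_iff_norm_tendsto_zero]
      simpa using hx.sub_const y
    simpa using h1.add (hg t y)
  have hgadd : ∀ t u ξ, g (t + u) ξ = g t (g u ξ) := fun t u ξ =>
    tendsto_nhds_unique (hg (t + u) ξ) (by
      simp only [hadd]; exact happ t _ _ (hg u ξ))
  have hg0 : ∀ ξ, g 0 ξ = ξ := fun ξ =>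
    tendsto_nhds_unique (hg 0 ξ) (by
      simp only [unitaryGroup_zero (hadd _)]; exact tendsto_const_nhds)
  -- A strong limit of unitaries is in general only an isometry; surjectivity comes from the inverse
  -- `g (-t)` supplied by the group law.
  let U : ℝ → H ≃ₗᵢ[ℂ] H := fun t =>
    { toFun := g t
      invFun := g (-t)
      map_add' := fun ξ η => tendsto_nhds_unique (hg t (ξ + η)) (by
        simpa using (hg t ξ).add (hg t η))
      map_smul' := fun c ξ => tendsto_nhds_unique (hg t (c • ξ)) (by
        simpa using (hg t ξ).const_smul c)
      left_inv := fun ξ => by rw [← hgadd, neg_add_cancel, hg0]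
      right_inv := fun ξ => by rw [← hgadd, add_neg_cancel, hg0]
      norm_map' := hnorm t }
  have hunif : ∀ ξ T, TendstoUniformlyOn (fun N t => V N t ξ) (fun t => U t ξ) atTop
      (Set.Icc (-T) T) := fun ξ T =>
    (hC ξ T).tendstoUniformlyOn_of_tendsto fun t _ => hg t ξ
  refine ⟨U, hgadd, fun ξ => ?_, hunif⟩
  rw [continuous_iff_continuousAt]
  intro t
  have h1 : ContinuousOn (fun t => U t ξ) (Set.Icc (-(|t| + 1)) (|t| + 1)) :=
    (hunif ξ (|t| + 1)).continuousOn (Eventually.of_forall fun N => (hcont N ξ).continuousOn).frequently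
  refine h1.continuousAt (Icc_mem_nhds ?_ ?_)
  · linarith [neg_abs_le t]
  · linarith [le_abs_self t]

/-- The set of vectors on which a family of unitaries is uniformly Cauchy is determined by a total
set. -/
theorem uniformly_small_of_total {ι : Type} {p : Filter ι} {s : Set ℝ}
    {A B : ι → ℝ → H ≃ₗᵢ[ℂ] H} {S : Set H} (hS : Dense (Submodule.span ℂ S : Set H))
    (h : ∀ x ∈ S, ∀ ε > 0, ∀ᶠ i in p, ∀ t ∈ s, ‖A i t x - B i t x‖ < ε) (x : H) :
    ∀ ε > 0, ∀ᶠ i in p, ∀ t ∈ s, ‖A i t x - B i t x‖ < ε := by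
  have key : ∀ y ∈ Submodule.span ℂ S, ∀ ε > 0, ∀ᶠ i in p, ∀ t ∈ s, ‖A i t y - B i t y‖ < ε := by
    intro y hy
    induction hy using Submodule.span_induction with
    | mem y hy => exact h y hy
    | zero =>
      intro ε hε
      exact Eventually.of_forall fun i t _ => by simpa using hε
    | add y z _ _ hy hz =>
      intro ε hε
      filter_upwards [hy (ε / 2) (by positivity), hz (ε / 2) (by positivity)] with i h1 h2 t ht
      rw [map_add, map_add, add_sub_add_comm]
      exact (norm_add_le _ _).trans_lt (by linarith [h1 t ht, h2 t ht])
    | smul c y _ hy =>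
      intro ε hε
      filter_upwards [hy (ε / (‖c‖ + 1)) (by positivity)] with i h1 t ht
      rw [map_smul, map_smul, ← smul_sub, norm_smul]
      calc ‖c‖ * ‖A i t y - B i t y‖ ≤ (‖c‖) * (ε / (‖c‖ + 1)) := by gcongr; exact (h1 t ht).le
        _ = ε * (‖c‖ / (‖c‖ + 1)) := by ring
        _ < ε * 1 := by
          gcongr
          rw [div_lt_one (by positivity)]; linarith
        _ = ε := mul_one _
  intro ε hε
  -- Both families are isometric, so replacing `x` by `y` costs less than `ε / 3` in each,
  -- independently of `i` and `t`.
  obtain ⟨y, hy, hxy⟩ := Metric.mem_closure_iff.mp (hS x) (ε / 3) (by positivity)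
  rw [dist_eq_norm] at hxy
  filter_upwards [key y hy (ε / 3) (by positivity)] with i hi t ht
  have e : A i t x - B i t x = A i t (x - y) + (A i t y - B i t y) - B i t (x - y) := by
    rw [map_sub, map_sub]; abel
  rw [e]
  have h3 := norm_sub_le (A i t (x - y) + (A i t y - B i t y)) (B i t (x - y))
  have h4 := norm_add_le (A i t (x - y)) (A i t y - B i t y)
  rw [LinearIsometryEquiv.norm_map] at h3 h4
  linarith [hi t ht]

end UnitaryGroups

/-! ### Generators prescribed on basis vectors, and Duhamel's estimate. -/

section Generation

variable {H : Type} [NormedAddCommGroup H] [InnerProductSpace ℂ H]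

/-- `U` is a strongly continuous unitary group with `d/dt U_t eₙ |_{t=0} = i fₙ`. -/
structure GeneratesOn (e f : ℤ → H) (U : ℝ → H ≃ₗᵢ[ℂ] H) : Prop where
  add : ∀ t u ξ, U (t + u) ξ = U t (U u ξ)
  continuous : ∀ ξ, Continuous fun t => U t ξ
  hasDerivAt_zero : ∀ n, HasDerivAt (fun t => U t (e n)) (I • f n) 0

/-- Differentiability at time zero and the derivative are linear in the vector, so it suffices to
know them on a spanning family of the domain. -/
theorem GeneratesOn.isUnitaryGroupOf {o : H →ₗ.[ℂ] H} {e f : ℤ → H} {U : ℝ → H ≃ₗᵢ[ℂ] H}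
    (hU : GeneratesOn e f U) (ho : o.domain = Submodule.span ℂ (Set.range e))
    (hf : ∀ n (hn : e n ∈ o.domain), o ⟨e n, hn⟩ = f n) : IsUnitaryGroupOf o U := by
  refine ⟨hU.add, hU.continuous, ?_⟩
  have key : ∀ ξ (_ : ξ ∈ Submodule.span ℂ (Set.range e)) (h : ξ ∈ o.domain),
      HasDerivAt (fun t => U t ξ) (I • o ⟨ξ, h⟩) 0 := by
    intro ξ hξ
    induction hξ using Submodule.span_induction with
    | mem x hx =>
      obtain ⟨n, rfl⟩ := hx
      intro h
      rw [hf]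
      exact hU.hasDerivAt_zero n
    | zero =>
      intro h
      have h0 : o ⟨0, h⟩ = 0 := map_zero o.toFun
      rw [h0, smul_zero]
      simpa using hasDerivAt_const (0 : ℝ) (0 : H)
    | add x y hx hy h1 h2 =>
      intro h
      rw [← ho] at hx hy
      have h0 : o ⟨x + y, h⟩ = o ⟨x, hx⟩ + o ⟨y, hy⟩ := map_add o.toFun ⟨x, hx⟩ ⟨y, hy⟩
      rw [h0, smul_add]
      simpa using! (h1 hx).add (h2 hy)
    | smul c x hx h1 =>
      intro h
      rw [← ho] at hx
      have h0 : o ⟨c • x, h⟩ = c • o ⟨x, hx⟩ := map_smul o.toFun c ⟨x, hx⟩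
      rw [h0, smul_comm]
      simpa using! (h1 hx).const_smul c
  rintro ⟨ξ, hξ⟩
  exact key ξ (ho ▸ hξ) hξ

theorem IsUnitaryGroupOf.generatesOn {o : H →ₗ.[ℂ] H} {e f : ℤ → H} {U : ℝ → H ≃ₗᵢ[ℂ] H}
    (hU : IsUnitaryGroupOf o U) (ho : ∀ n, e n ∈ o.domain)
    (hf : ∀ n (hn : e n ∈ o.domain), o ⟨e n, hn⟩ = f n) : GeneratesOn e f U := by
  refine ⟨hU.add, hU.continuous, fun n => ?_⟩
  have := hU.hasDerivAt ⟨e n, ho n⟩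
  rwa [hf] at this

theorem GeneratesOn.hasDerivAt {e f : ℤ → H} {U : ℝ → H ≃ₗᵢ[ℂ] H} (hU : GeneratesOn e f U) (n : ℤ)
    (t : ℝ) : HasDerivAt (fun t => U t (e n)) (U t (I • f n)) t :=
  unitaryGroup_hasDerivAt hU.add (hU.hasDerivAt_zero n) t

/-- Comparison of a unitary group with an approximate solution of its Schrödinger equation. -/
theorem GeneratesOn.norm_sub_le {e g : ℤ → H} {V : ℝ → H ≃ₗᵢ[ℂ] H} (hV : GeneratesOn e g V)
    (S : Finset ℤ) {c c' : ℝ → ℤ → ℂ}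
    (hc : ∀ n ∈ S, ∀ s, HasDerivAt (fun s => c s n) (c' s n) s) {T η : ℝ}
    (hη : ∀ s ∈ Set.Icc (-T) T, ‖∑ n ∈ S, (c' s n • e n - c s n • I • g n)‖ ≤ η)
    {t : ℝ} (ht : t ∈ Set.Icc (-T) T) :
    ‖V t (∑ n ∈ S, c 0 n • e n) - ∑ n ∈ S, c t n • e n‖ ≤ η * T := by
  have hT : 0 ≤ T := by linarith [ht.1, ht.2]
  have h0 : (0 : ℝ) ∈ Set.Icc (-T) T := ⟨by linarith, hT⟩
  have hη0 : 0 ≤ η := (norm_nonneg _).trans (hη 0 h0)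
  -- Interaction picture: pulling the approximate solution back by `V (-s)` leaves only the residual
  -- of its Schrödinger equation, whose norm `V (-s)` preserves.
  have hd : ∀ s, HasDerivAt (fun s => ∑ n ∈ S, c s n • V (-s) (e n))
      (V (-s) (∑ n ∈ S, (c' s n • e n - c s n • I • g n))) s := by
    intro s
    rw [map_sum]
    refine HasDerivAt.fun_sum fun n hn => ?_
    have h1 : HasDerivAt (fun s => V (-s) (e n)) (-(V (-s) (I • g n))) s := by
      have := (hV.hasDerivAt n (-s)).scomp s (hasDerivAt_neg s)
      simpa using! this
    refine ((hc n hn s).fun_smul h1).congr_deriv ?_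
    simp only [map_sub, map_smul, smul_neg]
    abel
  have h1 := (convex_Icc (-T) T).norm_image_sub_le_of_norm_hasDerivWithin_le
    (fun s _ => (hd s).hasDerivWithinAt) (C := η) (fun s hs => by
      rw [LinearIsometryEquiv.norm_map]; exact hη s hs) h0 ht
  rw [sub_zero, Real.norm_eq_abs] at h1
  -- Applying the isometry `V t` undoes the pull-back.
  have h2 : ‖(∑ n ∈ S, c t n • V (-t) (e n)) - ∑ n ∈ S, c 0 n • V (-0) (e n)‖ =
      ‖V t (∑ n ∈ S, c 0 n • e n) - ∑ n ∈ S, c t n • e n‖ := by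
    have e1 : V t (∑ n ∈ S, c t n • V (-t) (e n)) = ∑ n ∈ S, c t n • e n := by
      simp only [map_sum, map_smul, unitaryGroup_neg hV.add]
    have e2 : ∑ n ∈ S, c 0 n • V (-0) (e n) = ∑ n ∈ S, c 0 n • e n := by
      simp only [neg_zero, unitaryGroup_zero hV.add]
    rw [← (V t).norm_map, map_sub, e1, e2, norm_sub_rev]
  rw [← h2]
  exact h1.trans (mul_le_mul_of_nonneg_left (abs_le.mpr ⟨ht.1, ht.2⟩) hη0)

end Generation

/-! ### Commutator bound and Grönwall inequality for weighted energies. -/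

section Energy

/-- The sum is the time derivative of the energy `∑ w² |c|²` under `c' = i A c`. Because `A` is
Hermitian, symmetrising replaces `w n ^ 2` by the difference `w n ^ 2 - w n' ^ 2`, that is, by a
commutator. The hypothesis makes the result a kernel in `n - n'` acting on the weighted
coefficients, and the Schur test bounds it by the sum of `k`. -/
theorem abs_commutator_sum_le (S : Finset ℤ) {w : ℤ → ℝ} {k : ℤ → ℝ} (hk0 : ∀ d, 0 ≤ k d)
    (hk : Summable k) (A : ℤ → ℤ → ℂ) (hA : ∀ a n, A a n = starRingEnd ℂ (A n a))
    (hkA : ∀ a n, |w a ^ 2 - w n ^ 2| * ‖A a n‖ ≤ k (a - n) * (|w a| * |w n|)) (c : ℤ → ℂ) :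
    |∑ n ∈ S, w n ^ 2 * (2 * (starRingEnd ℂ (c n) * (I * ∑ n' ∈ S, c n' * A n n')).re)| ≤
      (∑' d, k d) * ∑ n ∈ S, w n ^ 2 * ‖c n‖ ^ 2 := by
  set B : ℤ → ℤ → ℝ := fun n n' => (starRingEnd ℂ (c n) * (I * (c n' * A n n'))).re with hB
  have hBanti : ∀ n n', B n' n = -B n n' := by
    intro n n'
    have : starRingEnd ℂ (c n') * (I * (c n * A n' n)) =
        starRingEnd ℂ (-(starRingEnd ℂ (c n) * (I * (c n' * A n n')))) := by
      rw [hA n' n]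
      simp only [map_neg, map_mul, Complex.conj_conj, Complex.conj_I]
      ring
    simp only [hB]
    rw [this, Complex.conj_re, Complex.neg_re]
  have h1 : ∑ n ∈ S, w n ^ 2 * (2 * (starRingEnd ℂ (c n) * (I * ∑ n' ∈ S, c n' * A n n')).re) =
      ∑ n ∈ S, ∑ n' ∈ S, w n ^ 2 * (2 * B n n') := by
    refine Finset.sum_congr rfl fun n _ => ?_
    rw [Finset.mul_sum, Finset.mul_sum, Complex.re_sum, Finset.mul_sum, Finset.mul_sum]
  have h2 : ∑ n ∈ S, ∑ n' ∈ S, w n ^ 2 * (2 * B n n') =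
      ∑ n ∈ S, ∑ n' ∈ S, (w n ^ 2 - w n' ^ 2) * B n n' := by
    have e1 : ∑ n ∈ S, ∑ n' ∈ S, w n ^ 2 * B n n' = -∑ n ∈ S, ∑ n' ∈ S, w n' ^ 2 * B n n' := by
      rw [Finset.sum_comm, ← Finset.sum_neg_distrib]
      refine Finset.sum_congr rfl fun n _ => ?_
      rw [← Finset.sum_neg_distrib]
      refine Finset.sum_congr rfl fun n' _ => ?_
      rw [hBanti n n']; ring
    have e2 : ∑ n ∈ S, ∑ n' ∈ S, w n ^ 2 * (2 * B n n') = 2 * ∑ n ∈ S, ∑ n' ∈ S, w n ^ 2 * B n n' := by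
      simp only [Finset.mul_sum]
      refine Finset.sum_congr rfl fun n _ => Finset.sum_congr rfl fun n' _ => by ring
    simp only [sub_mul, Finset.sum_sub_distrib]
    rw [e2]; linarith
  -- The product of weighted coefficients is split by the arithmetic–geometric mean inequality, so
  -- that only row and column sums of the kernel remain.
  have h3 : ∀ n n', |(w n ^ 2 - w n' ^ 2) * B n n'| ≤
      k (n - n') * ((w n ^ 2 * ‖c n‖ ^ 2 + w n' ^ 2 * ‖c n'‖ ^ 2) / 2) := by
    intro n n'
    have hb : |B n n'| ≤ ‖A n n'‖ * (‖c n‖ * ‖c n'‖) := by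
      refine (Complex.abs_re_le_norm _).trans (le_of_eq ?_)
      simp only [norm_mul, RCLike.norm_conj, Complex.norm_I]; ring
    rw [abs_mul]
    calc |w n ^ 2 - w n' ^ 2| * |B n n'|
        ≤ |w n ^ 2 - w n' ^ 2| * (‖A n n'‖ * (‖c n‖ * ‖c n'‖)) := by gcongr
      _ = |w n ^ 2 - w n' ^ 2| * ‖A n n'‖ * (‖c n‖ * ‖c n'‖) := by ring
      _ ≤ k (n - n') * (|w n| * |w n'|) * (‖c n‖ * ‖c n'‖) :=
        mul_le_mul_of_nonneg_right (hkA n n') (by positivity)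
      _ = k (n - n') * ((|w n| * ‖c n‖) * (|w n'| * ‖c n'‖)) := by ring
      _ ≤ _ := by
        refine mul_le_mul_of_nonneg_left ?_ (hk0 _)
        have := two_mul_le_add_sq (|w n| * ‖c n‖) (|w n'| * ‖c n'‖)
        rw [mul_pow, mul_pow, sq_abs, sq_abs] at this
        linarith
  have hrow : ∀ n, ∑ n' ∈ S, k (n - n') ≤ ∑' d, k d := by
    intro n
    rw [← (Equiv.subLeft n).tsum_eq k]
    exact ((Equiv.subLeft n).summable_iff.mpr hk).sum_le_tsum S (fun i _ => hk0 _)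
  have hcol : ∀ n', ∑ n ∈ S, k (n - n') ≤ ∑' d, k d := by
    intro n'
    rw [← (Equiv.subRight n').tsum_eq k]
    exact ((Equiv.subRight n').summable_iff.mpr hk).sum_le_tsum S (fun i _ => hk0 _)
  rw [h1, h2]
  refine (Finset.abs_sum_le_sum_abs _ _).trans ?_
  calc ∑ n ∈ S, |∑ n' ∈ S, (w n ^ 2 - w n' ^ 2) * B n n'|
      ≤ ∑ n ∈ S, ∑ n' ∈ S, k (n - n') * ((w n ^ 2 * ‖c n‖ ^ 2 + w n' ^ 2 * ‖c n'‖ ^ 2) / 2) :=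
        Finset.sum_le_sum fun n _ => (Finset.abs_sum_le_sum_abs _ _).trans
          (Finset.sum_le_sum fun n' _ => h3 n n')
    _ = (∑ n ∈ S, (∑ n' ∈ S, k (n - n')) * (w n ^ 2 * ‖c n‖ ^ 2)) / 2 +
        (∑ n' ∈ S, (∑ n ∈ S, k (n - n')) * (w n' ^ 2 * ‖c n'‖ ^ 2)) / 2 := by
        rw [Finset.sum_comm (s := S) (t := S) (f := fun n n' =>
          k (n - n') * ((w n ^ 2 * ‖c n‖ ^ 2 + w n' ^ 2 * ‖c n'‖ ^ 2) / 2))]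
        rw [← add_div]
        simp only [Finset.sum_mul]
        rw [Finset.sum_comm (s := S) (t := S) (f := fun n n' => k (n - n') * (w n ^ 2 * ‖c n‖ ^ 2)),
          ← Finset.sum_add_distrib, Finset.sum_div]
        refine Finset.sum_congr rfl fun n _ => ?_
        rw [← Finset.sum_add_distrib, Finset.sum_div]
        refine Finset.sum_congr rfl fun n' _ => by ring
    _ ≤ (∑ n ∈ S, (∑' d, k d) * (w n ^ 2 * ‖c n‖ ^ 2)) / 2 +
        (∑ n' ∈ S, (∑' d, k d) * (w n' ^ 2 * ‖c n'‖ ^ 2)) / 2 := by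
        gcongr with n _ n' _
        · exact hrow n
        · exact hcol n'
    _ = _ := by rw [← Finset.mul_sum]; ring

/-- A two-sided Grönwall inequality. -/
theorem le_mul_exp_of_abs_deriv_le {g g' : ℝ → ℝ} {K : ℝ} (hg : ∀ t, HasDerivAt g (g' t) t)
    (h : ∀ t, |g' t| ≤ K * g t) (t : ℝ) : g t ≤ g 0 * Real.exp (K * |t|) := by
  have main : ∀ (f f' : ℝ → ℝ), (∀ t, HasDerivAt f (f' t) t) → (∀ t, f' t ≤ K * f t) →
      ∀ t, 0 ≤ t → f t ≤ f 0 * Real.exp (K * t) := by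
    intro f f' hf hff t ht
    have hd : ∀ t, HasDerivAt (fun t => f t * Real.exp (-(K * t)))
        ((f' t - K * f t) * Real.exp (-(K * t))) t := by
      intro t
      have h1 : HasDerivAt (fun t => -(K * t)) (-K) t := by
        simpa using! ((hasDerivAt_id t).const_mul K).neg
      refine ((hf t).fun_mul h1.exp).congr_deriv ?_
      ring
    have hanti : Antitone fun t => f t * Real.exp (-(K * t)) :=
      antitone_of_hasDerivAt_nonpos hd fun t =>
        mul_nonpos_of_nonpos_of_nonneg (by linarith [hff t]) (Real.exp_pos _).le
    have := hanti ht
    simp only [mul_zero, neg_zero, Real.exp_zero, mul_one] at this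
    calc f t = f t * Real.exp (-(K * t)) * Real.exp (K * t) := by
          rw [mul_assoc, ← Real.exp_add]; simp
      _ ≤ _ := by gcongr
  -- Negative times follow from the forward estimate applied to `t ↦ g (-t)`.
  rcases le_total 0 t with ht | ht
  · rw [abs_of_nonneg ht]
    exact main g g' hg (fun t => (le_abs_self _).trans (h t)) t ht
  · rw [abs_of_nonpos ht]
    have := main (fun t => g (-t)) (fun t => -g' (-t))
      (fun t => by simpa using! (hg (-t)).scomp t (hasDerivAt_neg t))
      (fun t => (neg_le_abs _).trans (h (-t))) (-t) (by linarith)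
    simpa using this

end Energy

/-! ### Compressions to finitely many modes. -/

section Truncation

variable {H : Type} [NormedAddCommGroup H] [InnerProductSpace ℂ H]

/-- The projection onto the span of the basis vectors with index in `S`. -/
noncomputable def basisProj (b : HilbertBasis ℤ ℂ H) (S : Finset ℤ) (x : H) : H := ∑ a ∈ S, ⟪b a, x⟫_ℂ • b a

theorem inner_basisProj (b : HilbertBasis ℤ ℂ H) (S : Finset ℤ) (x : H) (a : ℤ) :
    ⟪b a, basisProj b S x⟫_ℂ = if a ∈ S then ⟪b a, x⟫_ℂ else 0 := by
  simp only [basisProj, inner_sum, inner_smul_right, orthonormal_iff_ite.mp b.orthonormal]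
  simp

/-- Pythagoras: the remainder is orthogonal to the projection. -/
theorem norm_sub_basisProj_le (b : HilbertBasis ℤ ℂ H) (S : Finset ℤ) (x : H) :
    ‖x - basisProj b S x‖ ≤ ‖x‖ := by
  have h0 : ⟪basisProj b S x, x - basisProj b S x⟫_ℂ = 0 := by
    conv_lhs => rw [basisProj, sum_inner]
    refine Finset.sum_eq_zero fun a ha => ?_
    rw [inner_smul_left, inner_sub_right]
    have := inner_basisProj b S x a
    rw [if_pos ha, basisProj] at this
    rw [this, sub_self, mul_zero]
  have h1 := norm_add_sq_eq_norm_sq_add_norm_sq_of_inner_eq_zero _ _ h0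
  rw [add_sub_cancel] at h1
  nlinarith [norm_nonneg x, norm_nonneg (basisProj b S x), norm_nonneg (x - basisProj b S x)]

theorem tendsto_basisProj (b : HilbertBasis ℤ ℂ H) (x : H) :
    Tendsto (fun m : ℕ => basisProj b (Finset.Icc (-(m : ℤ)) m) x) atTop (𝓝 x) := by
  have h := (b.hasSum_repr x).comp Finset.tendsto_Icc_neg
  refine h.congr fun m => ?_
  simp [basisProj, HilbertBasis.repr_apply_apply]

/-- The compression, to the span of the basis vectors with index in `S`, of the operator with
columns `f`. -/
noncomputable def truncOp (b : HilbertBasis ℤ ℂ H) (f : ℤ → H) (S : Finset ℤ) : H →L[ℂ] H :=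
  ∑ n ∈ S, ∑ a ∈ S, ⟪b a, f n⟫_ℂ • InnerProductSpace.rankOne ℂ (b a) (b n)

theorem truncOp_apply (b : HilbertBasis ℤ ℂ H) (f : ℤ → H) (S : Finset ℤ) (x : H) :
    truncOp b f S x = ∑ n ∈ S, ⟪b n, x⟫_ℂ • basisProj b S (f n) := by
  simp only [truncOp, basisProj, sum_apply, smul_apply,
    InnerProductSpace.rankOne_apply, Finset.smul_sum]
  refine Finset.sum_congr rfl fun n _ => Finset.sum_congr rfl fun a _ => ?_
  rw [smul_comm]

theorem truncOp_basis (b : HilbertBasis ℤ ℂ H) (f : ℤ → H) {S : Finset ℤ} {n : ℤ} (hn : n ∈ S) :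
    truncOp b f S (b n) = basisProj b S (f n) := by
  rw [truncOp_apply]
  simp only [orthonormal_iff_ite.mp b.orthonormal]
  simp [hn]

theorem inner_truncOp (b : HilbertBasis ℤ ℂ H) (f : ℤ → H) (S : Finset ℤ) (x : H) (a : ℤ) :
    ⟪b a, truncOp b f S x⟫_ℂ = if a ∈ S then ∑ n ∈ S, ⟪b n, x⟫_ℂ * ⟪b a, f n⟫_ℂ else 0 := by
  rw [truncOp_apply, inner_sum]
  simp only [inner_smul_right, inner_basisProj]
  split_ifs <;> simp

theorem isSelfAdjoint_truncOp [CompleteSpace H] (b : HilbertBasis ℤ ℂ H) {f : ℤ → H}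
    (hf : ∀ a n, ⟪b a, f n⟫_ℂ = starRingEnd ℂ ⟪b n, f a⟫_ℂ) (S : Finset ℤ) :
    IsSelfAdjoint (truncOp b f S) := by
  rw [IsSelfAdjoint, truncOp, star_sum, Finset.sum_comm]
  refine Finset.sum_congr rfl fun n _ => ?_
  rw [star_sum]
  refine Finset.sum_congr rfl fun a _ => ?_
  rw [star_smul, ContinuousLinearMap.star_eq_adjoint, InnerProductSpace.adjoint_rankOne]
  congr 1
  exact (hf n a).symm

end Truncation

/-- The weight `(1 + n²)²`. -/
noncomputable def momentumWeight (n : ℤ) : ℝ := (1 + (n : ℝ) ^ 2) ^ 2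

theorem momentumWeight_pos (n : ℤ) : 0 < momentumWeight n := by
  unfold momentumWeight; positivity

/-! ### First-order operators and the approximation of their evolutions. -/

section FirstOrder

variable {H : Type} [NormedAddCommGroup H] [InnerProductSpace ℂ H]

/-- The columns of a symmetric operator with the off-diagonal decay of a first-order differential
operator with smooth coefficients: its commutator with the square of the weight is bounded relative
to that square. -/
structure IsFirstOrder (b : HilbertBasis ℤ ℂ H) (f : ℤ → H) : Prop where
  symm : ∀ a n, ⟪b a, f n⟫_ℂ = starRingEnd ℂ ⟪b n, f a⟫_ℂ
  comm : ∃ k : ℤ → ℝ, Summable k ∧ ∀ a n,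
    |momentumWeight a ^ 2 - momentumWeight n ^ 2| * ‖⟪b a, f n⟫_ℂ‖ ≤
      k (a - n) * (momentumWeight a * momentumWeight n)
  bound : ∃ C : ℝ, ∀ n, ‖f n‖ ≤ C * (1 + (n : ℝ) ^ 2)

theorem summable_inv_one_add_sq : Summable fun n : ℤ => (1 + (n : ℝ) ^ 2)⁻¹ := by
  refine Summable.of_norm_bounded_eventually
    ((Real.summable_one_div_int_pow (p := 2)).mpr one_lt_two) ?_
  rw [eventually_cofinite]
  refine (Set.finite_singleton (0 : ℤ)).subset fun n hn => ?_
  by_contra h0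
  refine hn ?_
  have : (n : ℝ) ≠ 0 := by exact_mod_cast h0
  have : 0 < (n : ℝ) ^ 2 := by positivity
  rw [Real.norm_of_nonneg (by positivity), one_div]
  gcongr
  linarith

variable [CompleteSpace H]

/-- The key estimate: every unitary group whose generator has columns close to those of a
first-order operator is close to the finite-dimensional evolutions `ψ m`. -/
theorem IsFirstOrder.exists_approx {b : HilbertBasis ℤ ℂ H} {f : ℤ → H} (hf : IsFirstOrder b f)
    (n₀ : ℤ) {T : ℝ} (hT : 0 ≤ T) :
    ∃ D : ℝ, 0 ≤ D ∧ ∃ δ : ℕ → ℝ, Tendsto δ atTop (𝓝 0) ∧ ∃ ψ : ℕ → ℝ → H,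
      ∀ m : ℕ, n₀ ∈ Finset.Icc (-(m : ℤ)) m → ∀ g V, GeneratesOn b g V → ∀ t ∈ Set.Icc (-T) T,
        ‖V t (b n₀) - ψ m t‖ ≤ D * (δ m + ∑ n ∈ Finset.Icc (-(m : ℤ)) m, ‖g n - f n‖) * T := by
  obtain ⟨k, hk, hkf⟩ := hf.comm
  obtain ⟨C, hC⟩ := hf.bound
  -- Nonnegativity of the kernel is forced by the commutator bound in the column `n = 0`, since the
  -- weights are positive.
  have hk0 : ∀ d, 0 ≤ k d := by
    intro d
    have h1 := hkf d 0
    rw [sub_zero] at h1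
    have h2 : 0 ≤ k d * (momentumWeight d * momentumWeight 0) := le_trans (by positivity) h1
    exact nonneg_of_mul_nonneg_left h2 (mul_pos (momentumWeight_pos _) (momentumWeight_pos _))
  set K := ∑' d, k d with hK
  set S : ℕ → Finset ℤ := fun m => Finset.Icc (-(m : ℤ)) m with hS
  have hex := fun m => exists_unitary_exp (isSelfAdjoint_truncOp b hf.symm (S m))
  choose W _ hWadd hWderiv using hex
  set c : ℕ → ℝ → ℤ → ℂ := fun m s n => ⟪b n, W m s (b n₀)⟫_ℂ with hc
  set c' : ℕ → ℝ → ℤ → ℂ := fun m s n => I * ⟪b n, truncOp b f (S m) (W m s (b n₀))⟫_ℂ with hc'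
  have hderiv : ∀ m s n, HasDerivAt (fun s => c m s n) (c' m s n) s := by
    intro m s n
    have h1 := (hasDerivAt_const s (b n)).inner ℂ (hWderiv m (b n₀) s)
    simpa [hc, hc', inner_smul_right] using h1
  have hc0 : ∀ m n, c m 0 n = if n = n₀ then 1 else 0 := by
    intro m n
    simp only [hc, unitaryGroup_zero (hWadd m)]
    exact orthonormal_iff_ite.mp b.orthonormal n n₀
  have hc'S : ∀ m s, ∀ n ∈ S m, c' m s n = I * ∑ n' ∈ S m, c m s n' * ⟪b n, f n'⟫_ℂ := by
    intro m s n hn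
    simp only [hc', inner_truncOp, if_pos hn, hc]
  -- weighted energy
  set E : ℕ → ℝ → ℝ := fun m s => ∑ n ∈ S m, momentumWeight n ^ 2 * ‖c m s n‖ ^ 2 with hE
  have hEd : ∀ m s, HasDerivAt (E m) (∑ n ∈ S m, momentumWeight n ^ 2 *
      (2 * (starRingEnd ℂ (c m s n) * (I * ∑ n' ∈ S m, c m s n' * ⟪b n, f n'⟫_ℂ)).re)) s := by
    intro m s
    refine HasDerivAt.fun_sum fun n hn => HasDerivAt.const_mul _ ?_
    rw [← hc'S m s n hn]
    have h1 := (hderiv m s n).norm_sq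
    refine h1.congr_deriv ?_
    rw [real_inner_eq_re_inner ℂ]
    simp [mul_comm]
  -- The rate `K` does not depend on `m`: compressing only restricts the double sum in the
  -- commutator estimate.
  have hEbound : ∀ m, n₀ ∈ S m → ∀ s, E m s ≤ momentumWeight n₀ ^ 2 * Real.exp (K * |s|) := by
    intro m hm s
    have h1 := le_mul_exp_of_abs_deriv_le (hEd m) (K := K) (fun t => by
      refine abs_commutator_sum_le (S m) hk0 hk (fun a n => ⟪b a, f n⟫_ℂ) hf.symm (fun a n => ?_) _
      rw [abs_of_pos (momentumWeight_pos a), abs_of_pos (momentumWeight_pos n)]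
      exact hkf a n) s
    have h2 : E m 0 = momentumWeight n₀ ^ 2 := by
      simp only [hE, hc0]
      rw [Finset.sum_eq_single_of_mem n₀ hm]
      · simp
      · intro n _ hn; simp [hn]
    rwa [h2] at h1
  -- The exponent `K T` is twice what the energy bound requires; this avoids a square root of the
  -- exponential.
  set D : ℝ := momentumWeight n₀ * Real.exp (K * T) with hD
  have hK0 : 0 ≤ K := tsum_nonneg hk0
  have hD0 : 0 ≤ D := mul_nonneg (momentumWeight_pos _).le (Real.exp_pos _).le
  have hcbound : ∀ m, n₀ ∈ S m → ∀ s ∈ Set.Icc (-T) T, ∀ n ∈ S m,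
      ‖c m s n‖ ≤ D * (momentumWeight n)⁻¹ := by
    intro m hm s hs n hn
    rw [← div_eq_mul_inv, le_div_iff₀ (momentumWeight_pos n)]
    refine le_of_sq_le_sq ?_ hD0
    have h1 : momentumWeight n ^ 2 * ‖c m s n‖ ^ 2 ≤ E m s :=
      Finset.single_le_sum (f := fun n => momentumWeight n ^ 2 * ‖c m s n‖ ^ 2)
        (fun i _ => by positivity) hn
    calc (‖c m s n‖ * momentumWeight n) ^ 2 = momentumWeight n ^ 2 * ‖c m s n‖ ^ 2 := by ring
      _ ≤ momentumWeight n₀ ^ 2 * Real.exp (K * |s|) := h1.trans (hEbound m hm s)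
      _ ≤ momentumWeight n₀ ^ 2 * (Real.exp (K * T)) ^ 2 := by
          gcongr
          rw [← Real.exp_nat_mul]
          refine Real.exp_le_exp.mpr ?_
          have : |s| ≤ T := abs_le.mpr ⟨hs.1, hs.2⟩
          push_cast
          nlinarith [mul_nonneg hK0 hT, mul_le_mul_of_nonneg_left this hK0]
      _ = D ^ 2 := by rw [hD]; ring
  set δ : ℕ → ℝ := fun m => ∑' n : ℤ, (momentumWeight n)⁻¹ * ‖f n - basisProj b (S m) (f n)‖ with hδ
  -- Here the exponent of the weight is used: `(1 + n²)⁻²` against columns of size `1 + n²` leaves a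
  -- summable majorant, so `δ m → 0` by dominated convergence.
  have hdom : ∀ m n, (momentumWeight n)⁻¹ * ‖f n - basisProj b (S m) (f n)‖ ≤
      C * (1 + (n : ℝ) ^ 2)⁻¹ := by
    intro m n
    have h1 : ‖f n - basisProj b (S m) (f n)‖ ≤ C * (1 + (n : ℝ) ^ 2) :=
      (norm_sub_basisProj_le b _ _).trans (hC n)
    have h2 := momentumWeight_pos n
    calc _ ≤ (momentumWeight n)⁻¹ * (C * (1 + (n : ℝ) ^ 2)) := by gcongr
      _ = _ := by
        unfold momentumWeight
        have : (1 + (n : ℝ) ^ 2) ≠ 0 := by positivity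
        field_simp
  have hnn : ∀ m n, 0 ≤ (momentumWeight n)⁻¹ * ‖f n - basisProj b (S m) (f n)‖ := fun m n =>
    mul_nonneg (inv_nonneg.mpr (momentumWeight_pos n).le) (norm_nonneg _)
  have hsumC : Summable fun n : ℤ => C * (1 + (n : ℝ) ^ 2)⁻¹ := summable_inv_one_add_sq.mul_left C
  have hδ0 : Tendsto δ atTop (𝓝 0) := by
    have := tendsto_tsum_of_dominated_convergence (𝓕 := atTop)
      (f := fun m n => (momentumWeight n)⁻¹ * ‖f n - basisProj b (S m) (f n)‖)
      (g := fun _ => 0) hsumC (fun n => by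
        have h1 := ((tendsto_basisProj b (f n)).const_sub (f n)).norm.const_mul (momentumWeight n)⁻¹
        simpa using h1)
      (Eventually.of_forall fun m n => by
        rw [Real.norm_of_nonneg (hnn m n)]; exact hdom m n)
    simpa using this
  -- The approximate solution is the compressed evolution itself. It is chosen before `g` and `V`,
  -- so it can be compared with several groups at once.
  refine ⟨D, hD0, δ, hδ0, fun m t => ∑ n ∈ S m, c m t n • b n, fun m hm g V hV t ht => ?_⟩
  have h0 : ∑ n ∈ S m, c m 0 n • b n = b n₀ := by
    simp only [hc0]
    rw [Finset.sum_eq_single_of_mem n₀ hm]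
    · simp
    · intro n _ hn; simp [hn]
  have hmain := hV.norm_sub_le (S m) (c := c m) (c' := c' m) (fun n _ s => hderiv m s n)
    (η := D * (δ m + ∑ n ∈ S m, ‖g n - f n‖)) (T := T) (fun s hs => ?_) ht
  · rwa [h0] at hmain
  -- The residual of the compressed evolution as a solution for `V`: mode by mode it is the
  -- truncation error of `f n` plus the discrepancy between `f n` and `g n`.
  have e1 : ∑ n ∈ S m, (c' m s n • b n - c m s n • I • g n) =
      ∑ n ∈ S m, (c m s n * I) • (basisProj b (S m) (f n) - g n) := by
    have e2 : ∑ n ∈ S m, c' m s n • b n = ∑ n ∈ S m, (c m s n * I) • basisProj b (S m) (f n) := by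
      simp only [basisProj, Finset.smul_sum]
      rw [Finset.sum_comm]
      refine Finset.sum_congr rfl fun n hn => ?_
      rw [hc'S m s n hn, Finset.mul_sum, Finset.sum_smul]
      refine Finset.sum_congr rfl fun n' _ => ?_
      rw [smul_smul]; congr 1; ring
    rw [Finset.sum_sub_distrib, e2, ← Finset.sum_sub_distrib]
    refine Finset.sum_congr rfl fun n _ => ?_
    rw [smul_sub, smul_smul]
  rw [e1]
  calc ‖∑ n ∈ S m, (c m s n * I) • (basisProj b (S m) (f n) - g n)‖
      ≤ ∑ n ∈ S m, (D * ((momentumWeight n)⁻¹ * ‖f n - basisProj b (S m) (f n)‖) +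
          D * ‖g n - f n‖) := by
        refine (norm_sum_le _ _).trans (Finset.sum_le_sum fun n hn => ?_)
        have h1 := hcbound m hm s hs n hn
        have hw : (momentumWeight n)⁻¹ ≤ 1 := by
          refine inv_le_one_of_one_le₀ ?_
          unfold momentumWeight
          nlinarith [sq_nonneg (n : ℝ), sq_nonneg ((n : ℝ) ^ 2)]
        have hw0 := inv_nonneg.mpr (momentumWeight_pos n).le
        have h2 : ‖basisProj b (S m) (f n) - g n‖ ≤
            ‖f n - basisProj b (S m) (f n)‖ + ‖g n - f n‖ := by
          rw [norm_sub_rev (f n), norm_sub_rev (g n)]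
          exact norm_sub_le_norm_sub_add_norm_sub _ _ _
        rw [norm_smul, norm_mul, Complex.norm_I, mul_one]
        calc _ ≤ D * (momentumWeight n)⁻¹ *
              (‖f n - basisProj b (S m) (f n)‖ + ‖g n - f n‖) := by gcongr
          _ = D * ((momentumWeight n)⁻¹ * ‖f n - basisProj b (S m) (f n)‖) +
              D * ((momentumWeight n)⁻¹ * ‖g n - f n‖) := by ring
          _ ≤ _ := by
            gcongr
            exact mul_le_of_le_one_left (norm_nonneg _) hw
    _ = D * (∑ n ∈ S m, (momentumWeight n)⁻¹ * ‖f n - basisProj b (S m) (f n)‖ +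
          ∑ n ∈ S m, ‖g n - f n‖) := by
        rw [Finset.sum_add_distrib, ← Finset.mul_sum, ← Finset.mul_sum, mul_add]
    _ ≤ _ := by
        gcongr
        exact (Summable.of_nonneg_of_le (hnn m) (hdom m) hsumC).sum_le_tsum _ (fun n _ => hnn m n)

end FirstOrder

/-! ### Existence, uniqueness and strong convergence of the evolutions. -/

section StrongConvergence

variable {H : Type} [NormedAddCommGroup H] [InnerProductSpace ℂ H]

theorem HilbertBasis.dense_range_span (b : HilbertBasis ℤ ℂ H) :
    Dense (Submodule.span ℂ (Set.range b) : Set H) := by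
  rw [Submodule.dense_iff_topologicalClosure_eq_top]
  exact b.dense_span

theorem generatesOn_exp {O : H →L[ℂ] H} {V : ℝ → H ≃ₗᵢ[ℂ] H}
    (hadd : ∀ t u ξ, V (t + u) ξ = V t (V u ξ))
    (hd : ∀ ξ t, HasDerivAt (fun t => V t ξ) (I • O (V t ξ)) t) (e : ℤ → H) :
    GeneratesOn e (fun n => O (e n)) V :=
  ⟨hadd, fun ξ => continuous_iff_continuousAt.mpr fun t => (hd ξ t).continuousAt, fun n => by
    have := hd (e n) 0
    rwa [unitaryGroup_zero hadd] at this⟩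

variable [CompleteSpace H]

/-- Both groups are compared with the same `ψ m`. The cutoff `m` is fixed first to make `D * δ m *
T` small; afterwards only the finitely many columns `|n| ≤ m` have to be close to `f n`, so
pointwise convergence suffices. The general filter serves Cauchy sequences, uniqueness and
convergence alike. -/
theorem IsFirstOrder.eventually_close {b : HilbertBasis ℤ ℂ H} {f : ℤ → H} (hf : IsFirstOrder b f)
    {ι : Type} {p : Filter ι} {g : ι → ℤ → H} {V : ι → ℝ → H ≃ₗᵢ[ℂ] H}
    (hV : ∀ i, GeneratesOn b (g i) (V i)) (hg : ∀ n, Tendsto (fun i => g i n) p (𝓝 (f n)))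
    {g' : ι → ℤ → H} {V' : ι → ℝ → H ≃ₗᵢ[ℂ] H}
    (hV' : ∀ i, GeneratesOn b (g' i) (V' i)) (hg' : ∀ n, Tendsto (fun i => g' i n) p (𝓝 (f n)))
    (ξ : H) (T : ℝ) :
    ∀ ε > 0, ∀ᶠ i in p, ∀ t ∈ Set.Icc (-T) T, ‖V i t ξ - V' i t ξ‖ < ε := by
  rcases lt_or_ge T 0 with hT | hT
  · intro ε _
    refine Eventually.of_forall fun i t ht => ?_
    linarith [ht.1, ht.2]
  refine uniformly_small_of_total b.dense_range_span ?_ ξ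
  rintro _ ⟨n₀, rfl⟩ ε hε
  obtain ⟨D, hD, δ, hδ, ψ, hψ⟩ := hf.exists_approx n₀ hT
  obtain ⟨m, hm1, hm2⟩ : ∃ m : ℕ, D * δ m * T < ε / 4 ∧ n₀ ∈ Finset.Icc (-(m : ℤ)) m := by
    have h1 : Tendsto (fun m => D * δ m * T) atTop (𝓝 0) := by
      simpa using (hδ.const_mul D).mul_const T
    refine ((h1.eventually_lt_const (by positivity : (0 : ℝ) < ε / 4)).and
      ((eventually_ge_atTop n₀.natAbs).mono fun m hm => ?_)).exists
    rw [Finset.mem_Icc]; omega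
  have hsum : ∀ g : ι → ℤ → H, (∀ n, Tendsto (fun i => g i n) p (𝓝 (f n))) →
      ∀ᶠ i in p, D * (∑ n ∈ Finset.Icc (-(m : ℤ)) m, ‖g i n - f n‖) * T < ε / 4 := by
    intro g hg
    have h1 : Tendsto (fun i => D * (∑ n ∈ Finset.Icc (-(m : ℤ)) m, ‖g i n - f n‖) * T) p (𝓝 0) := by
      have h2 : Tendsto (fun i => ∑ n ∈ Finset.Icc (-(m : ℤ)) m, ‖g i n - f n‖) p (𝓝 0) := by
        rw [← Finset.sum_const_zero (s := Finset.Icc (-(m : ℤ)) m)]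
        refine tendsto_finsetSum _ fun n _ => ?_
        simpa using ((hg n).sub_const (f n)).norm
      simpa using (h2.const_mul D).mul_const T
    exact h1.eventually_lt_const (by positivity)
  filter_upwards [hsum g hg, hsum g' hg'] with i h1 h2 t ht
  have h3 := hψ m hm2 (g i) (V i) (hV i) t ht
  have h4 := hψ m hm2 (g' i) (V' i) (hV' i) t ht
  have h5 := norm_sub_le_norm_sub_add_norm_sub (V i t (b n₀)) (ψ m t) (V' i t (b n₀))
  rw [norm_sub_rev (ψ m t)] at h5
  rw [mul_add, add_mul] at h3 h4
  linarith

/-- A first-order operator generates a unitary group. -/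
theorem IsFirstOrder.exists_unitaryGroup {b : HilbertBasis ℤ ℂ H} {f : ℤ → H}
    (hf : IsFirstOrder b f) : ∃ U : ℝ → H ≃ₗᵢ[ℂ] H, GeneratesOn b f U := by
  set S : ℕ → Finset ℤ := fun m => Finset.Icc (-(m : ℤ)) m with hS
  have hex := fun m => exists_unitary_exp (isSelfAdjoint_truncOp b hf.symm (S m))
  choose W _ hWadd hWderiv using hex
  have hW : ∀ m, GeneratesOn b (fun n => truncOp b f (S m) (b n)) (W m) := fun m =>
    generatesOn_exp (hWadd m) (hWderiv m) b
  have hg : ∀ n, Tendsto (fun m => truncOp b f (S m) (b n)) atTop (𝓝 (f n)) := by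
    intro n
    refine (tendsto_basisProj b (f n)).congr' ?_
    filter_upwards [eventually_ge_atTop n.natAbs] with m hm
    rw [truncOp_basis]
    rw [hS, Finset.mem_Icc]; omega
  have hC : ∀ ξ T, UniformCauchySeqOn (fun N t => W N t ξ) atTop (Set.Icc (-T) T) := by
    intro ξ T
    rw [Metric.uniformCauchySeqOn_iff]
    intro ε hε
    -- Indexing by pairs turns closeness of two families into the Cauchy property of the compressed
    -- evolutions.
    have h1 := hf.eventually_close (p := (atTop : Filter (ℕ × ℕ)))
      (g := fun i n => truncOp b f (S i.1) (b n)) (V := fun i => W i.1) (fun i => hW i.1)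
      (fun n => (hg n).comp (by rw [← prod_atTop_atTop_eq]; exact tendsto_fst))
      (g' := fun i n => truncOp b f (S i.2) (b n)) (V' := fun i => W i.2) (fun i => hW i.2)
      (fun n => (hg n).comp (by rw [← prod_atTop_atTop_eq]; exact tendsto_snd)) ξ T ε hε
    obtain ⟨⟨N₁, N₂⟩, hN⟩ := eventually_atTop.mp h1
    refine ⟨max N₁ N₂, fun m hm n hn t ht => ?_⟩
    rw [dist_eq_norm]
    exact hN (m, n) ⟨(le_max_left _ _).trans hm, (le_max_right _ _).trans hn⟩ t ht
  obtain ⟨U, hadd, hcont, hlim⟩ := exists_limit_unitaryGroup hWadd (fun N => (hW N).continuous) hC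
  refine ⟨U, hadd, hcont, fun n => ?_⟩
  -- Differentiation passes to the limit because the derivatives `W N t (I • truncOp b f (S N) (b
  -- n))` converge uniformly near zero: the columns converge and the `W N t` are isometric.
  have h := hasDerivAt_of_tendstoUniformlyOn (l := atTop) (isOpen_Ioo (a := (-1 : ℝ)) (b := 1))
    (f := fun N t => W N t (b n)) (f' := fun N t => W N t (I • truncOp b f (S N) (b n)))
    (g := fun t => U t (b n)) (g' := fun t => U t (I • f n)) (x := 0) ?_
    (Eventually.of_forall fun N t _ => (hW N).hasDerivAt n t)
    (fun t ht => (hlim (b n) 1).tendsto_at (Set.Ioo_subset_Icc_self ht)) (by norm_num)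
  · rwa [unitaryGroup_zero hadd] at h
  rw [Metric.tendstoUniformlyOn_iff]
  intro ε hε
  have h1 := Metric.tendstoUniformlyOn_iff.mp (hlim (I • f n) 1) (ε / 2) (by positivity)
  have h2 := Metric.tendsto_nhds.mp (hg n) (ε / 2) (by positivity)
  filter_upwards [h1, h2] with N h1 h2 t ht
  have h3 := h1 t (Set.Ioo_subset_Icc_self ht)
  rw [dist_eq_norm] at h2
  have h4 : dist (W N t (I • f n)) (W N t (I • truncOp b f (S N) (b n))) < ε / 2 := by
    rw [dist_eq_norm, ← map_sub, LinearIsometryEquiv.norm_map, ← smul_sub, norm_smul,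
      Complex.norm_I, one_mul, norm_sub_rev]
    exact h2
  exact (dist_triangle _ _ _).trans_lt (by linarith)

/-- Strong convergence on the basis vectors to a first-order operator implies convergence of the
Bogoliubov transformations in every representation of the CAR. -/
theorem IsFirstOrder.bogoliubovConvergence {b : HilbertBasis ℤ ℂ H} {f : ℤ → H}
    (hf : IsFirstOrder b f) (ρ : CARRep H) {oN : ℕ → H →L[ℂ] H} {o : H →ₗ.[ℂ] H}
    (hsa : ∀ N, IsSelfAdjoint (oN N)) (ho : o.domain = Submodule.span ℂ (Set.range b))
    (hof : ∀ n (hn : b n ∈ o.domain), o ⟨b n, hn⟩ = f n)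
    (hlim : ∀ n, Tendsto (fun N => oN N (b n)) atTop (𝓝 (f n))) :
    BogoliubovConvergence ρ oN o := by
  have hex := fun N => exists_unitary_exp (hsa N)
  choose V hVexp hVadd hVderiv using hex
  have hV : ∀ N, GeneratesOn b (fun n => oN N (b n)) (V N) := fun N =>
    generatesOn_exp (hVadd N) (hVderiv N) b
  obtain ⟨U, hU⟩ := hf.exists_unitaryGroup
  refine bogoliubovConvergence_of_strong ρ V U hVexp (hU.isUnitaryGroupOf ho hof) ?_ ?_
  · intro U' hU'
    have hU'' := hU'.generatesOn (e := b) (fun n => by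
      rw [ho]; exact Submodule.subset_span ⟨n, rfl⟩) hof
    funext t
    ext ξ
    rw [← sub_eq_zero, ← norm_le_zero_iff]
    refine le_of_forall_pos_le_add fun ε hε => ?_
    -- Uniqueness is the case of constant families, both with columns exactly `f`.
    have := hf.eventually_close (p := (atTop : Filter ℕ)) (g := fun _ => f) (V := fun _ => U')
      (fun _ => hU'') (fun n => tendsto_const_nhds) (g' := fun _ => f) (V' := fun _ => U)
      (fun _ => hU) (fun n => tendsto_const_nhds) ξ |t| ε hε
    obtain ⟨_, h⟩ := this.exists
    linarith [h t ⟨neg_abs_le t, le_abs_self t⟩]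
  · intro ξ t₀ t₁
    rw [Metric.tendstoUniformlyOn_iff]
    intro ε hε
    have := hf.eventually_close (p := (atTop : Filter ℕ)) (g := fun N n => oN N (b n)) (V := V) hV
      hlim (g' := fun _ => f) (V' := fun _ => U) (fun _ => hU) (fun n => tendsto_const_nhds) ξ
      (max |t₀| |t₁|) ε hε
    filter_upwards [this] with N hN t ht
    rw [dist_comm, dist_eq_norm]
    refine hN t ⟨?_, ?_⟩
    · linarith [ht.1, neg_abs_le t₀, le_max_left |t₀| |t₁|]
    · linarith [ht.2, le_abs_self t₁, le_max_right |t₀| |t₁|]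

end StrongConvergence

/-! ### Plane waves and a decay criterion for first-order operators. -/

section OneParticleBasis

theorem hasSum_stdVec {ι : Type} (ξ : EllTwo ι) : HasSum (fun i => ξ i • stdVec i) ξ := by
  let := Classical.decEq ι
  have h := lp.hasSum_single (p := 2) (E := fun _ : ι => ℂ) (by norm_num) ξ
  convert h using 2 with i
  ext j
  simp only [lp.coeFn_smul, Pi.smul_apply, stdVec_apply, lp.single_apply, Pi.single_apply]
  by_cases hj : j = i <;> simp [hj]

/-- The normalised plane waves as a Hilbert basis. -/
noncomputable def planeWaves : HilbertBasis ℤ ℂ OneParticle :=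
  HilbertBasis.mk orthonormal_stdVec (by
    rw [top_le_iff, ← Submodule.dense_iff_topologicalClosure_eq_top]
    intro ξ
    refine mem_closure_of_tendsto (hasSum_stdVec ξ) (Eventually.of_forall fun s => ?_)
    exact Submodule.sum_mem _ fun i _ => Submodule.smul_mem _ _ (Submodule.subset_span ⟨i, rfl⟩))

theorem coe_planeWaves : ⇑planeWaves = stdVec := HilbertBasis.coe_mk _ _

theorem inner_planeWaves (n : ℤ) (ξ : OneParticle) : ⟪planeWaves n, ξ⟫_ℂ = ξ n := by
  rw [coe_planeWaves, inner_stdVec]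

theorem norm_stdVec {ι : Type} (i : ι) : ‖(stdVec i : EllTwo ι)‖ = 1 := orthonormal_stdVec.1 i

/-- With `x = 1 + a²` and `y = 1 + n²`, the difference factors as `x⁴ - y⁴ = (x - y)(x + y)(x² +
y²)`. The factor `x - y = (a - n)(a + n)` is one order lower than `x`, which compensates the linear
growth on the left. The remaining factors are balanced between `a` and `n` by Peetre's inequality,
at the price of powers of `1 + (a - n)²`. -/
theorem abs_weight_sub_mul_le (a n : ℝ) :
    |((1 + a ^ 2) ^ 2) ^ 2 - ((1 + n ^ 2) ^ 2) ^ 2| * (1 + |a| + |n|) ≤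
      96 * (1 + (a - n) ^ 2) ^ 3 * ((1 + a ^ 2) ^ 2 * (1 + n ^ 2) ^ 2) := by
  set x := 1 + a ^ 2 with hx
  set y := 1 + n ^ 2 with hy
  set D := 1 + (a - n) ^ 2 with hD
  have hx0 : 0 < x := by positivity
  have hy0 : 0 < y := by positivity
  have hD1 : 1 ≤ D := by rw [hD]; nlinarith [sq_nonneg (a - n)]
  -- Peetre's inequality, in both directions.
  have hxy : x ≤ 2 * D * y := by
    rw [hx, hy, hD]; nlinarith [sq_nonneg (a - 2 * n), sq_nonneg ((a - n) * n), sq_nonneg n, sq_nonneg (a-n)]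
  have hyx : y ≤ 2 * D * x := by
    rw [hx, hy, hD]; nlinarith [sq_nonneg (n - 2 * a), sq_nonneg ((a - n) * a), sq_nonneg a, sq_nonneg (a-n)]
  have hd : |a - n| ≤ D := by
    rw [hD, ← sq_abs (a - n)]; nlinarith [sq_nonneg (|a - n| - 1)]
  have h1 : |x - y| ≤ D * (|a| + |n|) := by
    have : x - y = (a - n) * (a + n) := by rw [hx, hy]; ring
    rw [this, abs_mul]
    exact mul_le_mul hd (abs_add_le _ _) (abs_nonneg _) (by linarith)
  have h2 : (|a| + |n|) * (1 + |a| + |n|) ≤ 3 * (x + y) := by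
    rw [hx, hy, ← sq_abs a, ← sq_abs n]
    nlinarith [sq_nonneg (|a| - |n|), sq_nonneg (|a| - 1), sq_nonneg (|n| - 1), abs_nonneg a, abs_nonneg n]
  have hq : x ^ 2 + y ^ 2 ≤ 4 * D * (x * y) := by nlinarith
  have hq2 : (x + y) ^ 2 ≤ 8 * D * (x * y) := by nlinarith [sq_nonneg (x - y)]
  have e : (x ^ 2) ^ 2 - (y ^ 2) ^ 2 = (x - y) * ((x + y) * (x ^ 2 + y ^ 2)) := by ring
  rw [e, abs_mul, abs_of_nonneg (by positivity : 0 ≤ (x + y) * (x ^ 2 + y ^ 2))]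
  calc |x - y| * ((x + y) * (x ^ 2 + y ^ 2)) * (1 + |a| + |n|)
      ≤ D * (|a| + |n|) * ((x + y) * (x ^ 2 + y ^ 2)) * (1 + |a| + |n|) := by gcongr
    _ = D * ((x + y) * (x ^ 2 + y ^ 2)) * ((|a| + |n|) * (1 + |a| + |n|)) := by ring
    _ ≤ D * ((x + y) * (x ^ 2 + y ^ 2)) * (3 * (x + y)) := by gcongr
    _ = 3 * D * ((x + y) ^ 2 * (x ^ 2 + y ^ 2)) := by ring
    _ ≤ 3 * D * ((8 * D * (x * y)) * (4 * D * (x * y))) := by gcongr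
    _ = _ := by ring

/-- The three powers of `1 + d²` demanded of `γ` are those lost in `abs_weight_sub_mul_le`. The
column norm is estimated by the `ℓ¹` norm of its entries, for which the same summability is ample.
-/
theorem isFirstOrder_of_decay {f : ℤ → OneParticle} (hsymm : ∀ a n, f n a = starRingEnd ℂ (f a n))
    {γ : ℤ → ℝ} (hγ0 : ∀ d, 0 ≤ γ d) (hγ : Summable fun d : ℤ => γ d * (1 + (d : ℝ) ^ 2) ^ 3)
    (h : ∀ a n, ‖f n a‖ ≤ γ (a - n) * (1 + |(a : ℝ)| + |(n : ℝ)|)) :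
    IsFirstOrder planeWaves f := by
  refine ⟨fun a n => ?_, ⟨fun d => 96 * (γ d * (1 + (d : ℝ) ^ 2) ^ 3), hγ.mul_left 96,
    fun a n => ?_⟩, ⟨4 * ∑' d : ℤ, γ d * (1 + (d : ℝ) ^ 2) ^ 3, fun n => ?_⟩⟩
  · rw [inner_planeWaves, inner_planeWaves, hsymm]
  · rw [inner_planeWaves]
    have h1 := abs_weight_sub_mul_le a n
    have h2 := hγ0 (a - n)
    unfold momentumWeight
    push_cast
    calc _ ≤ |((1 + (a : ℝ) ^ 2) ^ 2) ^ 2 - ((1 + (n : ℝ) ^ 2) ^ 2) ^ 2| *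
          (γ (a - n) * (1 + |(a : ℝ)| + |(n : ℝ)|)) := by gcongr; exact h a n
      _ = γ (a - n) * (|((1 + (a : ℝ) ^ 2) ^ 2) ^ 2 - ((1 + (n : ℝ) ^ 2) ^ 2) ^ 2| *
          (1 + |(a : ℝ)| + |(n : ℝ)|)) := by ring
      _ ≤ γ (a - n) * (96 * (1 + ((a : ℝ) - n) ^ 2) ^ 3 *
          ((1 + (a : ℝ) ^ 2) ^ 2 * (1 + (n : ℝ) ^ 2) ^ 2)) := by gcongr
      _ = _ := by ring
  · have hb : ∀ a : ℤ, ‖f n a • (stdVec a : OneParticle)‖ ≤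
        4 * (1 + (n : ℝ) ^ 2) * (γ (a - n) * (1 + ((a - n : ℤ) : ℝ) ^ 2) ^ 3) := by
      intro a
      rw [norm_smul, norm_stdVec, mul_one]
      refine (h a n).trans ?_
      have h2 := hγ0 (a - n)
      push_cast
      set D := 1 + ((a : ℝ) - n) ^ 2 with hD
      have hD1 : 1 ≤ D := by rw [hD]; nlinarith [sq_nonneg ((a : ℝ) - n)]
      have h3 : |(a : ℝ)| ≤ |(a : ℝ) - n| + |(n : ℝ)| := by
        simpa using abs_add_le ((a : ℝ) - n) n
      -- The left side is at most `(1 + |a - n|)(1 + 2|n|)`, and each factor is then bounded by a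
      -- quadratic.
      have h4 : 1 + |(a : ℝ)| + |(n : ℝ)| ≤ 4 * (1 + (n : ℝ) ^ 2) * D := by
        have h5 : 1 + |(a : ℝ) - n| ≤ 2 * D := by
          rw [hD, ← sq_abs ((a : ℝ) - n)]; nlinarith [sq_nonneg (|(a : ℝ) - n| - 1)]
        have h6 : 1 + 2 * |(n : ℝ)| ≤ 2 * (1 + (n : ℝ) ^ 2) := by
          rw [← sq_abs (n : ℝ)]; nlinarith [sq_nonneg (|(n : ℝ)| - 1)]
        have h7 := mul_le_mul h5 h6 (by positivity) (by positivity)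
        nlinarith [abs_nonneg ((a : ℝ) - n), abs_nonneg (n : ℝ)]
      have h8 : D ≤ D ^ 3 := by
        calc D = D ^ 1 := (pow_one D).symm
          _ ≤ D ^ 3 := pow_le_pow_right₀ hD1 (by norm_num)
      calc γ (a - n) * (1 + |(a : ℝ)| + |(n : ℝ)|) ≤ γ (a - n) * (4 * (1 + (n : ℝ) ^ 2) * D ^ 3) := by
            refine mul_le_mul_of_nonneg_left (h4.trans ?_) h2
            gcongr
        _ = _ := by ring
    have hs : Summable fun a : ℤ => 4 * (1 + (n : ℝ) ^ 2) *
        (γ (a - n) * (1 + ((a - n : ℤ) : ℝ) ^ 2) ^ 3) :=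
      ((Equiv.subRight n).summable_iff.mpr hγ).mul_left _
    rw [← (hasSum_stdVec (f n)).tsum_eq]
    refine (tsum_of_norm_bounded hs.hasSum hb).trans (le_of_eq ?_)
    have e := (Equiv.subRight n).tsum_eq (fun d : ℤ => γ d * (1 + (d : ℝ) ^ 2) ^ 3)
    simp only [Equiv.subRight_apply] at e
    rw [tsum_mul_left, e]
    ring

end OneParticleBasis

/-! ### Matrix elements of smeared Virasoro generators. -/

section Virasoro

theorem units_mul_self (χ : ℤˣ) : (χ : ℤ) * χ = 1 := by
  rcases Int.units_eq_one_or χ with h | h <;> simp [h]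

/-- The normalisation `‖e_l‖² = 2L` cancels `π` and `L`, and `χ² = 1` removes the chirality from the
`κ` term; all later estimates involve only integers and the shift. -/
theorem virasoroVec_eq {L : ℝ} (hL : L ≠ 0) (b : Sector) (χ : ℤˣ) (κ n : ℤ) :
    virasoroVec L b χ κ n =
      ((((χ : ℤ) : ℝ) * (n + b.shift) - κ / 2 : ℝ) : ℂ) • stdVec (n - (χ : ℤ) * κ) := by
  unfold virasoroVec mom
  congr 2
  have h1 : ((χ : ℤ) : ℝ) * ((χ : ℤ) : ℝ) = 1 := by exact_mod_cast units_mul_self χ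
  field_simp
  linear_combination (-(κ : ℝ)) * h1

theorem shift_nonneg (b : Sector) : 0 ≤ b.shift := by
  cases b <;> simp [Sector.shift]

theorem shift_le (b : Sector) : b.shift ≤ 1 / 2 := by
  cases b <;> simp [Sector.shift]

theorem abs_units_cast (χ : ℤˣ) : |((χ : ℤ) : ℝ)| = 1 := by
  rcases units_int_cast_cases χ with h | h <;> simp [h]

theorem abs_virasoro_coeff_le (b : Sector) (χ : ℤˣ) (κ n : ℤ) :
    |((χ : ℤ) : ℝ) * (n + b.shift) - κ / 2| ≤ 1 + |(n : ℝ)| + |(κ : ℝ)| := by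
  refine (abs_sub _ _).trans ?_
  rw [abs_mul, abs_units_cast, one_mul, abs_div, abs_of_pos (by norm_num : (0 : ℝ) < 2)]
  have h1 := abs_add_le (n : ℝ) b.shift
  rw [abs_of_nonneg (shift_nonneg b)] at h1
  linarith [shift_le b, abs_nonneg (κ : ℝ)]

theorem norm_virasoroVec_le {L : ℝ} (hL : L ≠ 0) (b : Sector) (χ : ℤˣ) (κ n : ℤ) :
    ‖virasoroVec L b χ κ n‖ ≤ 1 + |(n : ℝ)| + |(κ : ℝ)| := by
  rw [virasoroVec_eq hL, norm_smul, norm_stdVec, mul_one, Complex.norm_real]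
  exact abs_virasoro_coeff_le b χ κ n

theorem summable_of_summable_mul_weight {s : ℤ → ℂ}
    (hs : Summable fun κ : ℤ => ‖s κ‖ * (1 + (κ : ℝ) ^ 2) ^ 3) (c : ℝ) :
    Summable fun κ : ℤ => ‖s κ‖ * (c + |(κ : ℝ)|) := by
  refine Summable.of_norm_bounded (hs.mul_left (|c| + 1)) fun κ => ?_
  rw [norm_mul, norm_norm, Real.norm_eq_abs, mul_left_comm]
  refine mul_le_mul_of_nonneg_left ?_ (norm_nonneg _)
  have h1 := abs_add_le c |(κ : ℝ)|
  rw [abs_abs] at h1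
  have h2 : |(κ : ℝ)| ≤ 1 + (κ : ℝ) ^ 2 := by
    rw [← sq_abs (κ : ℝ)]; nlinarith [sq_nonneg (|(κ : ℝ)| - 1)]
  have h3 : (1 : ℝ) ≤ 1 + (κ : ℝ) ^ 2 := by nlinarith [sq_nonneg (κ : ℝ)]
  have h4 : 1 + (κ : ℝ) ^ 2 ≤ (1 + (κ : ℝ) ^ 2) ^ 3 := by
    calc 1 + (κ : ℝ) ^ 2 = (1 + (κ : ℝ) ^ 2) ^ 1 := (pow_one _).symm
      _ ≤ _ := pow_le_pow_right₀ h3 (by norm_num)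
  nlinarith [abs_nonneg c]

theorem summable_smul_virasoroVec {L : ℝ} (hL : L ≠ 0) (b : Sector) (χ : ℤˣ) {s : ℤ → ℂ}
    (hs : Summable fun κ : ℤ => ‖s κ‖ * (1 + (κ : ℝ) ^ 2) ^ 3) (n : ℤ) :
    Summable fun κ => s κ • virasoroVec L b χ κ n := by
  refine Summable.of_norm_bounded (summable_of_summable_mul_weight hs (1 + |(n : ℝ)|)) fun κ => ?_
  rw [norm_smul]
  exact mul_le_mul_of_nonneg_left (norm_virasoroVec_le hL b χ κ n) (norm_nonneg _)

/-- Only the mode `κ = χ(n - a)` connects `n` to `a`. At that mode the coefficient depends on the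
midpoint of `n` and `a`, hence is symmetric in them; this is what makes the generator symmetric. -/
theorem tsum_smul_virasoroVec_apply {L : ℝ} (hL : L ≠ 0) (b : Sector) (χ : ℤˣ) {s : ℤ → ℂ}
    (hs : Summable fun κ : ℤ => ‖s κ‖ * (1 + (κ : ℝ) ^ 2) ^ 3) (n a : ℤ) :
    (∑' κ, s κ • virasoroVec L b χ κ n) a =
      s ((χ : ℤ) * (n - a)) * ((((χ : ℤ) : ℝ) * ((n + a) / 2 + b.shift) : ℝ) : ℂ) := by
  have h1 : HasSum (fun κ => ⟪stdVec a, s κ • virasoroVec L b χ κ n⟫_ℂ)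
      ⟪stdVec a, ∑' κ, s κ • virasoroVec L b χ κ n⟫_ℂ :=
    (innerSL ℂ (stdVec a : OneParticle)).hasSum (summable_smul_virasoroVec hL b χ hs n).hasSum
  rw [inner_stdVec] at h1
  refine h1.unique ?_
  have hχ := units_mul_self χ
  have e : (fun κ => ⟪stdVec a, s κ • virasoroVec L b χ κ n⟫_ℂ) = fun κ =>
      if κ = (χ : ℤ) * (n - a) then
        s ((χ : ℤ) * (n - a)) * ((((χ : ℤ) : ℝ) * ((n + a) / 2 + b.shift) : ℝ) : ℂ) else 0 := by
    funext κ
    rw [inner_smul_right, virasoroVec_eq hL, inner_smul_right, inner_stdVec, stdVec_apply]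
    by_cases h : κ = (χ : ℤ) * (n - a)
    · have h2 : a = n - (χ : ℤ) * κ := by
        rw [h]; linear_combination (n - a) * hχ
      rw [if_pos h, if_pos h2, mul_one, ← h]
      congr 2
      have h3 : (κ : ℝ) = ((χ : ℤ) : ℝ) * (n - a) := by rw [h]; push_cast; ring
      rw [h3]; ring
    · have h2 : a ≠ n - (χ : ℤ) * κ := fun h2 => h (by
        rw [h2]; linear_combination (-κ) * hχ)
      rw [if_neg h, if_neg h2, mul_zero, mul_zero]
  rw [e]
  exact hasSum_ite_eq _ _

/-- A smeared Virasoro generator with rapidly decreasing, conjugation-symmetric coefficients is a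
first-order operator. -/
theorem isFirstOrder_virasoro {L : ℝ} (hL : L ≠ 0) (b : Sector) (χ : ℤˣ) {s : ℤ → ℂ}
    (hconj : ∀ κ, starRingEnd ℂ (s κ) = s (-κ))
    (hs : Summable fun κ : ℤ => ‖s κ‖ * (1 + (κ : ℝ) ^ 2) ^ 3) :
    IsFirstOrder planeWaves fun n => ∑' κ, s κ • virasoroVec L b χ κ n := by
  have hχ := units_mul_self χ
  -- The decay kernel is a function of `a - n`, whereas the coefficient sits at `χ(n - a)`; this
  -- involution reindexes one into the other.
  let e : ℤ ≃ ℤ := ⟨fun d => -((χ : ℤ) * d), fun d => -((χ : ℤ) * d),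
    fun d => by linear_combination d * hχ, fun d => by linear_combination d * hχ⟩
  refine isFirstOrder_of_decay (γ := fun d => ‖s (-((χ : ℤ) * d))‖) (fun a n => ?_)
    (fun _ => norm_nonneg _) ?_ fun a n => ?_
  · rw [tsum_smul_virasoroVec_apply hL b χ hs, tsum_smul_virasoroVec_apply hL b χ hs, map_mul,
      hconj, Complex.conj_ofReal]
    congr 2
    · ring_nf
    · ring_nf
  · refine (e.summable_iff.mpr hs).congr fun d => ?_
    have : ((e d : ℤ) : ℝ) ^ 2 = (d : ℝ) ^ 2 := by
      have h1 : ((χ : ℤ) : ℝ) * ((χ : ℤ) : ℝ) = 1 := by exact_mod_cast hχ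
      change ((-((χ : ℤ) * d) : ℤ) : ℝ) ^ 2 = _
      push_cast
      linear_combination (d : ℝ) ^ 2 * h1
    simp only [Function.comp_apply, this]
    rfl
  · rw [tsum_smul_virasoroVec_apply hL b χ hs, norm_mul, Complex.norm_real, Real.norm_eq_abs,
      abs_mul, abs_units_cast, one_mul]
    have e1 : (χ : ℤ) * (n - a) = -((χ : ℤ) * (a - n)) := by ring
    rw [e1]
    refine mul_le_mul_of_nonneg_left ?_ (norm_nonneg _)
    have h1 := abs_add_le (((n : ℝ) + a) / 2) b.shift
    rw [abs_of_nonneg (shift_nonneg b), abs_div, abs_of_pos (by norm_num : (0 : ℝ) < 2)] at h1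
    have h2 := abs_add_le (n : ℝ) a
    linarith [shift_le b, abs_nonneg (n : ℝ), abs_nonneg (a : ℝ)]

/-- The coefficients of a combination of the modes `κ` and `-κ`. -/
noncomputable def pairCoeff (c c' : ℂ) (κ : ℤ) (j : ℤ) : ℂ := (if j = κ then c else 0) + if j = -κ then c' else 0

theorem summable_pairCoeff (c c' : ℂ) (κ : ℤ) :
    Summable fun j : ℤ => ‖pairCoeff c c' κ j‖ * (1 + (j : ℝ) ^ 2) ^ 3 := by
  refine summable_of_ne_finset_zero (s := {κ, -κ}) fun j hj => ?_
  simp only [Finset.mem_insert, Finset.mem_singleton, not_or] at hj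
  simp [pairCoeff, hj.1, hj.2]

theorem conj_pairCoeff {c c' : ℂ} (h : starRingEnd ℂ c = c') (κ j : ℤ) :
    starRingEnd ℂ (pairCoeff c c' κ j) = pairCoeff c c' κ (-j) := by
  subst h
  have e1 : (-j = κ) ↔ (j = -κ) := by constructor <;> intro h <;> omega
  simp only [pairCoeff, map_add, e1, neg_inj]
  rw [add_comm]
  congr 1
  · by_cases h : j = -κ <;> simp only [h, if_true, if_false, Complex.conj_conj, map_zero]
  · by_cases h : j = κ <;> simp only [h, if_true, if_false, map_zero]

/-- The two indicators are added rather than chosen between, so the identity survives for `κ = 0`,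
where the two modes coincide. -/
theorem tsum_pairCoeff (c c' : ℂ) (κ : ℤ) (v : ℤ → OneParticle) :
    ∑' j, pairCoeff c c' κ j • v j = c • v κ + c' • v (-κ) := by
  have h1 := (hasSum_ite_eq κ (c • v κ)).add (hasSum_ite_eq (-κ) (c' • v (-κ)))
  rw [← h1.tsum_eq]
  refine tsum_congr fun j => ?_
  rw [pairCoeff, add_smul]
  congr 1
  · by_cases h : j = κ <;> simp [h]
  · by_cases h : j = -κ <;> simp [h]

end Virasoro

/-! ### Koo–Saleur approximants on the lattice. -/

section Lattice

theorem latSize_pos {L₀ : ℕ} (h : 0 < L₀) (N : ℕ) : 0 < latSize L₀ N := by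
  unfold latSize; positivity

theorem tendsto_latSize {L₀ : ℕ} (h : 0 < L₀) : Tendsto (fun N => latSize L₀ N) atTop atTop := by
  refine tendsto_atTop_mono (fun N => ?_) tendsto_id
  calc N ≤ 2 ^ N := Nat.lt_two_pow_self.le
    _ ≤ 2 ^ N * L₀ := Nat.le_mul_of_pos_right _ h

theorem eventually_mem_lattice {L₀ : ℕ} (h : 0 < L₀) (n : ℤ) :
    ∀ᶠ N in atTop, n ∈ Finset.Ico (-(latSize L₀ N : ℤ)) (latSize L₀ N) := by
  filter_upwards [(tendsto_latSize h).eventually_gt_atTop n.natAbs] with N hN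
  rw [Finset.mem_Ico]; omega

theorem latSpacing_pos {L : ℝ} (hL : 0 < L) {L₀ : ℕ} (h : 0 < L₀) (N : ℕ) :
    0 < latSpacing L L₀ N := by
  have := latSize_pos h N
  unfold latSpacing; positivity

theorem tendsto_latSpacing (L : ℝ) {L₀ : ℕ} (h : 0 < L₀) :
    Tendsto (fun N => latSpacing L L₀ N) atTop (𝓝 0) :=
  tendsto_const_nhds.div_atTop (tendsto_natCast_atTop_atTop.comp (tendsto_latSize h))

theorem latSpacing_mul {L : ℝ} (hL : 0 < L) {L₀ : ℕ} (h : 0 < L₀) (N : ℕ) (x : ℝ) :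
    latSpacing L L₀ N * (Real.pi / L * x) = Real.pi / latSize L₀ N * x := by
  have := latSize_pos h N
  unfold latSpacing
  field_simp

theorem eq_of_modEq_of_mem {A m l : ℤ} (hm : m ∈ Finset.Ico (-A) A) (hl : l ∈ Finset.Ico (-A) A)
    (h : m ≡ l [ZMOD 2 * A]) : m = l := by
  obtain ⟨q, hq⟩ := h.dvd
  rw [Finset.mem_Ico] at hm hl
  have h1 : -1 < q := by by_contra h; nlinarith
  have h2 : q < 1 := by by_contra h; nlinarith
  have : q = 0 := by omega
  rw [this] at hq; omega

/-- The normalised lattice plane wave of index `m`, extended periodically in `m`. -/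
noncomputable def latVec (L₀ N : ℕ) (m : ℤ) : LatOneParticle L₀ N :=
  WithLp.toLp 2 fun l => if m ≡ l [ZMOD 2 * latSize L₀ N] then 1 else 0

theorem latVec_apply (L₀ N : ℕ) (m : ℤ) (l : LatIndex L₀ N) :
    latVec L₀ N m l = if m ≡ l [ZMOD 2 * latSize L₀ N] then 1 else 0 := rfl

theorem latVec_eq_single {L₀ N : ℕ} {m : ℤ}
    (hm : m ∈ Finset.Ico (-(latSize L₀ N : ℤ)) (latSize L₀ N)) :
    latVec L₀ N m = EuclideanSpace.single (⟨m, hm⟩ : LatIndex L₀ N) 1 := by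
  ext l
  rw [latVec_apply, PiLp.single_apply]
  by_cases h : l = ⟨m, hm⟩
  · subst h; simp
  · rw [if_neg h, if_neg]
    exact fun h' => h (Subtype.ext (eq_of_modEq_of_mem hm l.2 h').symm)

theorem latVec_congr {L₀ N : ℕ} {m m' : ℤ} (h : m ≡ m' [ZMOD 2 * latSize L₀ N]) :
    latVec L₀ N m = latVec L₀ N m' := by
  ext l
  rw [latVec_apply, latVec_apply]
  have : m ≡ l [ZMOD 2 * latSize L₀ N] ↔ m' ≡ l [ZMOD 2 * latSize L₀ N] :=
    ⟨fun h' => h.symm.trans h', fun h' => h.trans h'⟩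
  simp only [this]

theorem exists_mem_modEq {L₀ : ℕ} (h : 0 < L₀) (N : ℕ) (m : ℤ) :
    ∃ l ∈ Finset.Ico (-(latSize L₀ N : ℤ)) (latSize L₀ N), m ≡ l [ZMOD 2 * latSize L₀ N] := by
  have hA : (0 : ℤ) < latSize L₀ N := by exact_mod_cast latSize_pos h N
  have h0 := Int.emod_nonneg (m + latSize L₀ N) (by omega : (2 * latSize L₀ N : ℤ) ≠ 0)
  have h1 := Int.emod_lt_of_pos (m + latSize L₀ N) (by omega : 0 < (2 * latSize L₀ N : ℤ))
  refine ⟨(m + latSize L₀ N) % (2 * latSize L₀ N) - latSize L₀ N, ?_, ?_⟩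
  · rw [Finset.mem_Ico]; omega
  · have h2 : (m + latSize L₀ N) % (2 * latSize L₀ N) ≡ m + latSize L₀ N [ZMOD 2 * latSize L₀ N] :=
      Int.mod_modEq _ _
    have h3 := h2.symm.sub_right (latSize L₀ N : ℤ)
    simpa using h3

/-- The nonzero matrix elements of the Koo–Saleur approximants. -/
noncomputable def ksCoeff (L : ℝ) (L₀ : ℕ) (b : Sector) (χ : ℤˣ) (N : ℕ) (κ n : ℤ) : ℝ :=
  ((χ : ℤ) : ℝ) / (2 * Real.pi) * Real.cos (latSpacing L L₀ N * (Real.pi / L * κ) / 4) ^ 2 *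
    Real.sin (latSpacing L L₀ N * (mom L b n - ((χ : ℤ) : ℝ) * (Real.pi / L * κ) / 2)) *
    (2 * latSize L₀ N)

theorem ksOperator_latVec {L : ℝ} {L₀ : ℕ} (b : Sector) (χ : ℤˣ) {N : ℕ} (κ : ℤ) {n : ℤ}
    (hn : n ∈ Finset.Ico (-(latSize L₀ N : ℤ)) (latSize L₀ N)) :
    ksOperator L L₀ b χ N κ (latVec L₀ N n) =
      (ksCoeff L L₀ b χ N κ n : ℂ) • latVec L₀ N (n - (χ : ℤ) * κ) := by
  ext m
  rw [latVec_eq_single hn, ksOperator, Matrix.ofLp_toEuclideanCLM]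
  simp only [PiLp.ofLp_single, Matrix.mulVec_single_one, PiLp.smul_apply, latVec_apply, smul_eq_mul]
  change ksMatrix L L₀ b χ N κ m ⟨n, hn⟩ = _
  simp only [ksMatrix, Matrix.of_apply]
  have e : ((m : ℤ) ≡ n - (χ : ℤ) * κ [ZMOD 2 * latSize L₀ N]) ↔
      (n - (χ : ℤ) * κ ≡ m [ZMOD 2 * latSize L₀ N]) := Int.modEq_comm
  by_cases h : n - (χ : ℤ) * κ ≡ m [ZMOD 2 * latSize L₀ N]
  · rw [if_pos h, if_pos (e.mpr h), mul_one]; rfl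
  · rw [if_neg h, if_neg (fun h' => h (e.mp h')), mul_zero]

theorem latSpacing_mul_mom {L : ℝ} (hL : 0 < L) {L₀ : ℕ} (h : 0 < L₀) (b : Sector) (χ : ℤˣ) (N : ℕ)
    (κ n : ℤ) : latSpacing L L₀ N * (mom L b n - ((χ : ℤ) : ℝ) * (Real.pi / L * κ) / 2) =
      Real.pi / latSize L₀ N * (n + b.shift - ((χ : ℤ) : ℝ) * κ / 2) := by
  rw [← latSpacing_mul hL h]
  unfold mom
  ring

/-- For a nonzero entry `m = l + χκ + 2 L_N q`, so the sine arguments of the two transposed entries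
differ by `2πq`. The boundary shift drops out of this difference, hence both sectors behave alike;
the cosine is even in `κ`. -/
theorem star_ksOperator {L : ℝ} (hL : 0 < L) {L₀ : ℕ} (h : 0 < L₀) (b : Sector) (χ : ℤˣ) (N : ℕ)
    (κ : ℤ) : star (ksOperator L L₀ b χ N κ) = ksOperator L L₀ b χ N (-κ) := by
  rw [ksOperator, ksOperator, ← map_star]
  congr 1
  ext m l
  rw [Matrix.star_apply]
  simp only [ksMatrix, Matrix.of_apply]
  have e : ((l : ℤ) ≡ m - (χ : ℤ) * κ [ZMOD 2 * latSize L₀ N]) ↔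
      ((m : ℤ) ≡ l - (χ : ℤ) * (-κ) [ZMOD 2 * latSize L₀ N]) := by
    rw [Int.modEq_iff_dvd, Int.modEq_iff_dvd]
    have : (m : ℤ) - (χ : ℤ) * κ - l = -((l : ℤ) - (χ : ℤ) * -κ - m) := by ring
    rw [this, dvd_neg]
  by_cases hm : (l : ℤ) ≡ m - (χ : ℤ) * κ [ZMOD 2 * latSize L₀ N]
  · rw [if_pos hm, if_pos (e.mp hm)]
    simp only [RCLike.star_def, Complex.conj_ofReal]
    congr 1
    obtain ⟨q, hq⟩ := hm.dvd
    have hA := latSize_pos h N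
    have hq' : (m : ℝ) - ((χ : ℤ) : ℝ) * κ - ((l : ℤ) : ℝ) = 2 * latSize L₀ N * q := by
      exact_mod_cast hq
    rw [latSpacing_mul_mom hL h, latSpacing_mul_mom hL h]
    have e1 : Real.pi / latSize L₀ N * (((m : ℤ) : ℝ) + b.shift - ((χ : ℤ) : ℝ) * κ / 2) =
        Real.pi / latSize L₀ N * (((l : ℤ) : ℝ) + b.shift - ((χ : ℤ) : ℝ) * ((-κ : ℤ) : ℝ) / 2) +
          q * (2 * Real.pi) := by
      have : (m : ℝ) = ((l : ℤ) : ℝ) + ((χ : ℤ) : ℝ) * κ + 2 * latSize L₀ N * q := by linarith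
      rw [this]
      push_cast
      field_simp
      ring
    have e2 : latSpacing L L₀ N * (Real.pi / L * ((-κ : ℤ) : ℝ)) / 4 =
        -(latSpacing L L₀ N * (Real.pi / L * κ) / 4) := by push_cast; ring
    rw [e1, Real.sin_add_int_mul_two_pi, e2, Real.cos_neg]
  · rw [if_neg hm, if_neg (fun h' => hm (e.mpr h')), star_zero]

theorem conj_half : starRingEnd ℂ (1 / 2) = 1 / 2 := by
  norm_num [Complex.ext_iff]

theorem conj_inv_two_I : starRingEnd ℂ (1 / (2 * I)) = -(1 / (2 * I)) := by
  have : starRingEnd ℂ 2 = 2 := by norm_num [Complex.ext_iff]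
  rw [map_div₀, map_mul, map_one, Complex.conj_I, this]
  ring

theorem isSelfAdjoint_half_add {H : Type*} [NormedAddCommGroup H] [InnerProductSpace ℂ H]
    [CompleteSpace H] {x y : H →L[ℂ] H} (h : star x = y) : IsSelfAdjoint ((1 / 2 : ℂ) • (x + y)) := by
  have h' : star y = x := by rw [← h, star_star]
  rw [IsSelfAdjoint, star_smul, star_add, h, h', add_comm, RCLike.star_def, conj_half]

theorem isSelfAdjoint_half_sub {H : Type*} [NormedAddCommGroup H] [InnerProductSpace ℂ H]
    [CompleteSpace H] {x y : H →L[ℂ] H} (h : star x = y) :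
    IsSelfAdjoint ((1 / (2 * I) : ℂ) • (x - y)) := by
  have h' : star y = x := by rw [← h, star_star]
  rw [IsSelfAdjoint, star_smul, star_sub, h, h', ← neg_sub, smul_neg, ← neg_smul, RCLike.star_def,
    conj_inv_two_I, neg_neg]

theorem isSelfAdjoint_ksRe {L : ℝ} (hL : 0 < L) {L₀ : ℕ} (h : 0 < L₀) (b : Sector) (χ : ℤˣ) (N : ℕ)
    (κ : ℤ) : IsSelfAdjoint (ksRe L L₀ b χ N κ) :=
  isSelfAdjoint_half_add (star_ksOperator hL h b χ N κ)

theorem isSelfAdjoint_ksIm {L : ℝ} (hL : 0 < L) {L₀ : ℕ} (h : 0 < L₀) (b : Sector) (χ : ℤˣ) (N : ℕ)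
    (κ : ℤ) : IsSelfAdjoint (ksIm L L₀ b χ N κ) :=
  isSelfAdjoint_half_sub (star_ksOperator hL h b χ N κ)

theorem IsSelfAdjoint.transport {L₀ N : ℕ} {o : LatOneParticle L₀ N →L[ℂ] LatOneParticle L₀ N}
    (ho : IsSelfAdjoint o) (R : LatOneParticle L₀ N →L[ℂ] OneParticle) :
    IsSelfAdjoint (transport R o) := ho.conj_adjoint R

/-- Writing `sin x = x sinc x` avoids a case distinction at vanishing argument; the factor `ε_N` so
produced cancels the growth of `2 L_N` because `ε_N L_N = L`. -/
theorem tendsto_ksCoeff {L : ℝ} (hL : 0 < L) {L₀ : ℕ} (h : 0 < L₀) (b : Sector) (χ : ℤˣ) (κ n : ℤ) :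
    Tendsto (fun N => ksCoeff L L₀ b χ N κ n) atTop
      (𝓝 (((χ : ℤ) : ℝ) * (n + b.shift) - κ / 2)) := by
  have hε := tendsto_latSpacing L h
  set y : ℝ := mom L b n - ((χ : ℤ) : ℝ) * (Real.pi / L * κ) / 2 with hy
  have h1 : Tendsto (fun N => Real.cos (latSpacing L L₀ N * (Real.pi / L * κ) / 4) ^ 2) atTop
      (𝓝 1) := by
    have : Tendsto (fun N => latSpacing L L₀ N * (Real.pi / L * κ) / 4) atTop (𝓝 0) := by
      simpa using (hε.mul_const (Real.pi / L * κ)).div_const 4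
    simpa using ((Real.continuous_cos.tendsto 0).comp this).pow 2
  have h2 : Tendsto (fun N => Real.sinc (latSpacing L L₀ N * y)) atTop (𝓝 1) := by
    have : Tendsto (fun N => latSpacing L L₀ N * y) atTop (𝓝 0) := by
      simpa using hε.mul_const y
    simpa [Function.comp_def] using (Real.continuous_sinc.tendsto 0).comp this
  have h3 := ((h1.mul h2).mul_const (((χ : ℤ) : ℝ) / (2 * Real.pi) * y * (2 * L)))
  have e : ∀ N, Real.cos (latSpacing L L₀ N * (Real.pi / L * κ) / 4) ^ 2 *
      Real.sinc (latSpacing L L₀ N * y) * (((χ : ℤ) : ℝ) / (2 * Real.pi) * y * (2 * L)) =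
      ksCoeff L L₀ b χ N κ n := by
    intro N
    have hε0 := latSpacing_pos hL h N
    have hA : (latSize L₀ N : ℝ) ≠ 0 := by exact_mod_cast (latSize_pos h N).ne'
    have hs : Real.sin (latSpacing L L₀ N * y) =
        latSpacing L L₀ N * y * Real.sinc (latSpacing L L₀ N * y) := by
      by_cases h0 : latSpacing L L₀ N * y = 0
      · simp [h0]
      · rw [Real.sinc_of_ne_zero h0, mul_div_cancel₀ _ h0]
    have hεA : latSpacing L L₀ N * latSize L₀ N = L := by
      unfold latSpacing; field_simp
    rw [ksCoeff, ← hy, hs]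
    linear_combination (-2 * Real.cos (latSpacing L L₀ N * (Real.pi / L * κ) / 4) ^ 2 *
      Real.sinc (latSpacing L L₀ N * y) * (((χ : ℤ) : ℝ) / (2 * Real.pi) * y)) * hεA
  have e' : 1 * 1 * (((χ : ℤ) : ℝ) / (2 * Real.pi) * y * (2 * L)) =
      ((χ : ℤ) : ℝ) * (n + b.shift) - κ / 2 := by
    have h4 : ((χ : ℤ) : ℝ) * ((χ : ℤ) : ℝ) = 1 := by exact_mod_cast units_mul_self χ
    rw [hy]
    unfold mom
    field_simp
    linear_combination (-(κ : ℝ)) * h4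
  rw [← e']
  exact h3.congr e

/-- From `|sin x| ≤ |x|`; the bound is independent of `N` and serves as majorant when the modes are
summed. -/
theorem abs_ksCoeff_le {L : ℝ} (hL : 0 < L) {L₀ : ℕ} (h : 0 < L₀) (b : Sector) (χ : ℤˣ) (N : ℕ)
    (κ n : ℤ) : |ksCoeff L L₀ b χ N κ n| ≤ 1 + |(n : ℝ)| + |(κ : ℝ)| := by
  have hA : (0 : ℝ) < latSize L₀ N := by exact_mod_cast latSize_pos h N
  rw [ksCoeff, latSpacing_mul_mom hL h]
  have h1 : |Real.sin (Real.pi / latSize L₀ N * (n + b.shift - ((χ : ℤ) : ℝ) * κ / 2))| ≤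
      Real.pi / latSize L₀ N * (1 + |(n : ℝ)| + |(κ : ℝ)|) := by
    refine Real.abs_sin_le_abs.trans ?_
    rw [abs_mul, abs_of_pos (by positivity : 0 < Real.pi / latSize L₀ N)]
    refine mul_le_mul_of_nonneg_left ?_ (by positivity)
    have h2 : (n : ℝ) + b.shift - ((χ : ℤ) : ℝ) * κ / 2 =
        ((χ : ℤ) : ℝ) * (((χ : ℤ) : ℝ) * (n + b.shift) - κ / 2) := by
      have h4 : ((χ : ℤ) : ℝ) * ((χ : ℤ) : ℝ) = 1 := by exact_mod_cast units_mul_self χ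
      linear_combination (-((n : ℝ) + b.shift)) * h4
    rw [h2, abs_mul, abs_units_cast, one_mul]
    exact abs_virasoro_coeff_le b χ κ n
  rw [abs_mul, abs_mul, abs_mul, abs_div, abs_units_cast, abs_of_pos (by positivity : 0 < 2 * Real.pi),
    abs_of_nonneg (sq_nonneg _), abs_of_pos (by positivity : (0 : ℝ) < 2 * latSize L₀ N)]
  calc 1 / (2 * Real.pi) * Real.cos (latSpacing L L₀ N * (Real.pi / L * κ) / 4) ^ 2 *
        |Real.sin (Real.pi / latSize L₀ N * (n + b.shift - ((χ : ℤ) : ℝ) * κ / 2))| *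
        (2 * latSize L₀ N)
      ≤ 1 / (2 * Real.pi) * 1 * (Real.pi / latSize L₀ N * (1 + |(n : ℝ)| + |(κ : ℝ)|)) *
        (2 * latSize L₀ N) := by
        gcongr
        exact Real.cos_sq_le_one _
    _ = _ := by field_simp

end Lattice

/-! ### Asymptotic embeddings and convergence of the transported generators. -/

section RenormalizationMaps

/-- The asymptotic properties of the maps `R^N_∞` under which transported Koo–Saleur approximants
converge. -/
structure IsAsymptoticEmbedding {L₀ : ℕ} (R : ∀ N, LatOneParticle L₀ N →L[ℂ] OneParticle) : Prop where
  adjoint_stdVec : ∀ n, ∃ r : ℕ → ℂ, Tendsto r atTop (𝓝 1) ∧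
    ∀ᶠ N in atTop, ContinuousLinearMap.adjoint (R N) (stdVec n) = r N • latVec L₀ N n
  tendsto_latVec : ∀ m, Tendsto (fun N => R N (latVec L₀ N m)) atTop (𝓝 (stdVec m))

/-- The adjoint of `R N` sends the plane wave to `r N` times a lattice wave, the approximant moves
that wave by `χκ` with a convergent coefficient, and `R N` returns it to the continuum; each of the
three steps converges separately. -/
theorem IsAsymptoticEmbedding.tendsto_transport {L : ℝ} (hL : 0 < L) {L₀ : ℕ} (h : 0 < L₀)
    {R : ∀ N, LatOneParticle L₀ N →L[ℂ] OneParticle} (hR : IsAsymptoticEmbedding R) (b : Sector)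
    (χ : ℤˣ) (κ n : ℤ) :
    Tendsto (fun N => transport (R N) (ksOperator L L₀ b χ N κ) (stdVec n)) atTop
      (𝓝 (virasoroVec L b χ κ n)) := by
  obtain ⟨r, hr, hrN⟩ := hR.adjoint_stdVec n
  have hc : Tendsto (fun N => (ksCoeff L L₀ b χ N κ n : ℂ)) atTop
      (𝓝 ((((χ : ℤ) : ℝ) * (n + b.shift) - κ / 2 : ℝ) : ℂ)) :=
    (Complex.continuous_ofReal.tendsto _).comp (tendsto_ksCoeff hL h b χ κ n)
  have h1 := hr.smul (hc.smul (hR.tendsto_latVec (n - (χ : ℤ) * κ)))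
  rw [one_smul, ← virasoroVec_eq hL.ne'] at h1
  refine h1.congr' ?_
  filter_upwards [hrN, eventually_mem_lattice h n] with N h2 h3
  simp only [transport, ContinuousLinearMap.comp_apply]
  rw [h2, map_smul, ksOperator_latVec b χ κ h3, map_smul, map_smul]

theorem latMap_latVec {L₀ N : ℕ} (f : LatIndex L₀ N → OneParticle) {m : ℤ}
    (hm : m ∈ Finset.Ico (-(latSize L₀ N : ℤ)) (latSize L₀ N)) :
    latMap f (latVec L₀ N m) = f ⟨m, hm⟩ := by
  rw [latVec_eq_single hm, latMap]
  simp

theorem adjoint_latMap_apply {L₀ N : ℕ} (f : LatIndex L₀ N → OneParticle) (ξ : OneParticle)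
    (l : LatIndex L₀ N) : ContinuousLinearMap.adjoint (latMap f) ξ l = ⟪f l, ξ⟫_ℂ := by
  have h1 := ContinuousLinearMap.adjoint_inner_right (latMap f) (latVec L₀ N l) ξ
  rw [latMap_latVec f l.2, latVec_eq_single l.2, EuclideanSpace.inner_single_left] at h1
  simpa using h1

theorem adjoint_momentumMap_stdVec {L₀ N : ℕ} {n : ℤ}
    (hn : n ∈ Finset.Ico (-(latSize L₀ N : ℤ)) (latSize L₀ N)) :
    ContinuousLinearMap.adjoint (momentumMap L₀ N) (stdVec n) = latVec L₀ N n := by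
  ext l
  rw [momentumMap, adjoint_latMap_apply, inner_stdVec, stdVec_apply, latVec_apply]
  by_cases hl : (l : ℤ) = n
  · rw [if_pos hl, if_pos (by rw [hl])]
  · rw [if_neg hl, if_neg fun h' => hl (eq_of_modEq_of_mem hn l.2 h').symm]

theorem isAsymptoticEmbedding_momentumMap {L₀ : ℕ} (h : 0 < L₀) :
    IsAsymptoticEmbedding (momentumMap L₀) := by
  refine ⟨fun n => ⟨fun _ => 1, tendsto_const_nhds, ?_⟩, fun m => ?_⟩
  · filter_upwards [eventually_mem_lattice h n] with N hN
    rw [adjoint_momentumMap_stdVec hN, one_smul]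
  · refine tendsto_const_nhds.congr' ?_
    filter_upwards [eventually_mem_lattice h m] with N hN
    rw [momentumMap, latMap_latVec _ hN]

theorem stdOperator_domain (f : ℤ → OneParticle) :
    (stdOperator f).domain = Submodule.span ℂ (Set.range planeWaves) := by
  rw [coe_planeWaves]; rfl

theorem stdOperator_planeWaves (f : ℤ → OneParticle) (n : ℤ)
    (hn : planeWaves n ∈ (stdOperator f).domain) : stdOperator f ⟨planeWaves n, hn⟩ = f n := by
  have : ∀ v (hv : v ∈ (stdOperator f).domain), v = stdVec n → stdOperator f ⟨v, hv⟩ = f n := by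
    rintro v hv rfl
    exact stdOperator_apply _ n hv
  exact this _ hn (congrFun coe_planeWaves n)

theorem virasoro_domain (L : ℝ) (b : Sector) (χ : ℤˣ) (κ : ℤ) :
    (virasoro L b χ κ).domain = Submodule.span ℂ (Set.range planeWaves) :=
  stdOperator_domain _

theorem virasoro_apply (L : ℝ) (b : Sector) (χ : ℤˣ) (κ n : ℤ)
    (hn : planeWaves n ∈ (virasoro L b χ κ).domain) :
    virasoro L b χ κ ⟨planeWaves n, hn⟩ = virasoroVec L b χ κ n :=
  stdOperator_planeWaves _ n hn

theorem transport_smul {L₀ N : ℕ} (R : LatOneParticle L₀ N →L[ℂ] OneParticle) (c : ℂ)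
    (o : LatOneParticle L₀ N →L[ℂ] LatOneParticle L₀ N) :
    transport R (c • o) = c • transport R o := by
  ext; simp [transport]

theorem transport_add {L₀ N : ℕ} (R : LatOneParticle L₀ N →L[ℂ] OneParticle)
    (o o' : LatOneParticle L₀ N →L[ℂ] LatOneParticle L₀ N) :
    transport R (o + o') = transport R o + transport R o' := by
  ext; simp [transport]

theorem transport_sub {L₀ N : ℕ} (R : LatOneParticle L₀ N →L[ℂ] OneParticle)
    (o o' : LatOneParticle L₀ N →L[ℂ] LatOneParticle L₀ N) :
    transport R (o - o') = transport R o - transport R o' := by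
  ext; simp [transport]

/-- Convergence of the real parts of the Koo–Saleur approximants. -/
theorem IsAsymptoticEmbedding.bogoliubovConvergence_re {L : ℝ} (hL : 0 < L) {L₀ : ℕ} (h : 0 < L₀)
    {R : ∀ N, LatOneParticle L₀ N →L[ℂ] OneParticle} (hR : IsAsymptoticEmbedding R) (b : Sector)
    (χ : ℤˣ) (ρ : CARRep OneParticle) (κ : ℤ) :
    BogoliubovConvergence ρ (fun N => transport (R N) (ksRe L L₀ b χ N κ)) (virasoroRe L b χ κ) := by
  have hfo := isFirstOrder_virasoro hL.ne' b χ (s := pairCoeff (1 / 2) (1 / 2) κ)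
    (conj_pairCoeff conj_half κ) (summable_pairCoeff _ _ κ)
  refine hfo.bogoliubovConvergence ρ (fun N => (isSelfAdjoint_ksRe hL h b χ N κ).transport _) ?_
    (fun n hn => ?_) (fun n => ?_)
  -- The domain of a sum of partially defined operators is the intersection of the domains, here the
  -- same span twice.
  · change (virasoro L b χ κ).domain ⊓ (virasoro L b χ (-κ)).domain = _
    rw [virasoro_domain, virasoro_domain, inf_idem]
  · rw [tsum_pairCoeff (v := fun κ => virasoroVec L b χ κ n), ← smul_add]
    rw [← virasoro_apply L b χ κ n (by rw [virasoro_domain]; exact Submodule.subset_span ⟨n, rfl⟩),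
      ← virasoro_apply L b χ (-κ) n (by rw [virasoro_domain]; exact Submodule.subset_span ⟨n, rfl⟩)]
    rfl
  · rw [tsum_pairCoeff (v := fun κ => virasoroVec L b χ κ n), coe_planeWaves]
    have h1 := ((hR.tendsto_transport hL h b χ κ n).const_smul (1 / 2 : ℂ)).add
      ((hR.tendsto_transport hL h b χ (-κ) n).const_smul (1 / 2 : ℂ))
    refine h1.congr fun N => ?_
    rw [ksRe, transport_smul, transport_add, ← smul_add]
    rfl

/-- Convergence of the imaginary parts of the Koo–Saleur approximants. -/
theorem IsAsymptoticEmbedding.bogoliubovConvergence_im {L : ℝ} (hL : 0 < L) {L₀ : ℕ} (h : 0 < L₀)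
    {R : ∀ N, LatOneParticle L₀ N →L[ℂ] OneParticle} (hR : IsAsymptoticEmbedding R) (b : Sector)
    (χ : ℤˣ) (ρ : CARRep OneParticle) (κ : ℤ) :
    BogoliubovConvergence ρ (fun N => transport (R N) (ksIm L L₀ b χ N κ)) (virasoroIm L b χ κ) := by
  have hfo := isFirstOrder_virasoro hL.ne' b χ (s := pairCoeff (1 / (2 * I)) (-(1 / (2 * I))) κ)
    (conj_pairCoeff conj_inv_two_I κ) (summable_pairCoeff _ _ κ)
  refine hfo.bogoliubovConvergence ρ (fun N => (isSelfAdjoint_ksIm hL h b χ N κ).transport _) ?_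
    (fun n hn => ?_) (fun n => ?_)
  · change (virasoro L b χ κ).domain ⊓ (virasoro L b χ (-κ)).domain = _
    rw [virasoro_domain, virasoro_domain, inf_idem]
  · rw [tsum_pairCoeff (v := fun κ => virasoroVec L b χ κ n), neg_smul, ← sub_eq_add_neg, ← smul_sub]
    rw [← virasoro_apply L b χ κ n (by rw [virasoro_domain]; exact Submodule.subset_span ⟨n, rfl⟩),
      ← virasoro_apply L b χ (-κ) n (by rw [virasoro_domain]; exact Submodule.subset_span ⟨n, rfl⟩)]
    rfl
  · rw [tsum_pairCoeff (v := fun κ => virasoroVec L b χ κ n), coe_planeWaves, neg_smul,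
      ← sub_eq_add_neg]
    have h1 := ((hR.tendsto_transport hL h b χ κ n).const_smul (1 / (2 * I) : ℂ)).sub
      ((hR.tendsto_transport hL h b χ (-κ) n).const_smul (1 / (2 * I) : ℂ))
    refine h1.congr fun N => ?_
    rw [ksIm, transport_smul, transport_sub, ← smul_sub]
    rfl

end RenormalizationMaps

/-! ### Fourier transform of the scaling function: decay and zeros. -/

section ScalingFunction

open scoped FourierTransform in
theorem fourierHat_eq_fourier (s : ℝ → ℝ) (p : ℝ) :
    fourierHat s p = 𝓕 (fun x => (s x : ℂ)) (p / (2 * Real.pi)) := by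
  rw [Real.fourier_real_eq_integral_exp_smul, fourierHat]
  refine MeasureTheory.integral_congr_ae (Eventually.of_forall fun x => ?_)
  simp only [smul_eq_mul]
  congr 2
  push_cast
  have : (Real.pi : ℂ) ≠ 0 := by exact_mod_cast Real.pi_ne_zero
  field_simp

theorem continuous_fourierHat {s : ℝ → ℝ} (hs : MeasureTheory.Integrable s) :
    Continuous (fourierHat s) := by
  unfold fourierHat
  refine MeasureTheory.continuous_of_dominated (bound := fun x => ‖s x‖) (fun p => ?_) (fun p => ?_)
    hs.norm ?_
  · refine MeasureTheory.AEStronglyMeasurable.mul ?_ ?_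
    · exact (by fun_prop : Continuous fun x : ℝ => Complex.exp (-(I * (p * x)))).aestronglyMeasurable
    · exact Complex.continuous_ofReal.comp_aestronglyMeasurable hs.1
  · refine Eventually.of_forall fun x => ?_
    rw [norm_mul, Complex.norm_real]
    refine mul_le_of_le_one_left (norm_nonneg _) (le_of_eq ?_)
    rw [Complex.norm_exp]; simp
  · refine Eventually.of_forall fun x => ?_
    fun_prop

theorem conj_fourierHat (s : ℝ → ℝ) (p : ℝ) :
    starRingEnd ℂ (fourierHat s p) = fourierHat s (-p) := by
  rw [fourierHat, fourierHat, ← integral_conj]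
  refine MeasureTheory.integral_congr_ae (Eventually.of_forall fun x => ?_)
  simp only [map_mul, Complex.conj_ofReal, ← Complex.exp_conj, map_neg, Complex.conj_I]
  congr 2
  push_cast; ring

theorem fourierHat_zero {s : ℝ → ℝ} (h : ∫ x, s x = 1) : fourierHat s 0 = 1 := by
  unfold fourierHat
  simp only [Complex.ofReal_zero, zero_mul, mul_zero, neg_zero, Complex.exp_zero, one_mul]
  rw [show ∫ x, (s x : ℂ) = ((∫ x, s x : ℝ) : ℂ) from integral_ofReal, h, Complex.ofReal_one]

theorem HasCompactSupport.iteratedDeriv {f : ℝ → ℂ} (hf : HasCompactSupport f) (n : ℕ) :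
    HasCompactSupport (iteratedDeriv n f) := by
  induction n with
  | zero => simpa using hf
  | succ n ih => rw [iteratedDeriv_succ]; exact ih.deriv

open scoped FourierTransform in
/-- The Fourier transform of a compactly supported `C⁸` function decays like `|p|⁻⁸`. -/
theorem exists_fourierHat_decay {s : ℝ → ℝ} (hs : ContDiff ℝ (8 : ℕ) s)
    (hc : HasCompactSupport s) : ∃ C : ℝ, ∀ p, ‖fourierHat s p‖ * (1 + p ^ 2) ^ 4 ≤ C := by
  set f : ℝ → ℂ := fun x => (s x : ℂ) with hf
  have hfd : ContDiff ℝ ((8 : ℕ∞) : WithTop ℕ∞) f := Complex.ofRealCLM.contDiff.comp hs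
  have hfc : HasCompactSupport f := hc.comp_left Complex.ofReal_zero
  have hint : ∀ n : ℕ, n ≤ (8 : ℕ∞) → MeasureTheory.Integrable (iteratedDeriv n f) := by
    intro n hn
    refine (hfd.continuous_iteratedDeriv n (by exact_mod_cast hn)).integrable_of_hasCompactSupport
      (hfc.iteratedDeriv n)
  have hbound : ∀ n : ℕ, n ≤ (8 : ℕ∞) → ∀ p,
      |p| ^ n * ‖fourierHat s p‖ ≤ ∫ x, ‖iteratedDeriv n f x‖ := by
    intro n hn p
    have h1 := congrFun (Real.fourier_iteratedDeriv hfd hint hn) (p / (2 * Real.pi))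
    have h2 : ‖𝓕 (iteratedDeriv n f) (p / (2 * Real.pi))‖ ≤ ∫ x, ‖iteratedDeriv n f x‖ :=
      VectorFourier.norm_fourierIntegral_le_integral_norm _ _ _ _ _
    rw [h1, norm_smul, ← fourierHat_eq_fourier, norm_pow] at h2
    have h3 : ‖(2 * Real.pi * I * ((p / (2 * Real.pi) : ℝ) : ℂ) : ℂ)‖ = |p| := by
      have : (2 * Real.pi * I * ((p / (2 * Real.pi) : ℝ) : ℂ) : ℂ) = I * (p : ℂ) := by
        push_cast
        have : (Real.pi : ℂ) ≠ 0 := by exact_mod_cast Real.pi_ne_zero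
        field_simp
      rw [this, norm_mul, Complex.norm_I, one_mul, Complex.norm_real, Real.norm_eq_abs]
    rwa [h3] at h2
  -- Only the derivatives of order `0` and `8` enter; the factor `8` is that of the convexity bound
  -- `(1 + q)⁴ ≤ 8 (1 + q⁴)` at `q = p²`.
  refine ⟨8 * ((∫ x, ‖iteratedDeriv 0 f x‖) + ∫ x, ‖iteratedDeriv 8 f x‖), fun p => ?_⟩
  have h0 := hbound 0 (by simp) p
  have h8 := hbound 8 (by norm_num) p
  rw [pow_zero, one_mul] at h0
  have h9 : (1 + p ^ 2) ^ 4 ≤ 8 * (1 + |p| ^ 8) := by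
    have e : |p| ^ 8 = (p ^ 2) ^ 4 := by
      rw [← sq_abs p, ← pow_mul]
    rw [e]
    have hq : 0 ≤ p ^ 2 := sq_nonneg p
    generalize p ^ 2 = q at hq
    nlinarith [sq_nonneg (q - 1), sq_nonneg (q ^ 2 - 1), mul_nonneg hq (sq_nonneg (q - 1)),
      mul_nonneg hq (sq_nonneg (q ^ 2 - 1)), sq_nonneg (q * (q - 1)), sq_nonneg (q ^ 2 - q)]
  calc _ ≤ ‖fourierHat s p‖ * (8 * (1 + |p| ^ 8)) := by gcongr
    _ = 8 * (‖fourierHat s p‖ + |p| ^ 8 * ‖fourierHat s p‖) := by ring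
    _ ≤ _ := by gcongr

theorem conj_filterSymbol (h : ℤ →₀ ℝ) (p : ℝ) :
    starRingEnd ℂ (filterSymbol h p) = filterSymbol h (-p) := by
  unfold filterSymbol trigPoly
  rw [map_mul, map_inv₀, Complex.conj_ofReal, Finsupp.sum, Finsupp.sum, map_sum]
  congr 1
  refine Finset.sum_congr rfl fun n _ => ?_
  simp only [map_mul, Complex.conj_ofReal, ← Complex.exp_conj, map_neg, Complex.conj_I, map_intCast]
  congr 2
  push_cast; ring

/-- The two-scale relation in momentum space. -/
theorem fourierHat_two_mul {s : ℝ → ℝ} {h : ℤ →₀ ℝ} (hs : MeasureTheory.Integrable s)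
    (hsc : ∀ᵐ x : ℝ, s x = h.sum fun n c => c * (Real.sqrt 2 * s (2 * x - n))) (p : ℝ) :
    fourierHat s (2 * p) = filterSymbol h p * fourierHat s p := by
  set G : ℤ → ℝ → ℂ := fun n y => Complex.exp (-(I * (p * (y + n)))) * (s y : ℂ) with hG
  have hGi : ∀ n, MeasureTheory.Integrable (G n) := by
    intro n
    refine hs.ofReal.bdd_mul (c := 1)
      (by fun_prop : Continuous fun y : ℝ => Complex.exp (-(I * (p * (y + n))))).aestronglyMeasurable
      (Eventually.of_forall fun y => ?_)
    rw [Complex.norm_exp]; simp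
  -- Substituting `y = 2x - n` produces the phase `e^{-ipn}` of the filter symbol and the Jacobian
  -- `1/2`.
  have hGint : ∀ n, ∫ x : ℝ, G n (2 * x - n) = (1 / 2 : ℂ) * (Complex.exp (-(I * (p * n))) * fourierHat s p) := by
    intro n
    have h1 := MeasureTheory.Measure.integral_comp_mul_left (fun y => G n (y - n)) 2
    rw [MeasureTheory.integral_sub_right_eq_self (G n) (n : ℝ)] at h1
    rw [h1, fourierHat, ← MeasureTheory.integral_const_mul, ← MeasureTheory.integral_const_mul,
      ← MeasureTheory.integral_smul]
    refine MeasureTheory.integral_congr_ae (Eventually.of_forall fun x => ?_)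
    simp only [hG]
    rw [mul_add, mul_add, neg_add, Complex.exp_add, abs_of_pos (by norm_num), Complex.real_smul]
    push_cast
    ring
  have hcomp : ∀ n : ℤ, MeasureTheory.Integrable fun x : ℝ => G n (2 * x - n) := fun n =>
    ((hGi n).comp_sub_right (n : ℝ)).comp_mul_left' (by norm_num : (2 : ℝ) ≠ 0)
  have e1 : fourierHat s (2 * p) =
      ∫ x : ℝ, ∑ n ∈ h.support, ((h n * Real.sqrt 2 : ℝ) : ℂ) * G n (2 * x - n) := by
    rw [fourierHat]
    refine MeasureTheory.integral_congr_ae ?_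
    filter_upwards [hsc] with x hx
    rw [hx, Finsupp.sum]
    push_cast
    rw [Finset.mul_sum]
    refine Finset.sum_congr rfl fun n _ => ?_
    simp only [hG]
    have : Complex.exp (-(I * (2 * p * x))) = Complex.exp (-(I * (p * (((2 * x - n : ℝ) : ℂ) + n)))) := by
      congr 1; push_cast; ring
    rw [this]
    push_cast
    ring
  rw [e1, MeasureTheory.integral_finsetSum _ fun n _ => (hcomp n).const_mul _]
  simp only [MeasureTheory.integral_const_mul, hGint]
  rw [filterSymbol, trigPoly, Finsupp.sum, mul_assoc, Finset.sum_mul, Finset.mul_sum]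
  refine Finset.sum_congr rfl fun n _ => ?_
  have h2 : ((Real.sqrt 2 : ℝ) : ℂ) * ((Real.sqrt 2 : ℝ) : ℂ) = 2 := by
    rw [← Complex.ofReal_mul, Real.mul_self_sqrt (by norm_num)]; norm_num
  have h3 : ((Real.sqrt 2 : ℝ) : ℂ) ≠ 0 := fun h0 => by rw [h0] at h2; norm_num at h2
  have h4 : ((Real.sqrt 2 : ℝ) : ℂ)⁻¹ = ((Real.sqrt 2 : ℝ) : ℂ) * (1 / 2) := by
    linear_combination (-((Real.sqrt 2 : ℝ) : ℂ)⁻¹ / 2) * h2 +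
      (((Real.sqrt 2 : ℝ) : ℂ) / 2) * mul_inv_cancel₀ h3
  rw [h4]
  push_cast
  ring

variable {K : ℕ} {h : ℤ →₀ ℝ} {s : ℝ → ℝ}

theorem IsDaubechies.integrable (hd : IsDaubechies K h s) (hs : Continuous s) :
    MeasureTheory.Integrable s := hs.integrable_of_hasCompactSupport hd.hasCompactSupport

theorem IsDaubechies.filterSymbol_eq_zero (hd : IsDaubechies K h s) {p : ℝ}
    (hp : Complex.exp (-(I * p)) = -1) : filterSymbol h p = 0 := by
  obtain ⟨q, hq, -⟩ := hd.factor
  have := hd.two_le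
  rw [hq, hp, add_neg_cancel, zero_div, zero_pow (by omega), zero_mul]

/-- On this interval `1 + e^{-ip}` has real part at least `1`, and `|𝓛(p)|² ≥ 1` because the term `j
= 0` of the nonnegative sum equals `1`. -/
theorem IsDaubechies.filterSymbol_ne_zero (hd : IsDaubechies K h s) {p : ℝ}
    (hp : |p| ≤ Real.pi / 2) : filterSymbol h p ≠ 0 := by
  obtain ⟨q, hq, hq2⟩ := hd.factor
  rw [hq]
  refine mul_ne_zero (pow_ne_zero _ (div_ne_zero ?_ two_ne_zero)) ?_
  · intro h0
    have h1 := congrArg Complex.re h0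
    have h2 : (Complex.exp (-(I * p))).re = Real.cos p := by
      rw [Complex.exp_re]; simp
    rw [Complex.add_re, h2] at h1
    have h3 : 0 ≤ Real.cos p := Real.cos_nonneg_of_neg_pi_div_two_le_of_le
      (by linarith [neg_abs_le p]) (by linarith [le_abs_self p])
    simp at h1
    linarith
  · intro h0
    have h1 := hq2 p
    rw [h0] at h1
    have hK := hd.two_le
    have h2 : (1 : ℝ) ≤ ∑ j ∈ Finset.range K,
        ((K - 1 + j).choose j : ℝ) * Real.sin (p / 2) ^ (2 * j) := by
      have := Finset.single_le_sum (f := fun j : ℕ =>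
        ((K - 1 + j).choose j : ℝ) * Real.sin (p / 2) ^ (2 * j)) (s := Finset.range K) (a := 0)
        (fun j _ => by rw [pow_mul]; positivity) (Finset.mem_range.mpr (by omega))
      simpa using this
    rw [← h1] at h2
    norm_num at h2

theorem IsDaubechies.fourierHat_two_mul (hd : IsDaubechies K h s) (hs : Continuous s) (p : ℝ) :
    fourierHat s (2 * p) = filterSymbol h p * fourierHat s p :=
  _root_.fourierHat_two_mul (hd.integrable hs) hd.scaling p

theorem exp_neg_I_pi_odd {q : ℤ} (hq : Odd q) :
    Complex.exp (-(I * ((Real.pi * q : ℝ) : ℂ))) = -1 := by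
  obtain ⟨r, rfl⟩ := hq
  have : -(I * ((Real.pi * ((2 * r + 1 : ℤ) : ℝ) : ℝ) : ℂ)) =
      ((-r - 1 : ℤ) : ℂ) * (2 * Real.pi * I) + Real.pi * I := by push_cast; ring
  rw [this, Complex.exp_add, Complex.exp_int_mul_two_pi_mul_I, one_mul, Complex.exp_pi_mul_I]

/-- The Strang–Fix condition of order zero. -/
theorem IsDaubechies.fourierHat_two_pi_mul (hd : IsDaubechies K h s) (hs : Continuous s) {q : ℤ}
    (hq : q ≠ 0) : fourierHat s (2 * Real.pi * q) = 0 := by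
  induction hn : q.natAbs using Nat.strong_induction_on generalizing q with
  | _ n ih =>
    -- For odd `q` the symbol vanishes at `πq`; for even `q` the two-scale relation descends to `q /
    -- 2`.
    rcases Int.even_or_odd q with he | ho
    · obtain ⟨r, hr⟩ := he
      have h1 : fourierHat s (2 * Real.pi * r) = 0 := ih r.natAbs (by omega) (by omega) rfl
      have e : 2 * Real.pi * q = 2 * (2 * Real.pi * r) := by rw [hr]; push_cast; ring
      rw [e, hd.fourierHat_two_mul hs, h1, mul_zero]
    · rw [mul_assoc, hd.fourierHat_two_mul hs, hd.filterSymbol_eq_zero (exp_neg_I_pi_odd ho), zero_mul]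

/-- A zero at `p` would, since the symbol is nonzero on `[-π/2, π/2]`, propagate to all `p / 2ⁿ`,
contradicting continuity and `ŝ(0) = 1`. -/
theorem IsDaubechies.fourierHat_ne_zero (hd : IsDaubechies K h s) (hs : Continuous s) {p : ℝ}
    (hp : |p| ≤ Real.pi) : fourierHat s p ≠ 0 := by
  intro h0
  have h1 : ∀ n : ℕ, fourierHat s (p / 2 ^ n) = 0 := by
    intro n
    induction n with
    | zero => simpa using h0
    | succ n ih =>
      have e : p / 2 ^ n = 2 * (p / 2 ^ (n + 1)) := by rw [pow_succ]; field_simp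
      rw [e, hd.fourierHat_two_mul hs] at ih
      refine (mul_eq_zero.mp ih).resolve_left (hd.filterSymbol_ne_zero ?_)
      rw [abs_div, abs_of_pos (by positivity : (0 : ℝ) < 2 ^ (n + 1))]
      have h2 : (2 : ℝ) ≤ 2 ^ (n + 1) := by
        rw [pow_succ]; linarith [one_le_pow₀ (M₀ := ℝ) (by norm_num : (1 : ℝ) ≤ 2) (n := n)]
      exact div_le_div₀ Real.pi_pos.le hp (by norm_num) h2
  have h2 : Tendsto (fun n : ℕ => fourierHat s (p / 2 ^ n)) atTop (𝓝 (fourierHat s 0)) := by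
    refine ((continuous_fourierHat (hd.integrable hs)).tendsto 0).comp ?_
    exact tendsto_const_nhds.div_atTop (tendsto_pow_atTop_atTop_of_one_lt (by norm_num))
  rw [fourierHat_zero hd.integral_eq_one] at h2
  simp only [h1] at h2
  exact zero_ne_one (tendsto_nhds_unique tendsto_const_nhds h2)

theorem IsDaubechies.exists_le_norm_fourierHat (hd : IsDaubechies K h s) (hs : Continuous s) :
    ∃ c : ℝ, 0 < c ∧ ∀ p : ℝ, |p| ≤ Real.pi → c ≤ ‖fourierHat s p‖ := by
  obtain ⟨p₀, hp₀, hmin⟩ := (isCompact_Icc (a := -Real.pi) (b := Real.pi)).exists_isMinOn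
    ⟨0, by simp [Real.pi_pos.le]⟩
    (continuous_fourierHat (hd.integrable hs)).norm.continuousOn
  refine ⟨‖fourierHat s p₀‖, norm_pos_iff.mpr (hd.fourierHat_ne_zero hs (abs_le.mpr hp₀)),
    fun p hp => hmin (abs_le.mp hp)⟩

end ScalingFunction

/-! ### The wavelet renormalization map as an asymptotic embedding. -/

section Wavelet

variable {K : ℕ} {h : ℤ →₀ ℝ} {s : ℝ → ℝ}

theorem norm_le_of_decay {C : ℝ} (hC : ∀ p, ‖fourierHat s p‖ * (1 + p ^ 2) ^ 4 ≤ C) (p : ℝ) :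
    ‖fourierHat s p‖ ≤ C * (1 + p ^ 2)⁻¹ := by
  have h1 : (1 : ℝ) ≤ 1 + p ^ 2 := by nlinarith [sq_nonneg p]
  rw [← div_eq_mul_inv, le_div_iff₀ (by positivity)]
  refine le_trans ?_ (hC p)
  gcongr
  calc 1 + p ^ 2 = (1 + p ^ 2) ^ 1 := (pow_one _).symm
    _ ≤ _ := pow_le_pow_right₀ h1 (by norm_num)

theorem latSpacing_mul_mom_eq {L : ℝ} (hL : 0 < L) {L₀ : ℕ} (h0 : 0 < L₀) (b : Sector) (N : ℕ)
    (j : ℤ) : latSpacing L L₀ N * mom L b j = Real.pi / latSize L₀ N * (j + b.shift) :=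
  latSpacing_mul hL h0 N _

/-- Ensures that the default value `0` in the definition of `waveletMap` is never used. -/
theorem memℓp_waveletCoord {C : ℝ} (hC : ∀ p, ‖fourierHat s p‖ * (1 + p ^ 2) ^ 4 ≤ C) {L : ℝ}
    (hL : 0 < L) {L₀ : ℕ} (h0 : 0 < L₀) (b : Sector) (N : ℕ) (l : LatIndex L₀ N) :
    Memℓp (waveletCoord s L L₀ b N l) 2 := by
  have hA : (0 : ℝ) < latSize L₀ N := by exact_mod_cast latSize_pos h0 N
  set a : ℝ := Real.pi / latSize L₀ N with ha
  have ha0 : 0 < a := by positivity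
  have hC0 : 0 ≤ C := le_trans (by positivity) (hC 0)
  -- The extra factor absorbs the rescaling of momenta by `a` and the boundary shift of at most
  -- `1/2`.
  set D : ℝ := C * (2 * (1 + (a ^ 2)⁻¹)) with hD
  have hD0 : 0 ≤ D := by positivity
  have hb : ∀ j, ‖waveletCoord s L L₀ b N l j‖ ≤ D * (1 + (j : ℝ) ^ 2)⁻¹ := by
    intro j
    unfold waveletCoord
    split_ifs
    · refine (norm_le_of_decay hC _).trans ?_
      rw [latSpacing_mul_mom_eq hL h0, ← ha, hD, mul_assoc]
      refine mul_le_mul_of_nonneg_left ?_ hC0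
      rw [← div_eq_mul_inv, inv_le_comm₀ (by positivity) (by positivity), inv_div,
        div_le_iff₀ (by positivity)]
      set y : ℝ := j + b.shift with hy
      have hj : (j : ℝ) = y - b.shift := by rw [hy]; ring
      have e : (1 + (a * y) ^ 2) * (2 * (1 + (a ^ 2)⁻¹)) =
          2 * (1 + y ^ 2 + (a ^ 2)⁻¹ + a ^ 2 * y ^ 2) := by field_simp; ring
      rw [e, hj]
      have h1 : 0 ≤ (a ^ 2)⁻¹ := by positivity
      have h2 : 0 ≤ a ^ 2 * y ^ 2 := by positivity
      have h3 := shift_nonneg b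
      have h4 := shift_le b
      nlinarith [sq_nonneg (y + b.shift)]
    · rw [norm_zero]; positivity
  refine memℓp_gen ?_
  refine Summable.of_nonneg_of_le (fun j => by positivity) (fun j => ?_)
    (summable_inv_one_add_sq.mul_left (D ^ 2))
  have h1 : (1 + (j : ℝ) ^ 2)⁻¹ ≤ 1 := inv_le_one_of_one_le₀ (by nlinarith [sq_nonneg (j : ℝ)])
  have h2 : 0 ≤ (1 + (j : ℝ) ^ 2)⁻¹ := by positivity
  rw [ENNReal.toReal_ofNat, Real.rpow_ofNat]
  calc ‖waveletCoord s L L₀ b N l j‖ ^ 2 ≤ (D * (1 + (j : ℝ) ^ 2)⁻¹) ^ 2 := by gcongr; exact hb j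
    _ = D ^ 2 * ((1 + (j : ℝ) ^ 2)⁻¹ * (1 + (j : ℝ) ^ 2)⁻¹) := by ring
    _ ≤ _ := by
      refine mul_le_mul_of_nonneg_left ?_ (by positivity)
      nlinarith

/-- A lattice wave is spread over its aliases `m + 2 L_N q`, and such a shift of the index moves the
argument of `ŝ` by exactly `2πq`. -/
theorem hasSum_waveletMap_latVec {C : ℝ} (hC : ∀ p, ‖fourierHat s p‖ * (1 + p ^ 2) ^ 4 ≤ C)
    {L : ℝ} (hL : 0 < L) {L₀ : ℕ} (h0 : 0 < L₀) (b : Sector) {N : ℕ} {m : ℤ}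
    (hm : m ∈ Finset.Ico (-(latSize L₀ N : ℤ)) (latSize L₀ N)) :
    HasSum (fun q : ℤ => fourierHat s (Real.pi / latSize L₀ N * (m + b.shift) + 2 * Real.pi * q) •
      (stdVec (m + 2 * latSize L₀ N * q) : OneParticle))
      (waveletMap s L L₀ b N (latVec L₀ N m)) := by
  have hA : (0 : ℝ) < latSize L₀ N := by exact_mod_cast latSize_pos h0 N
  have hA' : (latSize L₀ N : ℤ) ≠ 0 := by exact_mod_cast (latSize_pos h0 N).ne'
  have hmem := memℓp_waveletCoord hC hL h0 b N ⟨m, hm⟩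
  have e : waveletMap s L L₀ b N (latVec L₀ N m) =
      (⟨waveletCoord s L L₀ b N ⟨m, hm⟩, hmem⟩ : OneParticle) := by
    rw [waveletMap, latMap_latVec _ hm, dif_pos hmem]
  rw [e]
  have h1 := hasSum_stdVec (⟨waveletCoord s L L₀ b N ⟨m, hm⟩, hmem⟩ : OneParticle)
  have hinj : Function.Injective fun q : ℤ => m + 2 * latSize L₀ N * q := by
    intro q q' hq
    have : (2 * latSize L₀ N : ℤ) * q = 2 * latSize L₀ N * q' := by simpa using hq
    exact mul_left_cancel₀ (mul_ne_zero two_ne_zero hA') this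
  rw [← hinj.hasSum_iff] at h1
  · refine Eq.mp (congrArg (fun f => HasSum f _) (funext fun q => ?_)) h1
    change waveletCoord s L L₀ b N ⟨m, hm⟩ (m + 2 * latSize L₀ N * q) •
      (stdVec (m + 2 * latSize L₀ N * q) : OneParticle) = _
    rw [waveletCoord, if_pos, latSpacing_mul_mom_eq hL h0]
    · congr 2
      push_cast
      field_simp
      ring
    · exact (Int.modEq_iff_dvd.mpr ⟨-q, by simp⟩)
  · intro j hj
    change waveletCoord s L L₀ b N ⟨m, hm⟩ j • (stdVec j : OneParticle) = 0
    rw [waveletCoord, if_neg, zero_smul]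
    intro hmod
    obtain ⟨q, hq⟩ := hmod.symm.dvd
    exact hj ⟨q, by change m + 2 * latSize L₀ N * q = j; linarith⟩

/-- As `N` grows the weights of the aliases tend to `ŝ(2πq)`, which is `1` at `q = 0` and `0`
otherwise by the Strang–Fix condition. The decay of `ŝ` permits the limit inside the sum over
aliases. -/
theorem tendsto_waveletMap_latVec (hd : IsDaubechies K h s) (hs : Continuous s) {C : ℝ}
    (hC : ∀ p, ‖fourierHat s p‖ * (1 + p ^ 2) ^ 4 ≤ C)
    {L : ℝ} (hL : 0 < L) {L₀ : ℕ} (h0 : 0 < L₀) (b : Sector) (m : ℤ) :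
    Tendsto (fun N => waveletMap s L L₀ b N (latVec L₀ N m)) atTop (𝓝 (stdVec m)) := by
  have hC0 : 0 ≤ C := le_trans (by positivity) (hC 0)
  set x : ℕ → ℝ := fun N => Real.pi / latSize L₀ N * (m + b.shift) with hx
  have hx0 : Tendsto x atTop (𝓝 0) := by
    have : Tendsto (fun N => Real.pi / (latSize L₀ N : ℝ)) atTop (𝓝 0) :=
      tendsto_const_nhds.div_atTop (tendsto_natCast_atTop_atTop.comp (tendsto_latSize h0))
    simpa using this.mul_const (m + b.shift)
  set d : ℕ → ℤ → ℂ := fun N q => fourierHat s (x N + 2 * Real.pi * q) - if q = 0 then 1 else 0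
    with hdd
  have hbound : ∀ᶠ N in atTop, ∀ q, ‖d N q‖ ≤ (C + 1) * (1 + (q : ℝ) ^ 2)⁻¹ := by
    filter_upwards [hx0.eventually (Metric.ball_mem_nhds 0 one_pos)] with N hN q
    have hN' : |x N| < 1 := by simpa using hN
    have h1 := norm_le_of_decay hC (x N + 2 * Real.pi * q)
    have h2 : (1 + (x N + 2 * Real.pi * q) ^ 2)⁻¹ ≤ (1 + (q : ℝ) ^ 2)⁻¹ := by
      refine inv_anti₀ (by positivity) ?_
      by_cases hq : q = 0
      · subst hq; simp; positivity
      · have hq1 : (1 : ℝ) ≤ |(q : ℝ)| := by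
          rw [← Int.cast_abs]; exact_mod_cast Int.one_le_abs hq
        -- As `|x N| < 1` and `|q| ≥ 1`, the right side is at least `2π|q| - 1`.
        have h3 : |(q : ℝ)| ≤ |x N + 2 * Real.pi * q| := by
          have h4 : |2 * Real.pi * (q : ℝ)| ≤ |x N + 2 * Real.pi * q| + |x N| := by
            have := abs_sub (x N + 2 * Real.pi * q) (x N)
            simpa using this
          rw [abs_mul, abs_of_pos Real.two_pi_pos] at h4
          nlinarith [Real.pi_gt_three]
        have := sq_le_sq.mpr h3
        linarith
    calc ‖d N q‖ ≤ ‖fourierHat s (x N + 2 * Real.pi * q)‖ + ‖(if q = 0 then 1 else 0 : ℂ)‖ :=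
          norm_sub_le _ _
      _ ≤ C * (1 + (q : ℝ) ^ 2)⁻¹ + 1 * (1 + (q : ℝ) ^ 2)⁻¹ := by
          refine add_le_add (h1.trans (mul_le_mul_of_nonneg_left h2 hC0)) ?_
          by_cases hq : q = 0
          · subst hq; simp
          · rw [if_neg hq, norm_zero]; positivity
      _ = _ := by ring
  have hsum := summable_inv_one_add_sq.mul_left (C + 1)
  have hlim : Tendsto (fun N => ∑' q, ‖d N q‖) atTop (𝓝 0) := by
    have := tendsto_tsum_of_dominated_convergence (𝓕 := atTop) (f := fun N q => ‖d N q‖)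
      (g := fun _ => 0) hsum (fun q => by
        have h1 : Tendsto (fun N => fourierHat s (x N + 2 * Real.pi * q)) atTop
            (𝓝 (fourierHat s (2 * Real.pi * q))) := by
          have h2 : Tendsto (fun N => x N + 2 * Real.pi * q) atTop (𝓝 (2 * Real.pi * q)) := by
            simpa using hx0.add_const (2 * Real.pi * q)
          exact ((continuous_fourierHat (hd.integrable hs)).tendsto _).comp h2
        have h3 : fourierHat s (2 * Real.pi * q) = if q = 0 then 1 else 0 := by
          by_cases hq : q = 0
          · subst hq; simpa using fourierHat_zero hd.integral_eq_one
          · rw [if_neg hq, hd.fourierHat_two_pi_mul hs hq]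
        have h4 := (h1.sub_const (if q = 0 then 1 else 0)).norm
        rw [h3, sub_self, norm_zero] at h4
        exact h4)
      (hbound.mono fun N hN q => by rw [norm_norm]; exact hN q)
    simpa using this
  rw [tendsto_iff_norm_sub_tendsto_zero]
  refine tendsto_of_tendsto_of_tendsto_of_le_of_le' tendsto_const_nhds hlim
    (Eventually.of_forall fun N => norm_nonneg _) ?_
  filter_upwards [eventually_mem_lattice h0 m, hbound] with N hN hbN
  have h1 := hasSum_waveletMap_latVec hC hL h0 b hN
  have h2 := h1.sub (hasSum_ite_eq (0 : ℤ) (stdVec m : OneParticle))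
  have h3 : (fun q : ℤ => fourierHat s (Real.pi / latSize L₀ N * (m + b.shift) + 2 * Real.pi * q) •
      (stdVec (m + 2 * latSize L₀ N * q) : OneParticle) - if q = 0 then stdVec m else 0) =
      fun q => d N q • (stdVec (m + 2 * latSize L₀ N * q) : OneParticle) := by
    funext q
    simp only [hdd, hx, sub_smul]
    by_cases hq : q = 0
    · subst hq; simp
    · simp [hq]
  rw [h3] at h2
  rw [← h2.tsum_eq]
  refine (norm_tsum_le_tsum_norm ?_).trans (le_of_eq ?_)
  · simp only [norm_smul, norm_stdVec, mul_one]
    exact Summable.of_nonneg_of_le (fun q => norm_nonneg _) hbN hsum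
  · simp only [norm_smul, norm_stdVec, mul_one]

theorem isAsymptoticEmbedding_waveletMap (hd : IsDaubechies K h s) (hs : ContDiff ℝ (8 : ℕ) s)
    {L : ℝ} (hL : 0 < L) {L₀ : ℕ} (h0 : 0 < L₀) (b : Sector) :
    IsAsymptoticEmbedding (waveletMap s L L₀ b) := by
  obtain ⟨C, hC⟩ := exists_fourierHat_decay hs hd.hasCompactSupport
  refine ⟨fun n => ⟨fun N => starRingEnd ℂ (fourierHat s (latSpacing L L₀ N * mom L b n)), ?_, ?_⟩,
    tendsto_waveletMap_latVec hd hs.continuous hC hL h0 b⟩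
  · have h1 : Tendsto (fun N => latSpacing L L₀ N * mom L b n) atTop (𝓝 0) := by
      simpa using (tendsto_latSpacing L h0).mul_const (mom L b n)
    have h2 := ((continuous_fourierHat (hd.integrable hs.continuous)).tendsto 0).comp h1
    rw [fourierHat_zero hd.integral_eq_one] at h2
    simpa using! (Complex.continuous_conj.tendsto 1).comp h2
  · refine Eventually.of_forall fun N => ?_
    ext l
    have hmem := memℓp_waveletCoord hC hL h0 b N l
    rw [waveletMap, adjoint_latMap_apply, dif_pos hmem, ← inner_conj_symm, inner_stdVec,
      PiLp.smul_apply, latVec_apply]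
    change starRingEnd ℂ (waveletCoord s L L₀ b N l n) = _
    unfold waveletCoord
    by_cases hl : n ≡ l [ZMOD 2 * latSize L₀ N]
    · rw [if_pos hl, if_pos hl, smul_eq_mul, mul_one]
    · rw [if_neg hl, if_neg hl, smul_zero, map_zero]

end Wavelet

/-! ### Convergence of the smeared approximants. -/

section Smearing

variable {K : ℕ} {h : ℤ →₀ ℝ} {s : ℝ → ℝ}

theorem exists_fourierHat_decay_int {C : ℝ} (hC : ∀ p, ‖fourierHat s p‖ * (1 + p ^ 2) ^ 4 ≤ C)
    {a : ℝ} (ha : 0 < a) :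
    Summable fun κ : ℤ => ‖fourierHat s (a * κ)‖ * (1 + (κ : ℝ) ^ 2) ^ 3 := by
  have hC0 : 0 ≤ C := le_trans (by positivity) (hC 0)
  refine Summable.of_nonneg_of_le (fun κ => by positivity) (fun κ => ?_)
    (summable_inv_one_add_sq.mul_left (C * (1 + (a ^ 2)⁻¹) ^ 4))
  rw [← div_eq_mul_inv, le_div_iff₀ (by positivity)]
  have h1 : 1 + (κ : ℝ) ^ 2 ≤ (1 + (a ^ 2)⁻¹) * (1 + (a * κ) ^ 2) := by
    have e : (1 + (a ^ 2)⁻¹) * (1 + (a * κ) ^ 2) = 1 + (κ : ℝ) ^ 2 + (a ^ 2)⁻¹ + (a * κ) ^ 2 := by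
      field_simp; ring
    rw [e]
    have : 0 ≤ (a ^ 2)⁻¹ := by positivity
    nlinarith [sq_nonneg (a * (κ : ℝ))]
  calc ‖fourierHat s (a * κ)‖ * (1 + (κ : ℝ) ^ 2) ^ 3 * (1 + (κ : ℝ) ^ 2)
      = ‖fourierHat s (a * κ)‖ * (1 + (κ : ℝ) ^ 2) ^ 4 := by ring
    _ ≤ ‖fourierHat s (a * κ)‖ * ((1 + (a ^ 2)⁻¹) * (1 + (a * κ) ^ 2)) ^ 4 := by gcongr
    _ = ‖fourierHat s (a * κ)‖ * (1 + (a * κ) ^ 2) ^ 4 * (1 + (a ^ 2)⁻¹) ^ 4 := by ring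
    _ ≤ _ := by gcongr; exact hC _

theorem conj_loopHat (L : ℝ) {L₀ M : ℕ} (X : LatIndex L₀ M → ℝ) (κ : ℤ) :
    starRingEnd ℂ (loopHat L X κ) = loopHat L X (-κ) := by
  rw [loopHat, loopHat, map_sum]
  refine Finset.sum_congr rfl fun j _ => ?_
  simp only [map_mul, Complex.conj_ofReal, ← Complex.exp_conj, map_neg, Complex.conj_I]
  congr 2
  push_cast; ring

theorem norm_loopHat_le (L : ℝ) {L₀ M : ℕ} (X : LatIndex L₀ M → ℝ) (κ : ℤ) :
    ‖loopHat L X κ‖ ≤ ∑ j, |X j| := by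
  refine (norm_sum_le _ _).trans (Finset.sum_le_sum fun j _ => ?_)
  rw [norm_mul, Complex.norm_real, Complex.norm_exp, Real.norm_eq_abs]
  refine mul_le_of_le_one_left (abs_nonneg _) (le_of_eq ?_)
  rw [Real.exp_eq_one_iff, Complex.neg_re, ← Complex.ofReal_mul, Complex.I_mul_re, Complex.ofReal_im]
  simp

theorem latSize_succ (L₀ N : ℕ) : latSize L₀ (N + 1) = 2 * latSize L₀ N := by
  unfold latSize; rw [pow_succ]; ring

theorem latSpacing_eq_two_mul (L : ℝ) (L₀ N : ℕ) :
    latSpacing L L₀ N = 2 * latSpacing L L₀ (N + 1) := by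
  unfold latSpacing
  rw [latSize_succ, Nat.cast_mul, Nat.cast_ofNat, ← mul_div_assoc, mul_div_mul_left _ _ two_ne_zero]

/-- The iterated two-scale relation. -/
theorem IsDaubechies.fourierHat_eq_prod (hd : IsDaubechies K h s) (hs : Continuous s) (L : ℝ)
    (L₀ M : ℕ) (x : ℝ) {N : ℕ} (hN : M ≤ N) :
    fourierHat s (latSpacing L L₀ M * x) =
      (∏ j ∈ Finset.Ioc M N, filterSymbol h (latSpacing L L₀ j * x)) *
        fourierHat s (latSpacing L L₀ N * x) := by
  induction N, hN using Nat.le_induction with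
  | base => simp
  | succ N hN ih =>
    rw [ih, ← Finset.insert_Ioc_right_eq_Ioc_add_one (by omega),
      Finset.prod_insert (by simp), latSpacing_eq_two_mul L L₀ N, mul_assoc 2,
      hd.fourierHat_two_mul hs]
    ring

/-- The factors `2` in the renormalization of loops, one per scale, exactly compensate the growth of
`L_N`. -/
theorem loopToScale_eq {L : ℝ} {L₀ M : ℕ} (h0 : 0 < L₀) (X : LatIndex L₀ M → ℝ) {N : ℕ} (hN : M ≤ N)
    (κ : ℤ) : (2 * (latSize L₀ N : ℂ))⁻¹ * loopToScale h L X N κ =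
      (2 * (latSize L₀ M : ℂ))⁻¹ *
        (∏ j ∈ Finset.Ioc M N, filterSymbol h (latSpacing L L₀ j * (Real.pi / L * κ))) *
          loopHat L X κ := by
  rw [loopToScale, Finset.prod_mul_distrib, Finset.prod_const, Nat.card_Ioc]
  have e : (latSize L₀ N : ℂ) = 2 ^ (N - M) * latSize L₀ M := by
    have : latSize L₀ N = 2 ^ (N - M) * latSize L₀ M := by
      unfold latSize; rw [← mul_assoc, ← pow_add, Nat.sub_add_cancel hN]
    rw [this]; push_cast; ring
  have hM : (latSize L₀ M : ℂ) ≠ 0 := by exact_mod_cast (latSize_pos h0 M).ne'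
  rw [e]
  generalize (∏ j ∈ Finset.Ioc M N, filterSymbol h (latSpacing L L₀ j * (Real.pi / L * κ))) = P
  field_simp

theorem loopToLimit_eq {L : ℝ} (hL : 0 < L) {L₀ M : ℕ} (h0 : 0 < L₀) (X : LatIndex L₀ M → ℝ)
    (κ : ℤ) : (2 * (L : ℂ))⁻¹ * loopToLimit s L X κ =
      (2 * (latSize L₀ M : ℂ))⁻¹ * fourierHat s (latSpacing L L₀ M * (Real.pi / L * κ)) *
        loopHat L X κ := by
  have hM : (latSize L₀ M : ℂ) ≠ 0 := by exact_mod_cast (latSize_pos h0 M).ne'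
  have hL' : (L : ℂ) ≠ 0 := by exact_mod_cast hL.ne'
  have e : ((latSpacing L L₀ M : ℝ) : ℂ) = L / latSize L₀ M := by
    unfold latSpacing; push_cast; rfl
  rw [loopToLimit, e]
  field_simp

theorem conj_loopToScale (L : ℝ) {L₀ M : ℕ} (X : LatIndex L₀ M → ℝ) (N : ℕ) (κ : ℤ) :
    starRingEnd ℂ (loopToScale h L X N κ) = loopToScale h L X N (-κ) := by
  rw [loopToScale, loopToScale, map_mul, conj_loopHat, map_prod]
  congr 1
  refine Finset.prod_congr rfl fun j _ => ?_
  rw [map_mul, conj_filterSymbol, Complex.conj_ofNat]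
  congr 2
  push_cast; ring

theorem conj_loopToLimit (L : ℝ) {L₀ M : ℕ} (X : LatIndex L₀ M → ℝ) (κ : ℤ) :
    starRingEnd ℂ (loopToLimit s L X κ) = loopToLimit s L X (-κ) := by
  rw [loopToLimit, loopToLimit, map_mul, map_mul, conj_loopHat, conj_fourierHat,
    Complex.conj_ofReal]
  congr 3
  push_cast; ring

/-- The coefficient at the boundary momentum `-π / ε_N` vanishes. -/
theorem IsDaubechies.loopToScale_neg_latSize (hd : IsDaubechies K h s) {L : ℝ} (hL : 0 < L)
    {L₀ M : ℕ} (h0 : 0 < L₀) (X : LatIndex L₀ M → ℝ) {N : ℕ} (hN : M < N) :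
    loopToScale h L X N (-(latSize L₀ N : ℤ)) = 0 := by
  rw [loopToScale, Finset.prod_eq_zero (i := N) (Finset.mem_Ioc.mpr ⟨hN, le_rfl⟩), zero_mul]
  have hA : (latSize L₀ N : ℝ) ≠ 0 := by exact_mod_cast (latSize_pos h0 N).ne'
  have e : latSpacing L L₀ N * (Real.pi / L * ((-(latSize L₀ N : ℤ) : ℤ) : ℝ)) =
      Real.pi * ((-1 : ℤ) : ℝ) := by
    rw [latSpacing_mul hL h0]
    push_cast
    field_simp
  rw [e, hd.filterSymbol_eq_zero (exp_neg_I_pi_odd (by decide)), mul_zero]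

theorem star_transport {L₀ N : ℕ} (R : LatOneParticle L₀ N →L[ℂ] OneParticle)
    (o : LatOneParticle L₀ N →L[ℂ] LatOneParticle L₀ N) :
    star (transport R o) = transport R (star o) := by
  simp only [transport, ContinuousLinearMap.star_eq_adjoint, ContinuousLinearMap.adjoint_comp,
    ContinuousLinearMap.adjoint_adjoint, ContinuousLinearMap.comp_assoc]

/-- The half-open window contains `-A` but not `A`; when both boundary terms vanish, the sum runs
over the symmetric open interval. -/
theorem sum_Ico_neg_eq {E : Type*} [AddCommGroup E] {A : ℤ} (hA : 0 < A) (g : ℤ → E)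
    (h1 : g (-A) = 0) (h2 : g A = 0) :
    ∑ κ ∈ Finset.Ico (-A) A, g (-κ) = ∑ κ ∈ Finset.Ico (-A) A, g κ := by
  have e1 : ∑ κ ∈ Finset.Ico (-A) A, g (-κ) = ∑ κ ∈ Finset.Ioc (-A) A, g κ := by
    refine Finset.sum_nbij' (fun κ => -κ) (fun κ => -κ) ?_ ?_ ?_ ?_ ?_
    · intro κ hκ; rw [Finset.mem_Ico] at hκ; rw [Finset.mem_Ioc]; omega
    · intro κ hκ; rw [Finset.mem_Ioc] at hκ; rw [Finset.mem_Ico]; omega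
    · intro κ _; simp
    · intro κ _; simp
    · intro κ _; rfl
  rw [e1, ← Finset.Ioo_insert_right (by omega), ← Finset.Ioo_insert_left (by omega),
    Finset.sum_insert (by simp), Finset.sum_insert (by simp), h1, h2]

/-- Conjugation symmetry of the coefficients pairs the modes `κ` and `-κ`. The unpaired mode `-L_N`
drops out since the symbol vanishes at `-π`; its factor is present in the product only if `M < N`.
-/
theorem isSelfAdjoint_smearedKS (hd : IsDaubechies K h s) {L : ℝ} (hL : 0 < L) {L₀ M : ℕ}
    (h0 : 0 < L₀) (b : Sector) (χ : ℤˣ) (X : LatIndex L₀ M → ℝ) {N : ℕ} (hN : M < N) :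
    IsSelfAdjoint (smearedKS h L L₀ b χ X N) := by
  set g : ℤ → (OneParticle →L[ℂ] OneParticle) := fun κ =>
    loopToScale h L X N κ • transport (momentumMap L₀ N) (ksOperator L L₀ b χ N κ) with hg
  have hstar : ∀ κ, star (g κ) = g (-κ) := by
    intro κ
    simp only [hg]
    rw [star_smul, star_transport, star_ksOperator hL h0, RCLike.star_def, conj_loopToScale]
  have hA : (0 : ℤ) < latSize L₀ N := by exact_mod_cast latSize_pos h0 N
  have h1 : g (-(latSize L₀ N : ℤ)) = 0 := by
    simp only [hg]
    rw [hd.loopToScale_neg_latSize hL h0 X hN, zero_smul]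
  have h2 : g (latSize L₀ N : ℤ) = 0 := by
    have := hstar (-(latSize L₀ N : ℤ))
    rwa [h1, star_zero, neg_neg, eq_comm] at this
  have e : smearedKS h L L₀ b χ X N =
      (2 * (latSize L₀ N : ℂ))⁻¹ • ∑ κ ∈ Finset.Ico (-(latSize L₀ N : ℤ)) (latSize L₀ N), g κ := by
    rw [smearedKS, ← Finset.sum_coe_sort _ g]
  rw [e, IsSelfAdjoint, star_smul, star_sum]
  simp only [hstar]
  rw [sum_Ico_neg_eq hA g h1 h2]
  congr 1
  simp

/-- Modes shifted out of the momentum window wrap around to another plane wave; hence the bound on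
transported approximants holds for all `κ`, however large. -/
theorem norm_momentumMap_latVec {L₀ : ℕ} (h0 : 0 < L₀) (N : ℕ) (m : ℤ) :
    ‖momentumMap L₀ N (latVec L₀ N m)‖ = 1 := by
  obtain ⟨l, hl, hml⟩ := exists_mem_modEq h0 N m
  rw [latVec_congr hml, momentumMap, latMap_latVec _ hl, norm_stdVec]

theorem norm_transport_ksOperator_le {L : ℝ} (hL : 0 < L) {L₀ : ℕ} (h0 : 0 < L₀) (b : Sector)
    (χ : ℤˣ) {N : ℕ} (κ : ℤ) {n : ℤ}
    (hn : n ∈ Finset.Ico (-(latSize L₀ N : ℤ)) (latSize L₀ N)) :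
    ‖transport (momentumMap L₀ N) (ksOperator L L₀ b χ N κ) (stdVec n)‖ ≤
      1 + |(n : ℝ)| + |(κ : ℝ)| := by
  simp only [transport, ContinuousLinearMap.comp_apply]
  rw [adjoint_momentumMap_stdVec hn, ksOperator_latVec b χ κ hn, map_smul, norm_smul,
    norm_momentumMap_latVec h0, mul_one, Complex.norm_real]
  exact abs_ksCoeff_le hL h0 b χ N κ n

theorem smearedTerm_eq (s : ℝ → ℝ) (L : ℝ) (L₀ : ℕ) (b : Sector) (χ : ℤˣ) {M : ℕ}
    (X : LatIndex L₀ M → ℝ) (n κ : ℤ) : smearedTerm s L L₀ b χ X n κ =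
      ((2 * (L : ℂ))⁻¹ * loopToLimit s L X κ) • virasoroVec L b χ κ n := by
  rw [smearedTerm, smul_smul]

theorem summable_loopToLimit {C : ℝ} (hC : ∀ p, ‖fourierHat s p‖ * (1 + p ^ 2) ^ 4 ≤ C) {L : ℝ}
    (hL : 0 < L) {L₀ M : ℕ} (h0 : 0 < L₀) (X : LatIndex L₀ M → ℝ) :
    Summable fun κ : ℤ => ‖(2 * (L : ℂ))⁻¹ * loopToLimit s L X κ‖ * (1 + (κ : ℝ) ^ 2) ^ 3 := by
  have hA : (0 : ℝ) < latSize L₀ M := by exact_mod_cast latSize_pos h0 M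
  have h1 := exists_fourierHat_decay_int hC (by positivity : 0 < Real.pi / latSize L₀ M)
  refine Summable.of_nonneg_of_le (fun κ => by positivity) (fun κ => ?_)
    (h1.mul_left (‖(2 * (latSize L₀ M : ℂ))⁻¹‖ * ∑ j, |X j|))
  rw [loopToLimit_eq hL h0, norm_mul, norm_mul, latSpacing_mul hL h0]
  calc _ ≤ ‖(2 * (latSize L₀ M : ℂ))⁻¹‖ * ‖fourierHat s (Real.pi / latSize L₀ M * κ)‖ *
        (∑ j, |X j|) * (1 + (κ : ℝ) ^ 2) ^ 3 := by gcongr; exact norm_loopHat_le L X κ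
    _ = _ := by ring

/-- The iterated two-scale relation turns the partial product into `ŝ(ε_M k) / ŝ(ε_N k)`, and the
denominator tends to `ŝ(0) = 1`. -/
theorem tendsto_loopToScale (hd : IsDaubechies K h s) (hs : Continuous s) {L : ℝ} (hL : 0 < L)
    {L₀ M : ℕ} (h0 : 0 < L₀) (X : LatIndex L₀ M → ℝ) (κ : ℤ) :
    Tendsto (fun N => (2 * (latSize L₀ N : ℂ))⁻¹ * loopToScale h L X N κ) atTop
      (𝓝 ((2 * (L : ℂ))⁻¹ * loopToLimit s L X κ)) := by
  set x : ℝ := Real.pi / L * κ with hx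
  have h1 : Tendsto (fun N => fourierHat s (latSpacing L L₀ N * x)) atTop (𝓝 1) := by
    have h2 : Tendsto (fun N => latSpacing L L₀ N * x) atTop (𝓝 0) := by
      simpa using (tendsto_latSpacing L h0).mul_const x
    have h3 := ((continuous_fourierHat (hd.integrable hs)).tendsto 0).comp h2
    rwa [fourierHat_zero hd.integral_eq_one] at h3
  have h4 : Tendsto (fun N => fourierHat s (latSpacing L L₀ M * x) /
      fourierHat s (latSpacing L L₀ N * x)) atTop (𝓝 (fourierHat s (latSpacing L L₀ M * x))) := by
    have h2 := (tendsto_const_nhds (x := fourierHat s (latSpacing L L₀ M * x))).div h1 one_ne_zero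
    rw [div_one] at h2
    exact h2
  have h5 := (h4.const_mul (2 * (latSize L₀ M : ℂ))⁻¹).mul_const (loopHat L X κ)
  rw [loopToLimit_eq hL h0]
  refine h5.congr' ?_
  filter_upwards [eventually_ge_atTop M, h1.eventually_ne one_ne_zero] with N hN hne
  rw [loopToScale_eq h0 X hN, hd.fourierHat_eq_prod hs L L₀ M x hN, mul_div_cancel_right₀ _ hne]

/-- The same quotient; inside the lattice window `|ε_N k| ≤ π`, so its denominator is at least `c`.
This makes the decay of the coefficients in `κ` uniform in `N`. -/
theorem norm_loopToScale_le (hd : IsDaubechies K h s) (hs : Continuous s) {c : ℝ} (hc0 : 0 < c)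
    (hc : ∀ p : ℝ, |p| ≤ Real.pi → c ≤ ‖fourierHat s p‖) {L : ℝ} (hL : 0 < L) {L₀ M : ℕ}
    (h0 : 0 < L₀) (X : LatIndex L₀ M → ℝ) {N : ℕ} (hN : M ≤ N) {κ : ℤ}
    (hκ : κ ∈ Finset.Ico (-(latSize L₀ N : ℤ)) (latSize L₀ N)) :
    ‖(2 * (latSize L₀ N : ℂ))⁻¹ * loopToScale h L X N κ‖ ≤
      c⁻¹ * ‖(2 * (latSize L₀ M : ℂ))⁻¹‖ * (∑ j, |X j|) *
        ‖fourierHat s (Real.pi / latSize L₀ M * κ)‖ := by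
  have hA : (0 : ℝ) < latSize L₀ N := by exact_mod_cast latSize_pos h0 N
  have h1 := hd.fourierHat_eq_prod hs L L₀ M (Real.pi / L * κ) hN
  rw [loopToScale_eq h0 X hN, norm_mul, norm_mul]
  set P := ∏ j ∈ Finset.Ioc M N, filterSymbol h (latSpacing L L₀ j * (Real.pi / L * κ)) with hP
  have h2 : c ≤ ‖fourierHat s (latSpacing L L₀ N * (Real.pi / L * κ))‖ := by
    refine hc _ ?_
    rw [latSpacing_mul hL h0, abs_mul, abs_of_pos (by positivity : 0 < Real.pi / latSize L₀ N),
      div_mul_eq_mul_div, div_le_iff₀ hA]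
    refine mul_le_mul_of_nonneg_left ?_ Real.pi_pos.le
    rw [Finset.mem_Ico] at hκ
    rw [abs_le]
    constructor
    · exact_mod_cast hκ.1
    · exact_mod_cast hκ.2.le
  have h3 : ‖P‖ ≤ c⁻¹ * ‖fourierHat s (Real.pi / latSize L₀ M * κ)‖ := by
    rw [← latSpacing_mul hL h0, h1, norm_mul, inv_mul_eq_div, le_div_iff₀ hc0]
    gcongr
  calc _ ≤ ‖(2 * (latSize L₀ M : ℂ))⁻¹‖ *
        (c⁻¹ * ‖fourierHat s (Real.pi / latSize L₀ M * κ)‖) * ∑ j, |X j| := by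
        gcongr
        exact norm_loopHat_le L X κ
    _ = _ := by ring

theorem tendsto_smearedKS (hd : IsDaubechies K h s) (hs : ContDiff ℝ (8 : ℕ) s) {L : ℝ} (hL : 0 < L)
    {L₀ M : ℕ} (h0 : 0 < L₀) (b : Sector) (χ : ℤˣ) (X : LatIndex L₀ M → ℝ) (n : ℤ) :
    Tendsto (fun N => smearedKS h L L₀ b χ X N (stdVec n)) atTop
      (𝓝 (∑' κ, smearedTerm s L L₀ b χ X n κ)) := by
  obtain ⟨C, hC⟩ := exists_fourierHat_decay hs hd.hasCompactSupport
  obtain ⟨c, hc0, hc⟩ := hd.exists_le_norm_fourierHat hs.continuous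
  have hA : (0 : ℝ) < latSize L₀ M := by exact_mod_cast latSize_pos h0 M
  set I' : ℕ → Finset ℤ := fun N => Finset.Ico (-(latSize L₀ N : ℤ)) (latSize L₀ N) with hI'
  -- Extension by zero turns the sums over growing windows into series over a fixed index set, ready
  -- for dominated convergence.
  set F : ℕ → ℤ → OneParticle := fun N κ => if κ ∈ I' N then
    ((2 * (latSize L₀ N : ℂ))⁻¹ * loopToScale h L X N κ) •
      transport (momentumMap L₀ N) (ksOperator L L₀ b χ N κ) (stdVec n) else 0 with hF
  have hsum := (summable_of_summable_mul_weight (exists_fourierHat_decay_int hC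
    (by positivity : 0 < Real.pi / latSize L₀ M)) (1 + |(n : ℝ)|)).mul_left
    (c⁻¹ * ‖(2 * (latSize L₀ M : ℂ))⁻¹‖ * ∑ j, |X j|)
  have hlim := tendsto_tsum_of_dominated_convergence (𝓕 := atTop) (f := F)
    (g := fun κ => smearedTerm s L L₀ b χ X n κ) hsum (fun κ => by
      rw [smearedTerm_eq]
      refine ((tendsto_loopToScale hd hs.continuous hL h0 X κ).smul
        ((isAsymptoticEmbedding_momentumMap h0).tendsto_transport hL h0 b χ κ n)).congr' ?_
      filter_upwards [eventually_mem_lattice h0 κ] with N hN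
      simp only [hF]
      rw [if_pos hN])
    (by
      filter_upwards [eventually_mem_lattice h0 n, eventually_ge_atTop M] with N hn hN κ
      simp only [hF]
      split_ifs with hκ
      · rw [norm_smul, ← mul_assoc]
        exact mul_le_mul (norm_loopToScale_le hd hs.continuous hc0 hc hL h0 X hN hκ)
          (norm_transport_ksOperator_le hL h0 b χ κ hn) (norm_nonneg _) (by positivity)
      · rw [norm_zero]; positivity)
  refine hlim.congr fun N => ?_
  rw [tsum_eq_sum (s := I' N) (fun κ hκ => by simp only [hF]; rw [if_neg hκ]), smearedKS,
    smul_apply, sum_apply, Finset.smul_sum, ← Finset.sum_coe_sort]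
  refine Finset.sum_congr rfl fun κ _ => ?_
  simp only [hF]
  rw [if_pos κ.2, smul_apply, smul_smul]

theorem summable_smearedTerm (hd : IsDaubechies K h s) (hs : ContDiff ℝ (8 : ℕ) s) {L : ℝ}
    (hL : 0 < L) {L₀ M : ℕ} (h0 : 0 < L₀) (b : Sector) (χ : ℤˣ) (X : LatIndex L₀ M → ℝ) (n : ℤ) :
    Summable (smearedTerm s L L₀ b χ X n) := by
  obtain ⟨C, hC⟩ := exists_fourierHat_decay hs hd.hasCompactSupport
  simp only [funext (smearedTerm_eq s L L₀ b χ X n)]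
  exact summable_smul_virasoroVec hL.ne' b χ (summable_loopToLimit hC hL h0 X) n

/-- Convergence of the smeared Koo–Saleur approximants. -/
theorem bogoliubovConvergence_smeared (hd : IsDaubechies K h s) (hs : ContDiff ℝ (8 : ℕ) s) {L : ℝ}
    (hL : 0 < L) {L₀ M : ℕ} (h0 : 0 < L₀) (b : Sector) (χ : ℤˣ) (X : LatIndex L₀ M → ℝ)
    (ρ : CARRep OneParticle) :
    BogoliubovConvergence ρ (fun N => smearedKS h L L₀ b χ X (M + 1 + N))
      (smearedVirasoro s L L₀ b χ X) := by
  obtain ⟨C, hC⟩ := exists_fourierHat_decay hs hd.hasCompactSupport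
  have hfo := isFirstOrder_virasoro hL.ne' b χ
    (s := fun κ => (2 * (L : ℂ))⁻¹ * loopToLimit s L X κ) (fun κ => by
      rw [map_mul, conj_loopToLimit, map_inv₀, map_mul, Complex.conj_ofReal, Complex.conj_ofNat])
    (summable_loopToLimit hC hL h0 X)
  simp only [← smearedTerm_eq] at hfo
  -- The offset `M + 1 + N` keeps every scale strictly above `M`, where the approximants are
  -- self-adjoint.
  refine hfo.bogoliubovConvergence ρ
    (fun N => isSelfAdjoint_smearedKS hd hL h0 b χ X (by omega)) (stdOperator_domain _)
    (fun n hn => stdOperator_planeWaves _ n hn) (fun n => ?_)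
  rw [coe_planeWaves]
  refine (tendsto_smearedKS hd hs hL h0 b χ X n).comp ?_
  exact tendsto_atTop_mono (fun N => Nat.le_add_left N (M + 1)) tendsto_id

end Smearing
theorem mainTheorem8 :
    ∃ α₀ : ℕ, ∀ (L : ℝ) (L₀ : ℕ) (b : Sector) (χ : ℤˣ), 0 < L → 0 < L₀ →
      (∀ (K : ℕ) (h : ℤ →₀ ℝ) (s : ℝ → ℝ), IsDaubechies K h s → ContDiff ℝ α₀ s →
        (∀ (ι : Type) [LinearOrder ι] (Q : QuasiFree OneParticle ι) (κ : ℤ),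
          BogoliubovConvergence Q.rep
            (fun N => transport (waveletMap s L L₀ b N) (ksRe L L₀ b χ N κ))
            (virasoroRe L b χ κ) ∧
          BogoliubovConvergence Q.rep
            (fun N => transport (waveletMap s L L₀ b N) (ksIm L L₀ b χ N κ))
            (virasoroIm L b χ κ)) ∧
        ∀ (M : ℕ) (X : LatIndex L₀ M → ℝ),
          (∀ n : ℤ, Summable (smearedTerm s L L₀ b χ X n)) ∧
          BogoliubovConvergence (scalingLimitRep L χ b)
            (fun N => smearedKS h L L₀ b χ X (M + 1 + N))
            (smearedVirasoro s L L₀ b χ X)) ∧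
      ∀ κ : ℤ,
        BogoliubovConvergence (scalingLimitRep L χ b)
          (fun N => transport (momentumMap L₀ N) (ksRe L L₀ b χ N κ))
          (virasoroRe L b χ κ) ∧
        BogoliubovConvergence (scalingLimitRep L χ b)
          (fun N => transport (momentumMap L₀ N) (ksIm L L₀ b χ N κ))
          (virasoroIm L b χ κ) := by
  -- Eight derivatives give decay `(1 + p²)⁻⁴`: three powers pay for the commutator estimate and one
  -- for summability over the modes.
  refine ⟨8, fun L L₀ b χ hL h0 => ⟨fun K h s hd hs => ⟨fun ι _ Q κ => ?_, fun M X => ?_⟩,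
    fun κ => ?_⟩⟩
  · have hR := isAsymptoticEmbedding_waveletMap hd hs hL h0 b
    exact ⟨hR.bogoliubovConvergence_re hL h0 b χ Q.rep κ,
      hR.bogoliubovConvergence_im hL h0 b χ Q.rep κ⟩
  · exact ⟨summable_smearedTerm hd hs hL h0 b χ X, bogoliubovConvergence_smeared hd hs hL h0 b χ X _⟩
  · have hR := isAsymptoticEmbedding_momentumMap h0
    exact ⟨hR.bogoliubovConvergence_re hL h0 b χ _ κ, hR.bogoliubovConvergence_im hL h0 b χ _ κ⟩
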